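/- Let $\mathbf{M}$ be a complete and cocomplete closed symmetric monoidal category with unit object $I$ and braiding $\tau$, and let $\mathbf{Mon}_{\mathbf M}$ be its category of monoids. Let $\overline{\mathbf D}=(\mathbf D,\perp)$ be an orthogonal category: a small category $\mathbf D$ with a set $\perp$ of pairs of morphisms with common target that is symmetric and stable under post- and pre-composition. For an orthogonal category $\overline{\mathbf E}=(\mathbf E,\perp)$ let $\mathcal O_{\overline{\mathbf E}}$ be the symmetric coloured operad whose colours are the objects of $\mathbf E$ and whose operations from $(c_1,\dots,c_n)$ to $t$ are the pairs $(\sigma,\underline f)\in\Sigma_n\times\prod_i\mathbf E(c_i,t)$, modulo the equivalence relation generated by transpositions of adjacent orthogonal pairs in the sequence $\underline f\sigma^{-1}=(f_{\sigma^{-1}(1)},\dots,f_{\sigma^{-1}(n)})$; here permutations act by $(\sigma,\underline f)\mapsto(\sigma\sigma',\underline f\sigma')$, composition is $(\sigma,\underline f),(\sigma_i,\underline g_i)\mapsto(\sigma(\sigma_1,\dots,\sigma_m),\underline f(\underline g_1,\dots,\underline g_m))$ and the units are $(e,\mathrm{id}_t)$. Let $\mathbf{Alg}(\mathcal O_{\overline{\mathbf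 E}})$ be its category of algebras in $\mathbf M$, and let $p_{\overline{\mathbf E}}^*:\mathbf{Alg}(\mathcal O_{\overline{\mathbf E}})\to\mathbf{Mon}_{\mathbf M}^{\mathbf E}$ send an algebra to its underlying monoid-valued functor. Let $j:\mathbf C\to\mathbf D$ be the inclusion of a full subcategory, put $\overline{\mathbf C}=(\mathbf C,j^*(\perp))$, where $(f_1,f_2)\in j^*(\perp)$ if and only if $j(f_1)\perp j(f_2)$, and let $\mathcal O_j^*:\mathbf{Alg}(\mathcal O_{\overline{\mathbf D}})\to\mathbf{Alg}(\mathcal O_{\overline{\mathbf C}})$ be restriction along $j$, with left adjoint $\mathcal O_{j!}$. A functor $\mathfrak B:\mathbf D\to\mathbf{Mon}_{\mathbf M}$ is $\perp$-commutative over $d\in\mathbf D$ if $\mu_d\circ(\mathfrak B(f_1)\otimes\mathfrak B(f_2))=\mu_d\circ\tau\circ(\mathfrak B(f_1)\otimes\mathfrak B(f_2))$ for all $f_1\perp f_2$ with target $d$, and $\perp$-commutative if this holds over every $d$. An object $d\in\mathbf D$ is $j$-closed if for all $c_1,c_2\in\mathbf C$ and all $(g_1:c_1\to d)\perp(g_2:c_2\to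 d)$ there are $c\in\mathbf C$, $g:c\to d$ and $f_i:c_i\to c$ with $g_i=g f_i$ for $i=1,2$ and $(f_1,f_2)\in j^*(\perp)$. (1) Suppose that the two coprojections $I\rightrightarrows I\sqcup I$ are distinct. Then for every $d\in\mathbf D$ the following are equivalent: the left Kan extension $\operatorname{Lan}_j p_{\overline{\mathbf C}}^*(A)\in\mathbf{Mon}_{\mathbf M}^{\mathbf D}$ is $\perp$-commutative over $d$ for all $A\in\mathbf{Alg}(\mathcal O_{\overline{\mathbf C}})$; the object $d$ is $j$-closed. (2) If $A\in\mathbf{Alg}(\mathcal O_{\overline{\mathbf C}})$ is such that $\operatorname{Lan}_j p_{\overline{\mathbf C}}^*(A)$ is $\perp$-commutative, then there is an isomorphism $\operatorname{Lan}_j p_{\overline{\mathbf C}}^*(A)\cong p_{\overline{\mathbf D}}^*\,\mathcal O_{j!}(A)$ in $\mathbf{Mon}_{\mathbf M}^{\mathbf D}$. -/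

import Mathlib

open CategoryTheory MonoidalCategory Limits

universe w v₁ v₂ u₁ u₂ u

namespace QFTOperad

/-! ### Orthogonal categories -/

/-- An orthogonality relation on a category: a symmetric set of pairs of morphisms with common
target which is stable under post- and precomposition. -/
structure Orthogonality (C : Type u₁) [Category.{v₁} C] where
  rel : ∀ {c₁ c₂ c : C}, (c₁ ⟶ c) → (c₂ ⟶ c) → Prop
  symm : ∀ {c₁ c₂ c : C} {f₁ : c₁ ⟶ c} {f₂ : c₂ ⟶ c}, rel f₁ f₂ → rel f₂ f₁
  postcomp : ∀ {c₁ c₂ c c' : C} {f₁ : c₁ ⟶ c} {f₂ : c₂ ⟶ c} (g : c ⟶ c'),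
    rel f₁ f₂ → rel (f₁ ≫ g) (f₂ ≫ g)
  precomp : ∀ {b₁ b₂ c₁ c₂ c : C} {f₁ : c₁ ⟶ c} {f₂ : c₂ ⟶ c} (h₁ : b₁ ⟶ c₁) (h₂ : b₂ ⟶ c₂),
    rel f₁ f₂ → rel (h₁ ≫ f₁) (h₂ ≫ f₂)

/-- The pullback orthogonality relation `F^*(⊥)`. -/
def Orthogonality.pullback {C : Type u₁} [Category.{v₁} C] {D : Type u₂} [Category.{v₂} D]
    (R : Orthogonality D) (F : C ⥤ D) : Orthogonality C where
  rel f₁ f₂ := R.rel (F.map f₁) (F.map f₂)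
  symm h := R.symm h
  postcomp g h := by simpa using R.postcomp (F.map g) h
  precomp h₁ h₂ h := by simpa using R.precomp (F.map h₁) (F.map h₂) h

/-! ### Profiles -/

/-- `Pos c x` is the type of positions in the profile `c` whose entry is the colour `x`. -/
inductive Pos {K : Type u} : List K → K → Type u
  | here {x : K} {l : List K} : Pos (x :: l) x
  | there {x y : K} {l : List K} : Pos l x → Pos (y :: l) x

/-- The inputs of a profile `c`: its positions, together with their colours. -/
abbrev Input {K : Type u} (c : List K) : Type u := Σ x : K, Pos c x

/-- The list of all inputs of a profile, from left to right. -/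
def allInputs {K : Type u} : (c : List K) → List (Input c)
  | [] => []
  | x :: l => ⟨x, Pos.here⟩ :: (allInputs l).map (fun p => ⟨p.1, Pos.there p.2⟩)

/-- `Concat l l' l''` witnesses that `l''` is the concatenation `l ++ l'`
(there is exactly one element if this holds, and none otherwise). -/
inductive Concat {K : Type u} : List K → List K → List K → Type u
  | nil (l : List K) : Concat [] l l
  | cons (x : K) {l l' l'' : List K} : Concat l l' l'' → Concat (x :: l) l' (x :: l'')

/-- Positions of the left part, as positions of a concatenation. -/
def Concat.inl {K : Type u} {x : K} :
    {l l' l'' : List K} → Concat l l' l'' → Pos l x → Pos l'' x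
  | _, _, _, .cons _ _, .here => .here
  | _, _, _, .cons _ k, .there p => .there (k.inl p)

/-- Positions of the right part, as positions of a concatenation. -/
def Concat.inr {K : Type u} {x : K} :
    {l l' l'' : List K} → Concat l l' l'' → Pos l' x → Pos l'' x
  | _, _, _, .nil _, p => p
  | _, _, _, .cons _ k, p => .there (k.inr p)

/-- An adjacent transposition `l → l'` of profiles: `l = a ++ [x, y] ++ b` and
`l' = a ++ [y, x] ++ b`. These generate the groupoid of profiles and permutations. -/
inductive AdjSwap {K : Type u} : List K → List K → Type u
  | here (x y : K) (l : List K) : AdjSwap (x :: y :: l) (y :: x :: l)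
  | there (z : K) {l l' : List K} : AdjSwap l l' → AdjSwap (z :: l) (z :: l')

/-- The bijection between the positions of `l` and those of `l'` given by an adjacent
transposition. -/
def AdjSwap.pos {K : Type u} {z : K} : {l l' : List K} → AdjSwap l l' → Pos l z → Pos l' z
  | _, _, .here _ _ _, .here => .there .here
  | _, _, .here _ _ _, .there .here => .here
  | _, _, .here _ _ _, .there (.there p) => .there (.there p)
  | _, _, .there _ _, .here => .here
  | _, _, .there _ s, .there p => .there (s.pos p)

theorem allInputs_concat {K : Type u} : {l l' l'' : List K} → (k : Concat l l' l'') →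
    allInputs l'' = (allInputs l).map (fun p => ⟨p.1, k.inl p.2⟩) ++
      (allInputs l').map (fun p => ⟨p.1, k.inr p.2⟩)
  | _, _, _, .nil _ => by simp [allInputs, Concat.inr]
  | _, _, _, .cons _ k => by
      simp [allInputs, allInputs_concat k, Concat.inl, Concat.inr, Function.comp_def]

theorem allInputs_adjSwap {K : Type u} : {l l' : List K} → (s : AdjSwap l l') →
    ((allInputs l).map (fun p => (⟨p.1, s.pos p.2⟩ : Input l'))).Perm (allInputs l')
  | _, _, .here x y l => by
      simpa [allInputs, Function.comp_def, AdjSwap.pos] using List.Perm.swap _ _ _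
  | _, _, .there z s => by
      have := (allInputs_adjSwap s).map (fun p => (⟨p.1, Pos.there p.2⟩ : Input (z :: _)))
      simpa [allInputs, Function.comp_def, AdjSwap.pos] using this

section Operations

variable {C : Type u₁} [Category.{v₁} C]

/-! ### The operations -/

/-- A letter: an input of the profile `c` together with a morphism from its colour to `t`. -/
structure Letter (c : List C) (t : C) where
  src : C
  pos : Pos c src
  hom : src ⟶ t

/-- The input occurring in a letter. -/
def Letter.input {c : List C} {t : C} (a : Letter c t) : Input c := ⟨a.src, a.pos⟩

/-- The set `Σ_n × ∏ᵢ C(cᵢ, t)` for a profile `c = (c₁, …, cₙ)`. The pair `(σ, f)` is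
recorded as the sequence `f σ⁻¹ = (f_{σ⁻¹(1)}, …, f_{σ⁻¹(n)})`, each entry being labelled by the
input `σ⁻¹(k)` that it belongs to; so every input occurs exactly once. It represents the
operation `Φ₁ ⊗ ⋯ ⊗ Φₙ ↦ f_{σ⁻¹(1)}(Φ_{σ⁻¹(1)}) ⋯ f_{σ⁻¹(n)}(Φ_{σ⁻¹(n)})`. -/
@[ext]
structure Word (c : List C) (t : C) where
  letters : List (Letter c t)
  linear : (letters.map Letter.input).Perm (allInputs c)

/-- Transposition of a pair of orthogonal morphisms that are adjacent in `f σ⁻¹`. -/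
def Word.Step (R : Orthogonality C) {c : List C} {t : C} (w w' : Word c t) : Prop :=
  ∃ (l r : List (Letter c t)) (a b : Letter c t), R.rel a.hom b.hom ∧
    w.letters = l ++ a :: b :: r ∧ w'.letters = l ++ b :: a :: r

/-- The set of operations of the operad of `(C, ⊥)` with inputs `c` and output `t`: words modulo
the equivalence relation generated by transpositions of adjacent orthogonal pairs. -/
def Operation (R : Orthogonality C) (c : List C) (t : C) : Type (max u₁ v₁) :=
  Quot (Word.Step R (c := c) (t := t))

/-- The class of a word. -/
def Word.toOp (R : Orthogonality C) {c : List C} {t : C} (o : Word c t) : Operation R c t :=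
  Quot.mk _ o

/-- The unary operation given by a morphism. -/
def Word.ofHom {c t : C} (f : c ⟶ t) : Word [c] t where
  letters := [⟨c, .here, f⟩]
  linear := List.Perm.refl _

/-- The operadic unit. -/
def Word.one (t : C) : Word [t] t := Word.ofHom (𝟙 t)

/-- The action of an adjacent transposition of profiles, which relabels the inputs: `(σ, f)` is
sent to `(σ σ', f σ')`. -/
def Word.permute {c c' : List C} {t : C} (s : AdjSwap c c') (o : Word c t) : Word c' t where
  letters := o.letters.map (fun a => ⟨a.src, s.pos a.pos, a.hom⟩)
  linear := by
    have := (o.linear.map (fun p => (⟨p.1, s.pos p.2⟩ : Input c'))).trans (allInputs_adjSwap s)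
    simpa [Function.comp_def, Letter.input] using this

/-- A family of words `(o₁, …, oₘ)`, with `oᵢ` of profile `bᵢ` and target `aᵢ`, where
`a = (a₁, …, aₘ)` and `b` is the concatenation of `b₁, …, bₘ`. -/
inductive Forest : List C → List C → Type (max u₁ v₁)
  | nil : Forest [] []
  | cons {b bs b' : List C} {a : C} {as : List C} (k : Concat b bs b') (o : Word b a)
      (φ : Forest bs as) : Forest b' (a :: as)

/-- Substitution into one letter `f(x_p)`: the morphisms of the word `o_p = (τ, g)` are composed
with `f` and its inputs are relabelled as inputs of the concatenated profile. -/
def Forest.subst {t : C} : {b a : List C} → Forest b a → {x : C} → Pos a x → (x ⟶ t) →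
    List (Letter b t)
  | _, _, .cons k o _, _, .here, f => o.letters.map (fun l => ⟨l.src, k.inl l.pos, l.hom ≫ f⟩)
  | _, _, .cons k _ φ, _, .there p, f =>
      (φ.subst p f).map (fun l => ⟨l.src, k.inr l.pos, l.hom⟩)

theorem Forest.linear : {b a : List C} → (φ : Forest b a) →
    ((allInputs a).flatMap (fun p => (φ.subst p.2 (𝟙 p.1)).map Letter.input)).Perm (allInputs b)
  | _, _, .nil => by simp [allInputs]
  | _, _, .cons (a := a) (as := as) k o φ => by
      have h1 := o.linear.map (fun p => (⟨p.1, k.inl p.2⟩ : Input _))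
      have h2 := φ.linear.map (fun p => (⟨p.1, k.inr p.2⟩ : Input _))
      rw [allInputs_concat k]
      simp only [List.map_map, List.map_flatMap, Function.comp_def, Letter.input] at h1 h2
      simpa [allInputs, Forest.subst, List.flatMap_map, Function.comp_def, Letter.input]
        using h1.append h2

theorem Forest.subst_input {t t' : C} : {b a : List C} → (φ : Forest b a) → {x : C} →
    (p : Pos a x) → (f : x ⟶ t) → (f' : x ⟶ t') →
    (φ.subst p f).map Letter.input = (φ.subst p f').map Letter.input
  | _, _, .cons k o _, _, .here, f, f' => by simp [Forest.subst, Letter.input, Function.comp_def]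
  | _, _, .cons k o φ, _, .there p, f, f' => by
      have := congrArg (List.map (fun p => (⟨p.1, k.inr p.2⟩ : Input _))) (φ.subst_input p f f')
      simpa [Forest.subst, Letter.input, Function.comp_def] using this

/-- The operadic composition `γ(o; o₁, …, oₘ)`. In terms of pairs it is
`(σ, f), (σᵢ, gᵢ) ↦ (σ(σ₁, …, σₘ), f(g₁, …, gₘ))`: the block of `oᵢ` takes the place of the
`i`-th input of `o`. -/
def Word.comp {b a : List C} {t : C} (o : Word a t) (φ : Forest b a) : Word b t where
  letters := o.letters.flatMap (fun l => φ.subst l.pos l.hom)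
  linear := by
    have h := (o.linear.flatMap_right
      (fun p => (φ.subst p.2 (𝟙 p.1)).map Letter.input)).trans φ.linear
    rw [List.flatMap_map] at h
    rw [List.map_flatMap]
    convert h using 3 with l
    exact φ.subst_input l.pos l.hom (𝟙 l.src)

end Operations

section Algebras

variable {C : Type u₁} [Category.{v₁} C] {M : Type u} [Category.{w} M] [MonoidalCategory M]

/-! ### Tensor products over profiles -/

/-- The tensor product `A_{c₁} ⊗ ⋯ ⊗ A_{cₙ}` over a profile (the unit object for `n = 0`). -/
def tensorList {K : Type u₁} (A : K → M) : List K → M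
  | [] => 𝟙_ M
  | x :: l => A x ⊗ tensorList A l

/-- A family of morphisms induces a morphism between the tensor products. -/
def tensorListMap {K : Type u₁} {A B : K → M} (f : ∀ x, A x ⟶ B x) :
    (l : List K) → (tensorList A l ⟶ tensorList B l)
  | [] => 𝟙 (𝟙_ M)
  | x :: l => f x ⊗ₘ tensorListMap f l

/-- The canonical isomorphism splitting the tensor product over a concatenation. -/
def tensorConcat {K : Type u₁} (A : K → M) : {l l' l'' : List K} → Concat l l' l'' →
    (tensorList A l'' ≅ tensorList A l ⊗ tensorList A l')
  | _, _, _, .nil l => (λ_ (tensorList A l)).symm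
  | _, _, _, .cons x k => whiskerLeftIso (A x) (tensorConcat A k) ≪≫ (α_ _ _ _).symm

/-- The symmetric braiding of `M` permuting the tensor factors by an adjacent transposition. -/
def tensorSwap [BraidedCategory M] {K : Type u₁} (A : K → M) : {l l' : List K} → AdjSwap l l' →
    (tensorList A l ⟶ tensorList A l')
  | _, _, .here x y l =>
      (α_ (A x) (A y) (tensorList A l)).inv ≫ ((β_ (A x) (A y)).hom ▷ tensorList A l) ≫
        (α_ (A y) (A x) (tensorList A l)).hom
  | _, _, .there z s => A z ◁ tensorSwap A s

/-- The tensor product `α(o₁) ⊗ ⋯ ⊗ α(oₘ)`, as a morphism between tensor products over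
profiles. -/
def Forest.eval {A : C → M} (α : ∀ {c : List C} {t : C}, Word c t → (tensorList A c ⟶ A t)) :
    {b a : List C} → Forest b a → (tensorList A b ⟶ tensorList A a)
  | _, _, .nil => 𝟙 (𝟙_ M)
  | _, _, .cons k o φ => (tensorConcat A k).hom ≫ (α o ⊗ₘ φ.eval α)

/-! ### Algebras over the operad of an orthogonal category -/

/-- An algebra in `M` over the operad of the orthogonal category `(C, R)`: a family of objects
`A_c` with structure maps `A_{c₁} ⊗ ⋯ ⊗ A_{cₙ} ⟶ A_t`, one for each operation, which are
unital, equivariant (it suffices to say so for adjacent transpositions) and associative.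
As `M` is closed and cocomplete, families of such maps are the same thing as morphisms
`(O(t; c) ⊗ I) ⊗ A_{c₁} ⊗ ⋯ ⊗ A_{cₙ} ⟶ A_t`, where `O(t; c) ⊗ I` is the copower. -/
structure Alg (R : Orthogonality C) (M : Type u) [Category.{w} M] [MonoidalCategory M]
    [BraidedCategory M] where
  obj : C → M
  act : ∀ {c : List C} {t : C}, Operation R c t → (tensorList obj c ⟶ obj t)
  act_one : ∀ t : C, act ((Word.one t).toOp R) = (ρ_ (obj t)).hom
  act_permute : ∀ {c c' : List C} {t : C} (s : AdjSwap c c') (o : Word c t),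
    act (o.toOp R) = tensorSwap obj s ≫ act ((o.permute s).toOp R)
  act_comp : ∀ {b a : List C} {t : C} (o : Word a t) (φ : Forest b a),
    act ((o.comp φ).toOp R) = φ.eval (fun o' => act (o'.toOp R)) ≫ act (o.toOp R)

theorem tensorListMap_id {K : Type u₁} (A : K → M) :
    (l : List K) → tensorListMap (fun x => 𝟙 (A x)) l = 𝟙 (tensorList A l)
  | [] => rfl
  | x :: l => by simp [tensorListMap, tensorList, tensorListMap_id A l]

theorem tensorListMap_comp {K : Type u₁} {A B D : K → M} (f : ∀ x, A x ⟶ B x)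
    (g : ∀ x, B x ⟶ D x) :
    (l : List K) → tensorListMap (fun x => f x ≫ g x) l = tensorListMap f l ≫ tensorListMap g l
  | [] => (Category.id_comp (𝟙 (𝟙_ M))).symm
  | x :: l => by
      simp only [tensorListMap, tensorListMap_comp f g l]
      exact (tensorHom_comp_tensorHom _ _ _ _).symm

variable [BraidedCategory M]

/-- Morphisms of algebras. -/
@[ext]
structure Alg.Hom {R : Orthogonality C} (A B : Alg R M) where
  app : ∀ c : C, A.obj c ⟶ B.obj c
  comm : ∀ {c : List C} {t : C} (o : Operation R c t),
    A.act o ≫ app t = tensorListMap app c ≫ B.act o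

instance (R : Orthogonality C) : Category (Alg R M) where
  Hom := Alg.Hom
  id A := ⟨fun c => 𝟙 (A.obj c), fun o => by simp [tensorListMap_id]⟩
  comp f g := ⟨fun c => f.app c ≫ g.app c, fun o => by
    rw [tensorListMap_comp, Category.assoc, ← g.comm, ← Category.assoc, f.comm, Category.assoc]⟩

@[ext]
theorem Alg.hom_ext {R : Orthogonality C} {A B : Alg R M} {f g : A ⟶ B}
    (h : ∀ c, f.app c = g.app c) : f = g :=
  Alg.Hom.ext (funext h)

@[simp]
theorem Alg.id_app {R : Orthogonality C} (A : Alg R M) (c : C) :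
    Alg.Hom.app (𝟙 A) c = 𝟙 (A.obj c) := rfl

@[simp]
theorem Alg.comp_app {R : Orthogonality C} {A B D : Alg R M} (f : A ⟶ B) (g : B ⟶ D) (c : C) :
    Alg.Hom.app (f ≫ g) c = f.app c ≫ g.app c := rfl

/-! ### The underlying monoid-valued functor -/

/-- The operation of arity `0` with target `c`, represented by the empty word. -/
def Word.unit (c : C) : Word [] c where
  letters := []
  linear := List.Perm.refl _

/-- The operation of arity `2` represented by the identity permutation and `(id_c, id_c)`. -/
def Word.mul (c : C) : Word [c, c] c where
  letters := [⟨c, .here, 𝟙 c⟩, ⟨c, .there .here, 𝟙 c⟩]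
  linear := List.Perm.refl _

theorem aux_one_mul {M : Type u} [Category.{w} M] [MonoidalCategory M] {X : M} (e : 𝟙_ M ⟶ X)
    (m : X ⊗ (X ⊗ 𝟙_ M) ⟶ X)
    (h : (ρ_ X).hom = ((λ_ (X ⊗ 𝟙_ M)).inv ≫ (e ⊗ₘ ((X ◁ (λ_ (𝟙_ M)).inv ≫
      (α_ X (𝟙_ M) (𝟙_ M)).inv) ≫ ((ρ_ X).hom ⊗ₘ 𝟙 (𝟙_ M))))) ≫ m) :
    e ▷ X ≫ X ◁ (ρ_ X).inv ≫ m = (λ_ X).hom := by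
  rw [← Category.comp_id (λ_ X).hom, ← Iso.inv_hom_id (ρ_ X), h]
  monoidal

theorem aux_mul_one {M : Type u} [Category.{w} M] [MonoidalCategory M] {X : M} (e : 𝟙_ M ⟶ X)
    (m : X ⊗ (X ⊗ 𝟙_ M) ⟶ X)
    (h : (ρ_ X).hom = ((X ◁ (λ_ (𝟙_ M)).inv ≫ (α_ X (𝟙_ M) (𝟙_ M)).inv) ≫
      ((ρ_ X).hom ⊗ₘ ((λ_ (𝟙_ M)).inv ≫ (e ⊗ₘ 𝟙 (𝟙_ M))))) ≫ m) :
    X ◁ e ≫ X ◁ (ρ_ X).inv ≫ m = (ρ_ X).hom := by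
  have h' := congrArg (fun x => (ρ_ X).hom ≫ (ρ_ X).inv ≫ x) h
  simp only [Iso.hom_inv_id_assoc] at h'
  rw [h']
  monoidal

theorem aux_mul_assoc {M : Type u} [Category.{w} M] [MonoidalCategory M] {X : M}
    (m : X ⊗ (X ⊗ 𝟙_ M) ⟶ X)
    (h : ((X ◁ (λ_ (X ⊗ X ⊗ 𝟙_ M)).inv ≫ (α_ X (𝟙_ M) (X ⊗ X ⊗ 𝟙_ M)).inv) ≫
        ((ρ_ X).hom ⊗ₘ ((X ◁ ((X ◁ (λ_ (𝟙_ M)).inv) ≫ (α_ X (𝟙_ M) (𝟙_ M)).inv) ≫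
          (α_ X (X ⊗ 𝟙_ M) (𝟙_ M)).inv) ≫ (m ⊗ₘ 𝟙 (𝟙_ M))))) ≫ m =
      ((X ◁ (X ◁ (λ_ (X ⊗ 𝟙_ M)).inv ≫ (α_ X (𝟙_ M) (X ⊗ 𝟙_ M)).inv) ≫
        (α_ X (X ⊗ 𝟙_ M) (X ⊗ 𝟙_ M)).inv) ≫
          (m ⊗ₘ ((X ◁ (λ_ (𝟙_ M)).inv ≫ (α_ X (𝟙_ M) (𝟙_ M)).inv) ≫
            ((ρ_ X).hom ⊗ₘ 𝟙 (𝟙_ M))))) ≫ m) :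
    (X ◁ (ρ_ X).inv ≫ m) ▷ X ≫ X ◁ (ρ_ X).inv ≫ m =
      (α_ X X X).hom ≫ X ◁ (X ◁ (ρ_ X).inv ≫ m) ≫ X ◁ (ρ_ X).inv ≫ m := by
  have h₃ := congrArg (fun x => (α_ X X X).hom ≫ (X ◁ X ◁ (ρ_ X).inv) ≫ x) h
  calc _ = _ := ?_
    _ = _ := h₃.symm
    _ = _ := ?_
  · monoidal
  · monoidal

theorem aux_map_comp {M : Type u} [Category.{w} M] [MonoidalCategory M] {X Y Z : M}
    (f : X ⊗ 𝟙_ M ⟶ Y) (g : Y ⊗ 𝟙_ M ⟶ Z) (k : X ⊗ 𝟙_ M ⟶ Z)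
    (h : k = ((X ◁ (λ_ (𝟙_ M)).inv ≫ (α_ X (𝟙_ M) (𝟙_ M)).inv) ≫ (f ⊗ₘ 𝟙 (𝟙_ M))) ≫ g) :
    (ρ_ X).inv ≫ k = ((ρ_ X).inv ≫ f) ≫ (ρ_ Y).inv ≫ g := by
  rw [h]
  monoidal

theorem aux_one_map {M : Type u} [Category.{w} M] [MonoidalCategory M] {X Y : M}
    (e : 𝟙_ M ⟶ X) (f : X ⊗ 𝟙_ M ⟶ Y) (e' : 𝟙_ M ⟶ Y)
    (h : e' = ((λ_ (𝟙_ M)).inv ≫ (e ⊗ₘ 𝟙 (𝟙_ M))) ≫ f) :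
    e ≫ (ρ_ X).inv ≫ f = e' := by
  rw [h]
  monoidal

theorem aux_mul_map {M : Type u} [Category.{w} M] [MonoidalCategory M] {X Y : M}
    (m : X ⊗ (X ⊗ 𝟙_ M) ⟶ X) (f : X ⊗ 𝟙_ M ⟶ Y) (m' : Y ⊗ (Y ⊗ 𝟙_ M) ⟶ Y)
    (h : ((X ◁ (λ_ (X ⊗ 𝟙_ M)).inv ≫ (α_ X (𝟙_ M) (X ⊗ 𝟙_ M)).inv) ≫
        (f ⊗ₘ ((X ◁ (λ_ (𝟙_ M)).inv ≫ (α_ X (𝟙_ M) (𝟙_ M)).inv) ≫ (f ⊗ₘ 𝟙 (𝟙_ M))))) ≫ m' =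
      ((X ◁ (X ◁ (λ_ (𝟙_ M)).inv ≫ (α_ X (𝟙_ M) (𝟙_ M)).inv) ≫
        (α_ X (X ⊗ 𝟙_ M) (𝟙_ M)).inv) ≫ (m ⊗ₘ 𝟙 (𝟙_ M))) ≫ f) :
    (X ◁ (ρ_ X).inv ≫ m) ≫ (ρ_ X).inv ≫ f =
      (((ρ_ X).inv ≫ f) ⊗ₘ ((ρ_ X).inv ≫ f)) ≫ Y ◁ (ρ_ Y).inv ≫ m' := by
  have h₃ := congrArg (fun x => (X ◁ (ρ_ X).inv) ≫ x) h
  calc _ = _ := ?_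
    _ = _ := h₃.symm
    _ = _ := ?_
  · monoidal
  · monoidal

theorem aux_hom_mul {M : Type u} [Category.{w} M] [MonoidalCategory M] {X Y : M}
    (m : X ⊗ (X ⊗ 𝟙_ M) ⟶ X) (m' : Y ⊗ (Y ⊗ 𝟙_ M) ⟶ Y) (f : X ⟶ Y)
    (h : m ≫ f = (f ⊗ₘ (f ⊗ₘ 𝟙 (𝟙_ M))) ≫ m') :
    (X ◁ (ρ_ X).inv ≫ m) ≫ f = (f ⊗ₘ f) ≫ Y ◁ (ρ_ Y).inv ≫ m' := by
  rw [Category.assoc, h]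
  monoidal

theorem aux_hom_map {M : Type u} [Category.{w} M] [MonoidalCategory M] {X X' Y Y' : M}
    (k : X ⊗ 𝟙_ M ⟶ X') (k' : Y ⊗ 𝟙_ M ⟶ Y') (f : X ⟶ Y) (f' : X' ⟶ Y')
    (h : k ≫ f' = (f ⊗ₘ 𝟙 (𝟙_ M)) ≫ k') :
    ((ρ_ X).inv ≫ k) ≫ f' = f ≫ (ρ_ Y).inv ≫ k' := by
  rw [Category.assoc, h]
  monoidal

namespace Alg

variable {R : Orthogonality C} (A : Alg R M)

/-- The unit of `A_c`. -/
def one (c : C) : 𝟙_ M ⟶ A.obj c := A.act ((Word.unit c).toOp R)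

/-- The multiplication of `A_c`. -/
def mul (c : C) : A.obj c ⊗ A.obj c ⟶ A.obj c :=
  (A.obj c ◁ (ρ_ (A.obj c)).inv) ≫ A.act ((Word.mul c).toOp R)

/-- The action of a morphism of `C`. -/
def map {c c' : C} (f : c ⟶ c') : A.obj c ⟶ A.obj c' :=
  (ρ_ (A.obj c)).inv ≫ A.act ((Word.ofHom f).toOp R)

theorem one_mul (c : C) : A.one c ▷ A.obj c ≫ A.mul c = (λ_ (A.obj c)).hom := by
  have h := A.act_comp (Word.mul c)
    (.cons (.nil [c]) (Word.unit c) (.cons (.cons c (.nil [])) (Word.one c) .nil))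
  have e : (Word.mul c).comp (.cons (.nil [c]) (Word.unit c)
      (.cons (.cons c (.nil [])) (Word.one c) .nil)) = Word.one c := by
    ext1
    simp [Word.mul, Word.comp, Word.unit, Word.one, Word.ofHom, Forest.subst, Concat.inl,
      Concat.inr]
  rw [e, A.act_one] at h
  simp only [Forest.eval, tensorConcat, A.act_one] at h
  exact aux_one_mul _ _ h

theorem mul_one (c : C) : A.obj c ◁ A.one c ≫ A.mul c = (ρ_ (A.obj c)).hom := by
  have h := A.act_comp (Word.mul c)
    (.cons (.cons c (.nil [])) (Word.one c) (.cons (.nil []) (Word.unit c) .nil))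
  have e : (Word.mul c).comp (.cons (.cons c (.nil [])) (Word.one c)
      (.cons (.nil []) (Word.unit c) .nil)) = Word.one c := by
    ext1
    simp [Word.mul, Word.comp, Word.unit, Word.one, Word.ofHom, Forest.subst, Concat.inl]
  rw [e, A.act_one] at h
  simp only [Forest.eval, tensorConcat, A.act_one] at h
  exact aux_mul_one _ _ h

theorem mul_assoc (c : C) : A.mul c ▷ A.obj c ≫ A.mul c =
    (α_ _ _ _).hom ≫ A.obj c ◁ A.mul c ≫ A.mul c := by
  have h₁ := A.act_comp (Word.mul c)
    (.cons (.cons c (.cons c (.nil [c]))) (Word.mul c)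
      (.cons (.cons c (.nil [])) (Word.one c) .nil))
  have h₂ := A.act_comp (Word.mul c)
    (.cons (.cons c (.nil [c, c])) (Word.one c)
      (.cons (.cons c (.cons c (.nil []))) (Word.mul c) .nil))
  have e : (Word.mul c).comp (.cons (.cons c (.cons c (.nil [c]))) (Word.mul c)
      (.cons (.cons c (.nil [])) (Word.one c) .nil)) =
      (Word.mul c).comp (.cons (.cons c (.nil [c, c])) (Word.one c)
      (.cons (.cons c (.cons c (.nil []))) (Word.mul c) .nil)) := by
    ext1
    simp [Word.mul, Word.comp, Word.one, Word.ofHom, Forest.subst, Concat.inl, Concat.inr]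
  rw [e, h₂] at h₁
  simp only [Forest.eval, tensorConcat, A.act_one] at h₁
  exact aux_mul_assoc _ h₁

theorem map_id (c : C) : A.map (𝟙 c) = 𝟙 (A.obj c) := by
  have h := A.act_one c
  exact (congrArg (fun x => (ρ_ (A.obj c)).inv ≫ x) h).trans (Iso.inv_hom_id _)

theorem map_comp {c c' c'' : C} (f : c ⟶ c') (g : c' ⟶ c'') :
    A.map (f ≫ g) = A.map f ≫ A.map g := by
  have h := A.act_comp (Word.ofHom g) (.cons (.cons c (.nil [])) (Word.ofHom f) .nil)
  have e : (Word.ofHom g).comp (.cons (.cons c (.nil [])) (Word.ofHom f) .nil) =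
      Word.ofHom (f ≫ g) := by
    ext1
    simp [Word.comp, Word.ofHom, Forest.subst, Concat.inl]
  rw [e] at h
  simp only [Forest.eval, tensorConcat] at h
  exact aux_map_comp _ _ _ h

theorem one_map {c c' : C} (f : c ⟶ c') : A.one c ≫ A.map f = A.one c' := by
  have h := A.act_comp (Word.ofHom f) (.cons (.nil []) (Word.unit c) .nil)
  have e : (Word.ofHom f).comp (.cons (.nil []) (Word.unit c) .nil) = Word.unit c' := by
    ext1
    simp [Word.comp, Word.ofHom, Forest.subst, Word.unit]
  rw [e] at h
  simp only [Forest.eval, tensorConcat] at h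
  exact aux_one_map _ _ _ h

theorem mul_map {c c' : C} (f : c ⟶ c') :
    A.mul c ≫ A.map f = (A.map f ⊗ₘ A.map f) ≫ A.mul c' := by
  have h₁ := A.act_comp (Word.ofHom f) (.cons (.cons c (.cons c (.nil []))) (Word.mul c) .nil)
  have h₂ := A.act_comp (Word.mul c') (.cons (.cons c (.nil [c])) (Word.ofHom f)
    (.cons (.cons c (.nil [])) (Word.ofHom f) .nil))
  have e : (Word.ofHom f).comp (.cons (.cons c (.cons c (.nil []))) (Word.mul c) .nil) =
      (Word.mul c').comp (.cons (.cons c (.nil [c])) (Word.ofHom f)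
        (.cons (.cons c (.nil [])) (Word.ofHom f) .nil)) := by
    ext1
    simp [Word.comp, Word.ofHom, Forest.subst, Word.mul, Concat.inl, Concat.inr]
  rw [e, h₂] at h₁
  simp only [Forest.eval, tensorConcat] at h₁
  exact aux_mul_map _ _ _ h₁

/-- The monoid `A_c`. -/
def mon (c : C) : Mon M where
  X := A.obj c
  mon :=
    { one := A.one c
      mul := A.mul c
      one_mul := A.one_mul c
      mul_one := A.mul_one c
      mul_assoc := A.mul_assoc c }

/-- The monoid-valued functor underlying an algebra. -/
def toFunctor : C ⥤ Mon M where
  obj c := A.mon c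
  map f :=
    { hom := A.map f
      isMonHom_hom := { one_hom := A.one_map f, mul_hom := A.mul_map f } }
  map_id c := Mon.Hom.ext (A.map_id c)
  map_comp f g := Mon.Hom.ext (A.map_comp f g)

theorem hom_one {A B : Alg R M} (φ : A ⟶ B) (c : C) : A.one c ≫ φ.app c = B.one c :=
  (φ.comm ((Word.unit c).toOp R)).trans (Category.id_comp _)

theorem hom_mul {A B : Alg R M} (φ : A ⟶ B) (c : C) :
    A.mul c ≫ φ.app c = (φ.app c ⊗ₘ φ.app c) ≫ B.mul c :=
  aux_hom_mul _ _ _ (φ.comm ((Word.mul c).toOp R))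

theorem hom_map {A B : Alg R M} (φ : A ⟶ B) {c c' : C} (f : c ⟶ c') :
    A.map f ≫ φ.app c' = φ.app c ≫ B.map f :=
  aux_hom_map _ _ _ _ (φ.comm ((Word.ofHom f).toOp R))

end Alg

/-- The functor `p^*`, sending an algebra over the operad of `(C, ⊥)` to its underlying
monoid-valued functor. Its unit, multiplication and functoriality are the structure maps of the
nullary, binary and unary operations given by the empty word, by the pair of identities in their
given order, and by the morphisms of `C`. -/
def underlying (R : Orthogonality C) (M : Type u) [Category.{w} M] [MonoidalCategory M]
    [BraidedCategory M] : Alg R M ⥤ (C ⥤ Mon M) where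
  obj A := A.toFunctor
  map φ :=
    { app c :=
        { hom := φ.app c
          isMonHom_hom := { one_hom := Alg.hom_one φ c, mul_hom := Alg.hom_mul φ c } }
      naturality _ _ f := Mon.Hom.ext (Alg.hom_map φ f) }

end Algebras

section Auxiliary

theorem aux_pull_hom {M : Type u} [Category.{w} M] {T T' U U' X Y : M} (p : T ⟶ U) (a : U ⟶ X) (f : X ⟶ Y) (m : T ⟶ T')
    (p' : T' ⟶ U') (a' : U' ⟶ Y) (m' : U ⟶ U') (h : a ≫ f = m' ≫ a') (h' : m ≫ p' = p ≫ m') :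
    (p ≫ a) ≫ f = m ≫ p' ≫ a' := by
  rw [Category.assoc, h, ← Category.assoc, ← h', Category.assoc]

variable {M : Type u} [Category.{w} M] [MonoidalCategory M]

theorem aux_pull_nil {X Y : M} (f : X ⟶ Y) :
    (λ_ X).inv ≫ (𝟙 (𝟙_ M) ⊗ₘ f) = f ≫ (λ_ Y).inv := by simp

theorem aux_pull_cons (X : M) {Y Y' Z Z' W W' : M} (e : W ≅ Y ⊗ Z) (e' : W' ≅ Y' ⊗ Z')
    (f : Y ⟶ Y') (g : Z ⟶ Z') (h : W ⟶ W') (H : e.hom ≫ (f ⊗ₘ g) = h ≫ e'.hom) :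
    (whiskerLeftIso X e ≪≫ (α_ X Y Z).symm).hom ≫ ((X ◁ f) ⊗ₘ g) =
      (X ◁ h) ≫ (whiskerLeftIso X e' ≪≫ (α_ X Y' Z').symm).hom := by
  have h' : X ◁ (e.hom ≫ (f ⊗ₘ g)) ≫ (α_ X Y' Z').inv = X ◁ (h ≫ e'.hom) ≫ (α_ X Y' Z').inv := by
    rw [H]
  simp only [Iso.trans_hom, whiskerLeftIso_hom, Iso.symm_hom, Category.assoc]
  calc _ = X ◁ (e.hom ≫ (f ⊗ₘ g)) ≫ (α_ X Y' Z').inv := by monoidal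
    _ = _ := h'
    _ = _ := by monoidal

theorem aux_pull_swap [BraidedCategory M] (X Y : M) {Z Z' : M} (f : Z ⟶ Z') :
    ((α_ X Y Z).inv ≫ ((β_ X Y).hom ▷ Z) ≫ (α_ Y X Z).hom) ≫ (Y ◁ (X ◁ f)) =
      (X ◁ (Y ◁ f)) ≫ (α_ X Y Z').inv ≫ ((β_ X Y).hom ▷ Z') ≫ (α_ Y X Z').hom := by
  simp only [Category.assoc]
  rw [← associator_naturality_right, ← whisker_exchange_assoc, associator_inv_naturality_right_assoc]

theorem aux_pull_there (X : M) {Y Y' Z Z' : M} (s : Y ⟶ Z) (f' : Z ⟶ Z') (f : Y ⟶ Y')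
    (s' : Y' ⟶ Z') (h : s ≫ f' = f ≫ s') : X ◁ s ≫ X ◁ f' = X ◁ f ≫ X ◁ s' := by
  rw [← MonoidalCategory.whiskerLeft_comp, h, MonoidalCategory.whiskerLeft_comp]

theorem aux_pull_map {X X' Y Y' Z Z' : M} (g : X ⟶ X') (s : Y ⟶ Z) (f' : Z ⟶ Z') (f : Y ⟶ Y')
    (s' : Y' ⟶ Z') (h : s ≫ f' = f ≫ s') :
    (g ⊗ₘ s) ≫ X' ◁ f' = X ◁ f ≫ (g ⊗ₘ s') := by
  rw [MonoidalCategory.tensorHom_def, MonoidalCategory.tensorHom_def, Category.assoc,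
    ← MonoidalCategory.whiskerLeft_comp, h, MonoidalCategory.whiskerLeft_comp,
    ← whisker_exchange_assoc]

theorem aux_pull_eval {W W' X X' Y Y' Z U U' : M} (k : W ⟶ X ⊗ Y) (p : X ⟶ X') (a : X' ⟶ Z)
    (q : Y ⟶ Y') (e : Y ⟶ U) (r : U ⟶ U') (e' : Y' ⟶ U') {p' : W ⟶ W'} {k' : W' ⟶ X' ⊗ Y'}
    (h : k ≫ (p ⊗ₘ q) = p' ≫ k') (h' : e ≫ r = q ≫ e') :
    (k ≫ ((p ≫ a) ⊗ₘ e)) ≫ Z ◁ r = p' ≫ k' ≫ (a ⊗ₘ e') := by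
  rw [← Category.assoc p', ← h]
  simp only [Category.assoc, tensorHom_comp_tensorHom, ← h', ← id_tensorHom, Category.comp_id]

theorem aux_pull_one (X : M) : (X ◁ 𝟙 (𝟙_ M)) ≫ (ρ_ X).hom = (ρ_ X).hom := by simp

end Auxiliary

section Restriction

variable {C : Type u₁} [Category.{v₁} C] {D : Type u₂} [Category.{v₂} D] (F : C ⥤ D)

/-! ### Restriction of algebras along a functor -/

/-- The image of a position under a map of colours. -/
def Pos.map {K : Type u₁} {L : Type u₂} (F : K → L) {x : K} :
    {c : List K} → Pos c x → Pos (c.map F) (F x)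
  | _, .here => .here
  | _, .there p => .there (p.map F)

/-- The image of a concatenation under a map of colours. -/
def Concat.map {K : Type u₁} {L : Type u₂} (F : K → L) :
    {l l' l'' : List K} → Concat l l' l'' → Concat (l.map F) (l'.map F) (l''.map F)
  | _, _, _, .nil l => .nil (l.map F)
  | _, _, _, .cons x k => .cons (F x) (k.map F)

/-- The image of an adjacent transposition under a map of colours. -/
def AdjSwap.map {K : Type u₁} {L : Type u₂} (F : K → L) :
    {l l' : List K} → AdjSwap l l' → AdjSwap (l.map F) (l'.map F)
  | _, _, .here x y l => .here (F x) (F y) (l.map F)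
  | _, _, .there z s => .there (F z) (s.map F)

theorem allInputs_map {K : Type u₁} {L : Type u₂} (F : K → L) : (c : List K) →
    (allInputs c).map (fun p => (⟨F p.1, p.2.map F⟩ : Input (c.map F))) = allInputs (c.map F)
  | [] => rfl
  | x :: l => by
      change _ = (⟨F x, Pos.here⟩ : Input (F x :: l.map F)) :: (allInputs (l.map F)).map _
      rw [← allInputs_map F l]
      simp [allInputs, Function.comp_def, Pos.map]

theorem Concat.map_inl {K : Type u₁} {L : Type u₂} (F : K → L) {x : K} :
    {l l' l'' : List K} → (k : Concat l l' l'') → (p : Pos l x) →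
    (k.inl p).map F = (k.map F).inl (p.map F)
  | _, _, _, .cons _ _, .here => rfl
  | _, _, _, .cons _ k, .there p => congrArg Pos.there (k.map_inl F p)

theorem Concat.map_inr {K : Type u₁} {L : Type u₂} (F : K → L) {x : K} :
    {l l' l'' : List K} → (k : Concat l l' l'') → (p : Pos l' x) →
    (k.inr p).map F = (k.map F).inr (p.map F)
  | _, _, _, .nil _, _ => rfl
  | _, _, _, .cons _ k, p => congrArg Pos.there (k.map_inr F p)

theorem AdjSwap.map_pos {K : Type u₁} {L : Type u₂} (F : K → L) {x : K} :
    {l l' : List K} → (s : AdjSwap l l') → (p : Pos l x) →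
    (s.pos p).map F = (s.map F).pos (p.map F)
  | _, _, .here _ _ _, .here => rfl
  | _, _, .here _ _ _, .there .here => rfl
  | _, _, .here _ _ _, .there (.there _) => rfl
  | _, _, .there _ _, .here => rfl
  | _, _, .there _ s, .there p => congrArg Pos.there (s.map_pos F p)

/-- The image of a letter under a functor. -/
def Letter.map {c : List C} {t : C} (a : Letter c t) : Letter (c.map F.obj) (F.obj t) :=
  ⟨F.obj a.src, a.pos.map F.obj, F.map a.hom⟩

/-- The image of a word under a functor: `(σ, f) ↦ (σ, F(f))`. -/
def Word.map {c : List C} {t : C} (o : Word c t) : Word (c.map F.obj) (F.obj t) where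
  letters := o.letters.map (Letter.map F)
  linear := by
    have := o.linear.map (fun p => (⟨F.obj p.1, p.2.map F.obj⟩ : Input (c.map F.obj)))
    rw [allInputs_map] at this
    simpa [Function.comp_def, Letter.map, Letter.input] using this

/-- The image of a family of words under a functor. -/
def Forest.map : {b a : List C} → Forest b a → Forest (b.map F.obj) (a.map F.obj)
  | _, _, .nil => .nil
  | _, _, .cons k o φ => .cons (k.map F.obj) (o.map F) φ.map

theorem Forest.map_subst {t : C} : {b a : List C} → (φ : Forest b a) → {x : C} → (p : Pos a x) →
    (f : x ⟶ t) →
    (φ.subst p f).map (Letter.map F) = (φ.map F).subst (p.map F.obj) (F.map f)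
  | _, _, .cons k o φ, _, .here, f => by
      simp [Forest.subst, Forest.map, Pos.map, Word.map, Letter.map, Concat.map_inl]
  | _, _, .cons k o φ, _, .there p, f => by
      simp [Forest.subst, Forest.map, Pos.map, Letter.map, Concat.map_inr, ← φ.map_subst p f]

theorem Word.map_comp {b a : List C} {t : C} (o : Word a t) (φ : Forest b a) :
    (o.comp φ).map F = (o.map F).comp (φ.map F) := by
  ext1
  simp only [Word.map, Word.comp, List.map_flatMap, List.flatMap_map, Forest.map_subst]
  rfl

theorem Word.map_permute {c c' : List C} {t : C} (s : AdjSwap c c') (o : Word c t) :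
    (o.permute s).map F = (o.map F).permute (s.map F.obj) := by
  ext1
  simp [Word.map, Word.permute, Letter.map, AdjSwap.map_pos]

theorem Word.map_one (t : C) : (Word.one t).map F = Word.one (F.obj t) := by
  ext1
  simp [Word.map, Word.one, Word.ofHom, Letter.map, Pos.map]

/-- The map `[σ, f] ↦ [σ, F(f)]` from the operations of `(C, F^*(⊥))` to those of `(D, ⊥)`. -/
def Operation.map (R : Orthogonality D) {c : List C} {t : C} :
    Operation (R.pullback F) c t → Operation R (c.map F.obj) (F.obj t) :=
  Quot.map (Word.map F) (by
    rintro w w' ⟨l, r, a, b, h, h₁, h₂⟩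
    exact ⟨l.map (Letter.map F), r.map (Letter.map F), a.map F, b.map F, h,
      by simp [Word.map, h₁], by simp [Word.map, h₂]⟩)

section Tensor

variable {M : Type u} [Category.{w} M] [MonoidalCategory M]

/-- The identification of `A_{F(c₁)} ⊗ ⋯ ⊗ A_{F(cₙ)}` with the tensor product over `F(c)`. -/
def tensorPull {K : Type u₁} {L : Type u₂} (F : K → L) (A : L → M) : (c : List K) →
    (tensorList (fun x => A (F x)) c ⟶ tensorList A (c.map F))
  | [] => 𝟙 (𝟙_ M)
  | x :: l => A (F x) ◁ tensorPull F A l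

theorem tensorPull_concat {K : Type u₁} {L : Type u₂} (F : K → L) (A : L → M) :
    {l l' l'' : List K} → (k : Concat l l' l'') →
    (tensorConcat (fun x => A (F x)) k).hom ≫ (tensorPull F A l ⊗ₘ tensorPull F A l') =
      tensorPull F A l'' ≫ (tensorConcat A (k.map F)).hom
  | _, _, _, .nil l => by
      simp only [tensorConcat, Concat.map, tensorPull]
      exact aux_pull_nil _
  | _, _, _, .cons x k => by
      simp only [tensorConcat, Concat.map, tensorPull]
      exact aux_pull_cons _ _ _ _ _ _ (tensorPull_concat F A k)

theorem tensorPull_swap [BraidedCategory M] {K : Type u₁} {L : Type u₂} (F : K → L) (A : L → M) :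
    {l l' : List K} → (s : AdjSwap l l') →
    tensorSwap (fun x => A (F x)) s ≫ tensorPull F A l' =
      tensorPull F A l ≫ tensorSwap A (s.map F)
  | _, _, .here x y l => by
      simp only [tensorSwap, AdjSwap.map, tensorPull]
      exact aux_pull_swap _ _ _
  | _, _, .there z s => by
      simp only [tensorSwap, AdjSwap.map, tensorPull]
      exact aux_pull_there _ _ _ _ _ (tensorPull_swap F A s)

theorem tensorPull_map {K : Type u₁} {L : Type u₂} (F : K → L) {A B : L → M}
    (f : ∀ x, A x ⟶ B x) : (c : List K) →
    tensorListMap (fun x => f (F x)) c ≫ tensorPull F B c =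
      tensorPull F A c ≫ tensorListMap f (c.map F)
  | [] => rfl
  | x :: l => by
      simp only [tensorListMap, tensorPull]
      exact aux_pull_map _ _ _ _ _ (tensorPull_map F f l)

theorem Forest.eval_map {A : D → M}
    (α : ∀ {c : List D} {t : D}, Word c t → (tensorList A c ⟶ A t)) :
    {b a : List C} → (φ : Forest b a) →
    φ.eval (A := fun c => A (F.obj c)) (fun {c _} o => tensorPull F.obj A c ≫ α (o.map F)) ≫
      tensorPull F.obj A a = tensorPull F.obj A b ≫ (φ.map F).eval α
  | _, _, .nil => rfl
  | _, _, .cons k o φ => by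
      simp only [Forest.eval, Forest.map, tensorPull]
      exact aux_pull_eval _ _ _ _ _ _ _ (tensorPull_concat F.obj A k) (φ.eval_map α)

/-- Restriction of an algebra over `(D, ⊥)` to an algebra over `(C, F^*(⊥))`. -/
def Alg.restrict [BraidedCategory M] {R : Orthogonality D} (A : Alg R M) :
    Alg (R.pullback F) M where
  obj c := A.obj (F.obj c)
  act {c _} o := tensorPull F.obj A.obj c ≫ A.act (o.map F R)
  act_one t := by
    have h : ((Word.one t).toOp (R.pullback F)).map F R = (Word.one (F.obj t)).toOp R :=
      congrArg (Word.toOp R) (Word.map_one F t)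
    rw [h, A.act_one]
    exact aux_pull_one _
  act_permute {c c' t} s o := by
    have h : ((o.permute s).toOp (R.pullback F)).map F R =
        ((o.map F).permute (s.map F.obj)).toOp R :=
      congrArg (Word.toOp R) (Word.map_permute F s o)
    rw [h, ← Category.assoc, tensorPull_swap, Category.assoc, ← A.act_permute]
    rfl
  act_comp {b a t} o φ := by
    have h : ((o.comp φ).toOp (R.pullback F)).map F R =
        ((o.map F).comp (φ.map F)).toOp R :=
      congrArg (Word.toOp R) (Word.map_comp F o φ)
    rw [h, A.act_comp, ← Category.assoc, ← Forest.eval_map, Category.assoc]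
    rfl

end Tensor

/-- The restriction functor `O_F^*` from algebras over the operad of `(D, ⊥)` to algebras over
the operad of `(C, F^*(⊥))`. -/
def restriction (R : Orthogonality D) (M : Type u) [Category.{w} M] [MonoidalCategory M]
    [BraidedCategory M] : Alg R M ⥤ Alg (R.pullback F) M where
  obj A := A.restrict F
  map φ :=
    { app c := φ.app (F.obj c)
      comm o := by
        have h := φ.comm (o.map F R)
        exact aux_pull_hom _ _ _ _ _ _ _ h (tensorPull_map F.obj φ.app _) }

end Restriction

section Comparison

variable {C : Type u₁} [Category.{v₁} C] {D : Type u₂} [Category.{v₂} D]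
  {M : Type u} [Category.{w} M] [MonoidalCategory M] [BraidedCategory M]

/-! ### The notions compared -/

/-- A monoid-valued functor `B` on `(D, ⊥)` is `⊥`-commutative over the object `d` if
`μ_d ∘ (B(f₁) ⊗ B(f₂)) = μ_d^op ∘ (B(f₁) ⊗ B(f₂))` for all `f₁ ⊥ f₂` with target `d`. -/
def IsPerpCommutativeOver (R : Orthogonality D) (B : D ⥤ Mon M) (d : D) : Prop :=
  ∀ (d₁ d₂ : D) (f₁ : d₁ ⟶ d) (f₂ : d₂ ⟶ d), R.rel f₁ f₂ →
    ((B.map f₁).hom ⊗ₘ (B.map f₂).hom) ≫ MonObj.mul (X := (B.obj d).X) =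
      ((B.map f₁).hom ⊗ₘ (B.map f₂).hom) ≫ (β_ (B.obj d).X (B.obj d).X).hom ≫
        MonObj.mul (X := (B.obj d).X)

/-- The object `d` is `j`-closed: every orthogonal pair `g₁ ⊥ g₂` with target `d` and with sources
in `C` factors as `gᵢ = g ∘ fᵢ` through an object of `C`, with `(f₁, f₂) ∈ j^*(⊥)`. -/
def IsClosedAt (R : Orthogonality D) (j : C ⥤ D) (d : D) : Prop :=
  ∀ (c₁ c₂ : C) (g₁ : j.obj c₁ ⟶ d) (g₂ : j.obj c₂ ⟶ d), R.rel g₁ g₂ →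
    ∃ (c : C) (g : j.obj c ⟶ d) (f₁ : c₁ ⟶ c) (f₂ : c₂ ⟶ c),
      j.map f₁ ≫ g = g₁ ∧ j.map f₂ ≫ g = g₂ ∧ (R.pullback j).rel f₁ f₂

/-- The algebra `B` together with `η : A ⟶ O_j^* B` is the operadic extension `O_{j!}(A)` of `A`,
i.e. the value at `A` of the left adjoint of `O_j^*` with the component of the unit at `A`:
every morphism `A ⟶ O_j^* B'` factors through `η` for a unique morphism `B ⟶ B'`. -/
def IsOperadicExtension (R : Orthogonality D) (j : C ⥤ D) (A : Alg (R.pullback j) M)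
    (B : Alg R M) (η : A ⟶ (restriction j R M).obj B) : Prop :=
  ∀ (B' : Alg R M) (ψ : A ⟶ (restriction j R M).obj B'),
    ∃! φ : B ⟶ B', η ≫ (restriction j R M).map φ = ψ

end Comparison

end QFTOperad

/-! The whole proof rests on one fact: the underlying functor identifies algebras with ⊥-commutative
functors to monoids. In such a functor a word has a value, the product of the values of its letters,
and commutativity makes this product invariant under transposing adjacent orthogonal letters; this
gives `toAlg`. Conversely every structure map of an algebra is the product prescribed by its word
(`Alg.act_eq`), so a natural transformation of underlying functors respects all operations
(`underlyingFullyFaithful`).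

Statement (2) is then formal. If L is a ⊥-commutative left Kan extension of the functor underlying
A, then L underlies an algebra B. Full faithfulness on both sides and the universal property of L
turn morphisms B ⟶ B' into morphisms from A to the restriction of B', so B is the operadic extension
(`exists_isOperadicExtension`).

For a closed object d in (1), commuting with a fixed ψ : Y ⟶ L(d) is detected by a submonoid, the
centralizer of ψ, which exists because M is closed and has equalizers. A Kan extension is generated
at d' by the images of the A(c), so a map out of L(d') lands in the centralizer once its
restrictions to these images do (`commutes_of_kan`). Using this in both variables reduces
commutativity over d to orthogonal pairs with sources in C. By closedness such a pair factors
orthogonally through some c in C, where A already commutes.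

For the converse, take g₁ ⊥ g₂ with sources c₁, c₂ in C. Let S(d) be the monoid generated by all
morphisms to d from c₁ or c₂, where two generators commute if they factor orthogonally through an
object of C. The monoid algebras I[S(d)] form the left Kan extension of their restriction to C, and
this restriction is ⊥-commutative since j is full. If the extension is commutative over d,
distinctness of the coprojections gives g₁g₂ = g₂g₁ already in S(d). Comparison with the free monoid
on two letters shows that this only happens when g₁, g₂ are among the related pairs, which is the
required factorization (`GenMonoid.related_of_mul_of`). -/

namespace QFTOperad

/-! ### Shuffles of profiles -/

/-! ### Moving one tensor factor past another -/

section Exchange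

variable {M : Type u} [Category.{w} M] [MonoidalCategory M] [BraidedCategory M]

/-- The exchange `X ⊗ (Y ⊗ Z) ⟶ Y ⊗ (X ⊗ Z)`. -/
def exchange (X Y Z : M) : X ⊗ (Y ⊗ Z) ⟶ Y ⊗ (X ⊗ Z) :=
  (α_ X Y Z).inv ≫ ((β_ X Y).hom ▷ Z) ≫ (α_ Y X Z).hom

theorem exchange_natural {X X' Y Y' Z Z' : M} (f : X ⟶ X') (g : Y ⟶ Y') (h : Z ⟶ Z') :
    (f ⊗ₘ (g ⊗ₘ h)) ≫ exchange X' Y' Z' = exchange X Y Z ≫ (g ⊗ₘ (f ⊗ₘ h)) := by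
  simp only [exchange, Category.assoc, associator_inv_naturality_assoc]
  rw [← associator_naturality, ← tensorHom_id, ← tensorHom_id,
    tensorHom_comp_tensorHom_assoc, tensorHom_comp_tensorHom_assoc, BraidedCategory.braiding_naturality]
  simp

theorem exchange_natural_right {X Y Z Z' : M} (h : Z ⟶ Z') :
    X ◁ Y ◁ h ≫ exchange X Y Z' = exchange X Y Z ≫ Y ◁ X ◁ h := by
  simpa using exchange_natural (𝟙 X) (𝟙 Y) h

theorem exchange_natural_mid {X Y Y' Z : M} (h : Y ⟶ Y') :
    X ◁ h ▷ Z ≫ exchange X Y' Z = exchange X Y Z ≫ h ▷ (X ⊗ Z) := by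
  simpa using exchange_natural (𝟙 X) h (𝟙 Z)

theorem exchange_natural_right_assoc {X Y Z Z' W : M} (h : Z ⟶ Z')
    (k : Y ⊗ X ⊗ Z' ⟶ W) :
    X ◁ Y ◁ h ≫ exchange X Y Z' ≫ k = exchange X Y Z ≫ Y ◁ X ◁ h ≫ k := by
  rw [← Category.assoc, exchange_natural_right, Category.assoc]

theorem exchange_natural_mid_assoc {X Y Y' Z W : M} (h : Y ⟶ Y')
    (k : Y' ⊗ X ⊗ Z ⟶ W) :
    X ◁ h ▷ Z ≫ exchange X Y' Z ≫ k = exchange X Y Z ≫ h ▷ (X ⊗ Z) ≫ k := by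
  rw [← Category.assoc, exchange_natural_mid, Category.assoc]

theorem exchange_tensor_mid (X Y Y' Z : M) :
    exchange X (Y ⊗ Y') Z ≫ (α_ Y Y' (X ⊗ Z)).hom =
      X ◁ (α_ Y Y' Z).hom ≫ exchange X Y (Y' ⊗ Z) ≫ Y ◁ exchange X Y' Z := by
  simp only [exchange, BraidedCategory.braiding_tensor_right_hom]
  monoidal

theorem exchange_tensor_left (X X' Y Z : M) :
    exchange (X ⊗ X') Y Z ≫ Y ◁ (α_ X X' Z).hom =
      (α_ X X' (Y ⊗ Z)).hom ≫ X ◁ exchange X' Y Z ≫ exchange X Y (X' ⊗ Z) := by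
  simp only [exchange, BraidedCategory.braiding_tensor_left_hom]
  monoidal

theorem exchange_tensor_right (X Y Z W : M) :
    exchange X Y (Z ⊗ W) ≫ Y ◁ (α_ X Z W).inv =
      X ◁ (α_ Y Z W).inv ≫ (α_ X (Y ⊗ Z) W).inv ≫ exchange X Y Z ▷ W ≫
        (α_ Y (X ⊗ Z) W).hom := by
  simp only [exchange]
  monoidal

theorem exchange_unit_mid (X Z : M) :
    X ◁ (λ_ Z).inv ≫ exchange X (𝟙_ M) Z = (λ_ (X ⊗ Z)).inv := by
  simp only [exchange, braiding_tensorUnit_right]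
  monoidal

theorem exchange_unit_left (Y Z : M) :
    (λ_ (Y ⊗ Z)).inv ≫ exchange (𝟙_ M) Y Z = Y ◁ (λ_ Z).inv := by
  simp only [exchange, braiding_tensorUnit_left]
  monoidal

/-- This is the Yang–Baxter equation for X, Y, Z with W as a spectator, so it follows by whiskering
that equation with W and inserting associators. -/
theorem exchange_yang_baxter (X Y Z W : M) :
    X ◁ exchange Y Z W ≫ exchange X Z (Y ⊗ W) ≫ Z ◁ exchange X Y W =
      exchange X Y (Z ⊗ W) ≫ Y ◁ exchange X Z W ≫ exchange Y Z (X ⊗ W) := by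
  have h := BraidedCategory.yang_baxter X Y Z
  have h' := congrArg (fun f => X ◁ (α_ Y Z W).inv ≫ (α_ X (Y ⊗ Z) W).inv ≫
    f ▷ W ≫ (α_ Z (Y ⊗ X) W).hom ≫ Z ◁ (α_ Y X W).hom) h
  calc _ = _ := ?_
    _ = _ := h'.symm
    _ = _ := ?_
  · simp only [exchange]
    monoidal
  · simp only [exchange]
    monoidal

end Exchange

/-- Here a symmetric braiding is needed. The shuffle calculus below uses it whenever an exchange has
to be undone. -/
theorem exchange_exchange {M : Type u} [Category.{w} M] [MonoidalCategory M] [SymmetricCategory M]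
    (X Y Z : M) : exchange X Y Z ≫ exchange Y X Z = 𝟙 _ := by
  simp only [exchange, Category.assoc, Iso.hom_inv_id_assoc]
  rw [← comp_whiskerRight_assoc, SymmetricCategory.symmetry]
  simp

end QFTOperad

namespace QFTOperad

/-- `Shuffle l l' c` is the type of exhibitions of the list `c` as a shuffle of `l` and `l'`. -/
inductive Shuffle {K : Type u} : List K → List K → List K → Type u
  | nil : Shuffle [] [] []
  | left (x : K) {l l' c : List K} : Shuffle l l' c → Shuffle (x :: l) l' (x :: c)
  | right (x : K) {l l' c : List K} : Shuffle l l' c → Shuffle l (x :: l') (x :: c)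

namespace Shuffle

/-- Positions of the left part, as positions of the shuffle. -/
def inl {K : Type u} {x : K} : {l l' c : List K} → Shuffle l l' c → Pos l x → Pos c x
  | _, _, _, .left _ _, .here => .here
  | _, _, _, .left _ s, .there p => .there (s.inl p)
  | _, _, _, .right _ s, p => .there (s.inl p)

/-- Positions of the right part, as positions of the shuffle. -/
def inr {K : Type u} {x : K} : {l l' c : List K} → Shuffle l l' c → Pos l' x → Pos c x
  | _, _, _, .left _ s, p => .there (s.inr p)
  | _, _, _, .right _ _, .here => .here
  | _, _, _, .right _ s, .there p => .there (s.inr p)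

/-- The shuffle with empty left part. -/
def nilLeft {K : Type u} : (l : List K) → Shuffle [] l l
  | [] => .nil
  | x :: l => .right x (nilLeft l)

theorem nilLeft_inr {K : Type u} {x : K} : (l : List K) → (p : Pos l x) → (nilLeft l).inr p = p
  | _ :: _, .here => rfl
  | _ :: l, .there p => congrArg Pos.there (nilLeft_inr l p)

/-- An empty left part forces c = l. Phrased as an elimination principle, this avoids transporting a
shuffle along that equality. -/
theorem nilLeft_rec {K : Type u} {l c : List K} (s : Shuffle [] l c)
    {Q : (c : List K) → Shuffle [] l c → Prop} (h : Q l (nilLeft l)) : Q c s := by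
  induction l generalizing c with
  | nil => cases s; exact h
  | cons x l ih =>
    cases s with
    | right _ s => exact ih s (Q := fun c s => Q (x :: c) (.right x s)) h

end Shuffle

/-! ### Inductive steps for shuffles, for arbitrary objects in place of tensor products over lists
-/

section Aux

variable {M : Type u} [Category.{w} M] [MonoidalCategory M]

theorem tensor_natural_left {X Y C D L L' N N' : M} (f : X ⟶ Y) (s : C ⟶ L ⊗ L')
    (s' : D ⟶ N ⊗ N') (g : C ⟶ D) (g₁ : L ⟶ N) (g₂ : L' ⟶ N') (h : g ≫ s' = s ≫ (g₁ ⊗ₘ g₂)) :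
    (f ⊗ₘ g) ≫ Y ◁ s' ≫ (α_ _ _ _).inv =
      (X ◁ s ≫ (α_ _ _ _).inv) ≫ ((f ⊗ₘ g₁) ⊗ₘ g₂) := by
  rw [Category.assoc, ← associator_inv_naturality, tensorHom_comp_whiskerLeft_assoc, h,
    whiskerLeft_comp_tensorHom_assoc]

theorem tensor_swap_left (X : M) {C D L L' N : M} (σ : C ⟶ D) (s' : D ⟶ L ⊗ N) (s : C ⟶ L ⊗ L')
    (τ : L' ⟶ N) (h : σ ≫ s' = s ≫ L ◁ τ) :
    X ◁ σ ≫ X ◁ s' ≫ (α_ _ _ _).inv = (X ◁ s ≫ (α_ _ _ _).inv) ≫ (X ⊗ L) ◁ τ := by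
  rw [← whiskerLeft_comp_assoc, h]
  monoidal

theorem shuffle_assoc_left_left (X : M) {C L L₁ L₂ L₃ N : M} (s : C ⟶ L ⊗ L₃) (s₀ : L ⟶ L₁ ⊗ L₂)
    (s₁ : C ⟶ L₁ ⊗ N) (s₂ : N ⟶ L₂ ⊗ L₃) (h : s ≫ s₀ ▷ L₃ ≫ (α_ _ _ _).hom = s₁ ≫ L₁ ◁ s₂) :
    (X ◁ s ≫ (α_ _ _ _).inv) ≫ (X ◁ s₀ ≫ (α_ _ _ _).inv) ▷ L₃ ≫ (α_ _ _ _).hom =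
      (X ◁ s₁ ≫ (α_ _ _ _).inv) ≫ (X ⊗ L₁) ◁ s₂ := by
  calc _ = X ◁ (s ≫ s₀ ▷ L₃ ≫ (α_ _ _ _).hom) ≫ (α_ _ _ _).inv := by monoidal
    _ = _ := by rw [h]; monoidal

theorem concat_shuffle_left_nil {L L' N : M} (s : N ⟶ L ⊗ L') :
    (λ_ N).inv ≫ 𝟙_ M ◁ s ≫ (α_ _ _ _).inv = s ≫ (λ_ L).inv ▷ L' := by
  monoidal

theorem concat_shuffle_left_cons (X : M) {C B S S₁ S₂ N : M} (k : C ⟶ B ⊗ S) (s : S ⟶ S₁ ⊗ S₂)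
    (s' : C ⟶ N ⊗ S₂) (k' : N ⟶ B ⊗ S₁) (h : k ≫ B ◁ s ≫ (α_ _ _ _).inv = s' ≫ k' ▷ S₂) :
    (X ◁ k ≫ (α_ _ _ _).inv) ≫ (X ⊗ B) ◁ s ≫ (α_ _ _ _).inv =
      (X ◁ s' ≫ (α_ _ _ _).inv) ≫ (X ◁ k' ≫ (α_ _ _ _).inv) ▷ S₂ := by
  calc _ = X ◁ (k ≫ B ◁ s ≫ (α_ _ _ _).inv) ≫ (α_ _ _ _).inv ≫ (α_ _ _ _).inv ▷ _ := by monoidal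
    _ = _ := by rw [h]; monoidal

theorem forest_shuffle_left {C B S S₁ S₂ N A F F₁ F₂ : M} (k : C ⟶ B ⊗ S) (o : B ⟶ A) (e : S ⟶ F)
    (s : F ⟶ F₁ ⊗ F₂) (s₀ : S ⟶ S₁ ⊗ S₂) (e₁ : S₁ ⟶ F₁) (e₂ : S₂ ⟶ F₂) (s' : C ⟶ N ⊗ S₂)
    (k' : N ⟶ B ⊗ S₁) (h : e ≫ s = s₀ ≫ (e₁ ⊗ₘ e₂))
    (h' : k ≫ B ◁ s₀ ≫ (α_ _ _ _).inv = s' ≫ k' ▷ S₂) :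
    (k ≫ (o ⊗ₘ e)) ≫ A ◁ s ≫ (α_ _ _ _).inv = s' ≫ ((k' ≫ (o ⊗ₘ e₁)) ⊗ₘ e₂) := by
  rw [Category.assoc, tensor_natural_left o s₀ s e e₁ e₂ h, Category.assoc, reassoc_of% h',
    whiskerRight_comp_tensorHom]

variable [BraidedCategory M]

theorem tensor_natural_right {X Y C D L L' N N' : M} (f : X ⟶ Y) (s : C ⟶ L ⊗ L')
    (s' : D ⟶ N ⊗ N') (g : C ⟶ D) (g₁ : L ⟶ N) (g₂ : L' ⟶ N') (h : g ≫ s' = s ≫ (g₁ ⊗ₘ g₂)) :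
    (f ⊗ₘ g) ≫ Y ◁ s' ≫ exchange _ _ _ = (X ◁ s ≫ exchange _ _ _) ≫ (g₁ ⊗ₘ (f ⊗ₘ g₂)) := by
  rw [Category.assoc, ← exchange_natural, tensorHom_comp_whiskerLeft_assoc, h,
    whiskerLeft_comp_tensorHom_assoc]

theorem tensor_swap_right (X : M) {C D L L' N : M} (σ : C ⟶ D) (s' : D ⟶ L ⊗ N) (s : C ⟶ L ⊗ L')
    (τ : L' ⟶ N) (h : σ ≫ s' = s ≫ L ◁ τ) :
    X ◁ σ ≫ X ◁ s' ≫ exchange _ _ _ = (X ◁ s ≫ exchange _ _ _) ≫ L ◁ X ◁ τ := by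
  rw [← whiskerLeft_comp_assoc, h, Category.assoc, ← exchange_natural_right,
    whiskerLeft_comp_assoc]

theorem shuffle_assoc_left_right (X : M) {C L L₁ L₂ L₃ N : M} (s : C ⟶ L ⊗ L₃)
    (s₀ : L ⟶ L₁ ⊗ L₂) (s₁ : C ⟶ L₁ ⊗ N) (s₂ : N ⟶ L₂ ⊗ L₃)
    (h : s ≫ s₀ ▷ L₃ ≫ (α_ _ _ _).hom = s₁ ≫ L₁ ◁ s₂) :
    (X ◁ s ≫ (α_ _ _ _).inv) ≫ (X ◁ s₀ ≫ exchange _ _ _) ▷ L₃ ≫ (α_ _ _ _).hom =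
      (X ◁ s₁ ≫ exchange _ _ _) ≫ L₁ ◁ (X ◁ s₂ ≫ (α_ _ _ _).inv) := by
  calc _ = X ◁ (s ≫ s₀ ▷ L₃ ≫ (α_ _ _ _).hom) ≫ X ◁ (α_ _ _ _).inv ≫ (α_ _ _ _).inv ≫
        exchange _ _ _ ▷ L₃ ≫ (α_ _ _ _).hom := by monoidal
    _ = _ := by
      rw [h, ← exchange_tensor_right, Category.assoc, MonoidalCategory.whiskerLeft_comp,
        MonoidalCategory.whiskerLeft_comp, Category.assoc, exchange_natural_right_assoc]

theorem shuffle_assoc_right (X : M) {C L L₁ L₂ L₃ N : M} (s : C ⟶ L ⊗ L₃) (s₀ : L ⟶ L₁ ⊗ L₂)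
    (s₁ : C ⟶ L₁ ⊗ N) (s₂ : N ⟶ L₂ ⊗ L₃) (h : s ≫ s₀ ▷ L₃ ≫ (α_ _ _ _).hom = s₁ ≫ L₁ ◁ s₂) :
    (X ◁ s ≫ exchange _ _ _) ≫ s₀ ▷ (X ⊗ L₃) ≫ (α_ _ _ _).hom =
      (X ◁ s₁ ≫ exchange _ _ _) ≫ L₁ ◁ (X ◁ s₂ ≫ exchange _ _ _) := by
  have h' := congrArg (fun f => X ◁ f) h
  simp only [MonoidalCategory.whiskerLeft_comp] at h'
  simp only [Category.assoc, MonoidalCategory.whiskerLeft_comp]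
  rw [← exchange_natural_mid_assoc, exchange_tensor_mid, reassoc_of% h',
    exchange_natural_right_assoc]

theorem shuffle_exchange_mid (X : M) {C L₁ L₂ L₃ N N' : M} (s₁ : C ⟶ L₁ ⊗ N) (s₂ : N ⟶ L₂ ⊗ L₃)
    (t₁ : C ⟶ L₂ ⊗ N') (t₂ : N' ⟶ L₁ ⊗ L₃)
    (h : s₁ ≫ L₁ ◁ s₂ = t₁ ≫ L₂ ◁ t₂ ≫ exchange _ _ _) :
    (X ◁ s₁ ≫ exchange _ _ _) ≫ L₁ ◁ (X ◁ s₂ ≫ (α_ _ _ _).inv) =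
      (X ◁ t₁ ≫ (α_ _ _ _).inv) ≫ (X ⊗ L₂) ◁ t₂ ≫ exchange _ _ _ := by
  have h' := congrArg (fun f => X ◁ f) h
  simp only [MonoidalCategory.whiskerLeft_comp] at h'
  have e := exchange_tensor_left X L₂ L₁ L₃
  rw [← cancel_mono (L₁ ◁ (α_ X L₂ L₃).hom)]
  simp only [Category.assoc, e, MonoidalCategory.whiskerLeft_comp,
    Iso.inv_hom_id_assoc, whiskerLeft_inv_hom,
    Category.comp_id, tensor_whiskerLeft]
  rw [← exchange_natural_right, reassoc_of% h']

theorem shuffle_exchange_right (X : M) {C L₁ L₂ L₃ N N' : M} (s₁ : C ⟶ L₁ ⊗ N) (s₂ : N ⟶ L₂ ⊗ L₃)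
    (t₁ : C ⟶ L₂ ⊗ N') (t₂ : N' ⟶ L₁ ⊗ L₃)
    (h : s₁ ≫ L₁ ◁ s₂ = t₁ ≫ L₂ ◁ t₂ ≫ exchange _ _ _) :
    (X ◁ s₁ ≫ exchange _ _ _) ≫ L₁ ◁ (X ◁ s₂ ≫ exchange _ _ _) =
      (X ◁ t₁ ≫ exchange _ _ _) ≫ L₂ ◁ (X ◁ t₂ ≫ exchange _ _ _) ≫ exchange _ _ _ := by
  have h' := congrArg (fun f => X ◁ f) h
  simp only [MonoidalCategory.whiskerLeft_comp] at h'
  simp only [Category.assoc, MonoidalCategory.whiskerLeft_comp]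
  rw [← exchange_natural_right_assoc, ← exchange_natural_right_assoc, reassoc_of% h',
    exchange_yang_baxter]

theorem concat_shuffle_right_nil {L L' N : M} (s : N ⟶ L ⊗ L') :
    (λ_ N).inv ≫ 𝟙_ M ◁ s ≫ exchange _ _ _ = s ≫ L ◁ (λ_ L').inv := by
  rw [← exchange_unit_left]
  monoidal

theorem concat_shuffle_right_cons (X : M) {C B S S₁ S₂ N : M} (k : C ⟶ B ⊗ S) (s : S ⟶ S₁ ⊗ S₂)
    (s' : C ⟶ S₁ ⊗ N) (k' : N ⟶ B ⊗ S₂) (h : k ≫ B ◁ s ≫ exchange _ _ _ = s' ≫ S₁ ◁ k') :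
    (X ◁ k ≫ (α_ _ _ _).inv) ≫ (X ⊗ B) ◁ s ≫ exchange _ _ _ =
      (X ◁ s' ≫ exchange _ _ _) ≫ S₁ ◁ (X ◁ k' ≫ (α_ _ _ _).inv) := by
  have h' := congrArg (fun f => X ◁ f) h
  simp only [MonoidalCategory.whiskerLeft_comp] at h'
  rw [← cancel_mono (S₁ ◁ (α_ _ _ _).hom)]
  simp only [Category.assoc, exchange_tensor_left, MonoidalCategory.whiskerLeft_comp,
    whiskerLeft_inv_hom, Category.comp_id, tensor_whiskerLeft, Iso.inv_hom_id_assoc]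
  rw [← exchange_natural_right, reassoc_of% h']

theorem forest_shuffle_right {C B S S₁ S₂ N A F F₁ F₂ : M} (k : C ⟶ B ⊗ S) (o : B ⟶ A) (e : S ⟶ F)
    (s : F ⟶ F₁ ⊗ F₂) (s₀ : S ⟶ S₁ ⊗ S₂) (e₁ : S₁ ⟶ F₁) (e₂ : S₂ ⟶ F₂) (s' : C ⟶ S₁ ⊗ N)
    (k' : N ⟶ B ⊗ S₂) (h : e ≫ s = s₀ ≫ (e₁ ⊗ₘ e₂))
    (h' : k ≫ B ◁ s₀ ≫ exchange _ _ _ = s' ≫ S₁ ◁ k') :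
    (k ≫ (o ⊗ₘ e)) ≫ A ◁ s ≫ exchange _ _ _ = s' ≫ (e₁ ⊗ₘ (k' ≫ (o ⊗ₘ e₂))) := by
  rw [Category.assoc, tensor_natural_right o s₀ s e e₁ e₂ h, Category.assoc, reassoc_of% h',
    whiskerLeft_comp_tensorHom]

theorem swap_shuffle_right_right (X Y : M) {C L L' : M} (s : C ⟶ L ⊗ L') :
    exchange X Y C ≫ Y ◁ (X ◁ s ≫ exchange _ _ _) ≫ exchange _ _ _ =
      (X ◁ (Y ◁ s ≫ exchange _ _ _) ≫ exchange _ _ _) ≫ L ◁ exchange X Y L' := by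
  simp only [Category.assoc, MonoidalCategory.whiskerLeft_comp]
  rw [exchange_yang_baxter, exchange_natural_right_assoc]

theorem swap_shuffle_right_left (X Y : M) {C L L' : M} (s : C ⟶ L ⊗ L') :
    exchange X Y C ≫ Y ◁ (X ◁ s ≫ exchange _ _ _) ≫ (α_ _ _ _).inv =
      X ◁ (Y ◁ s ≫ (α_ _ _ _).inv) ≫ exchange _ _ _ := by
  rw [← cancel_mono (α_ _ _ _).hom]
  simp only [Category.assoc, MonoidalCategory.whiskerLeft_comp, exchange_tensor_mid,
    Iso.inv_hom_id, Category.comp_id, whiskerLeft_inv_hom_assoc]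
  rw [exchange_natural_right_assoc]

end Aux

section SymmetricAux

variable {M : Type u} [Category.{w} M] [MonoidalCategory M] [SymmetricCategory M]

theorem shuffle_exchange_left (X : M) {C L₁ L₂ L₃ N N' : M} (s₁ : C ⟶ L₁ ⊗ N) (s₂ : N ⟶ L₂ ⊗ L₃)
    (t₁ : C ⟶ L₂ ⊗ N') (t₂ : N' ⟶ L₁ ⊗ L₃)
    (h : s₁ ≫ L₁ ◁ s₂ = t₁ ≫ L₂ ◁ t₂ ≫ exchange _ _ _) :
    (X ◁ s₁ ≫ (α_ _ _ _).inv) ≫ (X ⊗ L₁) ◁ s₂ =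
      (X ◁ t₁ ≫ exchange _ _ _) ≫ L₂ ◁ (X ◁ t₂ ≫ (α_ _ _ _).inv) ≫ exchange _ _ _ := by
  have h' := congrArg (fun f => X ◁ f) h
  simp only [MonoidalCategory.whiskerLeft_comp] at h'
  rw [← cancel_mono (α_ _ _ _).hom]
  simp only [Category.assoc, MonoidalCategory.whiskerLeft_comp, exchange_tensor_mid,
    Iso.inv_hom_id_assoc, whiskerLeft_inv_hom_assoc, tensor_whiskerLeft, Iso.inv_hom_id,
    Category.comp_id]
  rw [← exchange_natural_right_assoc, reassoc_of% exchange_exchange, h']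

theorem swap_shuffle_left_right (X Y : M) {C L L' : M} (s : C ⟶ L ⊗ L') :
    exchange X Y C ≫ Y ◁ (X ◁ s ≫ (α_ _ _ _).inv) ≫ exchange _ _ _ =
      X ◁ (Y ◁ s ≫ exchange _ _ _) ≫ (α_ _ _ _).inv := by
  rw [← cancel_mono (α_ _ _ _).hom]
  simp only [Category.assoc, MonoidalCategory.whiskerLeft_comp, exchange_tensor_mid,
    Iso.inv_hom_id, Category.comp_id, whiskerLeft_inv_hom_assoc]
  rw [← exchange_natural_right_assoc, reassoc_of% exchange_exchange]

end SymmetricAux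

/-! ### Splitting tensor products along shuffles -/

section TensorShuffle

variable {M : Type u} [Category.{w} M] [MonoidalCategory M] [BraidedCategory M]
  {K : Type u₁} (A : K → M)

/-- The splitting of the tensor product over a shuffle. -/
def tensorShuffle : {l l' c : List K} → Shuffle l l' c →
    (tensorList A c ⟶ tensorList A l ⊗ tensorList A l')
  | _, _, _, .nil => (λ_ (𝟙_ M)).inv
  | _, _, _, .left x s => A x ◁ tensorShuffle s ≫ (α_ _ _ _).inv
  | _, _, _, .right x s => A x ◁ tensorShuffle s ≫ exchange _ _ _

theorem tensorShuffle_nilLeft : (l : List K) →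
    tensorShuffle A (.nilLeft l) = (λ_ (tensorList A l)).inv
  | [] => rfl
  | x :: l => by
      simp only [Shuffle.nilLeft, tensorShuffle, tensorShuffle_nilLeft l, tensorList]
      exact exchange_unit_mid _ _

theorem tensorShuffle_natural {A B : K → M} (f : ∀ x, A x ⟶ B x) : {l l' c : List K} →
    (s : Shuffle l l' c) → tensorListMap f c ≫ tensorShuffle B s =
      tensorShuffle A s ≫ (tensorListMap f l ⊗ₘ tensorListMap f l')
  | _, _, _, .nil => by simp [tensorShuffle, tensorListMap, tensorList]
  | _, _, _, .left x s => tensor_natural_left _ _ _ _ _ _ (tensorShuffle_natural f s)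
  | _, _, _, .right x s => tensor_natural_right _ _ _ _ _ _ (tensorShuffle_natural f s)

/-- A three-part shuffle can be bracketed either way; m collects the entries of l₂ and l₃. The
effects on positions and on tensor products are recorded together because the new shuffles are only
known through the recursion that builds them. -/
theorem Shuffle.assoc {l l₁ l₂ l₃ c : List K} (s₀ : Shuffle l₁ l₂ l) (s : Shuffle l l₃ c) :
    ∃ (m : List K) (s₁ : Shuffle l₁ m c) (s₂ : Shuffle l₂ l₃ m),
      (∀ x (p : Pos l₁ x), s.inl (s₀.inl p) = s₁.inl p) ∧
      (∀ x (p : Pos l₂ x), s.inl (s₀.inr p) = s₁.inr (s₂.inl p)) ∧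
      (∀ x (p : Pos l₃ x), s.inr p = s₁.inr (s₂.inr p)) ∧
      tensorShuffle A s ≫ tensorShuffle A s₀ ▷ tensorList A l₃ ≫ (α_ _ _ _).hom =
        tensorShuffle A s₁ ≫ tensorList A l₁ ◁ tensorShuffle A s₂ := by
  induction s generalizing l₁ l₂ with
  | nil =>
    cases s₀
    refine ⟨[], .nil, .nil, nofun, nofun, nofun, ?_⟩
    simp only [tensorShuffle, tensorList]
    monoidal
  | left x s ih =>
    cases s₀ with
    | left _ s₀ =>
      obtain ⟨m, s₁, s₂, h₁, h₂, h₃, h⟩ := ih s₀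
      refine ⟨m, .left x s₁, s₂, ?_, ?_, ?_, shuffle_assoc_left_left _ _ _ _ _ h⟩
      · rintro y (_ | p)
        · rfl
        · exact congrArg Pos.there (h₁ y _)
      · exact fun y p => congrArg Pos.there (h₂ y p)
      · exact fun y p => congrArg Pos.there (h₃ y p)
    | right _ s₀ =>
      obtain ⟨m, s₁, s₂, h₁, h₂, h₃, h⟩ := ih s₀
      refine ⟨_, .right x s₁, .left x s₂, ?_, ?_, ?_, shuffle_assoc_left_right _ _ _ _ _ h⟩
      · exact fun y p => congrArg Pos.there (h₁ y p)
      · rintro y (_ | p)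
        · rfl
        · exact congrArg Pos.there (h₂ y _)
      · exact fun y p => congrArg Pos.there (h₃ y p)
  | right x s ih =>
    obtain ⟨m, s₁, s₂, h₁, h₂, h₃, h⟩ := ih s₀
    refine ⟨_, .right x s₁, .right x s₂, ?_, ?_, ?_, shuffle_assoc_right _ _ _ _ _ h⟩
    · exact fun y p => congrArg Pos.there (h₁ y p)
    · exact fun y p => congrArg Pos.there (h₂ y p)
    · rintro y (_ | p)
      · rfl
      · exact congrArg Pos.there (h₃ y _)

/-- The initial block b is attached to the left part. This is the step that assigns the inputs of
one tree of a forest to a part of the shuffle. -/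
theorem Concat.shuffle_left {b l l₁ l₂ c : List K} (k : Concat b l c) (s : Shuffle l₁ l₂ l) :
    ∃ (m : List K) (k' : Concat b l₁ m) (s' : Shuffle m l₂ c),
      (∀ x (p : Pos b x), k.inl p = s'.inl (k'.inl p)) ∧
      (∀ x (p : Pos l₁ x), k.inr (s.inl p) = s'.inl (k'.inr p)) ∧
      (∀ x (p : Pos l₂ x), k.inr (s.inr p) = s'.inr p) ∧
      (tensorConcat A k).hom ≫ tensorList A b ◁ tensorShuffle A s ≫ (α_ _ _ _).inv =
        tensorShuffle A s' ≫ (tensorConcat A k').hom ▷ tensorList A l₂ := by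
  induction k with
  | nil l =>
    exact ⟨l₁, .nil _, s, nofun, fun _ _ => rfl, fun _ _ => rfl, concat_shuffle_left_nil _⟩
  | cons x k ih =>
    obtain ⟨m, k', s', h₁, h₂, h₃, h⟩ := ih s
    refine ⟨_, .cons x k', .left x s', ?_, ?_, ?_, concat_shuffle_left_cons _ _ _ _ _ h⟩
    · rintro y (_ | p)
      · rfl
      · exact congrArg Pos.there (h₁ y _)
    · exact fun y p => congrArg Pos.there (h₂ y p)
    · exact fun y p => congrArg Pos.there (h₃ y p)

/-- Now b joins the right part and has to pass the factors of l₁, whence the exchange. -/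
theorem Concat.shuffle_right {b l l₁ l₂ c : List K} (k : Concat b l c) (s : Shuffle l₁ l₂ l) :
    ∃ (m : List K) (k' : Concat b l₂ m) (s' : Shuffle l₁ m c),
      (∀ x (p : Pos b x), k.inl p = s'.inr (k'.inl p)) ∧
      (∀ x (p : Pos l₁ x), k.inr (s.inl p) = s'.inl p) ∧
      (∀ x (p : Pos l₂ x), k.inr (s.inr p) = s'.inr (k'.inr p)) ∧
      (tensorConcat A k).hom ≫ tensorList A b ◁ tensorShuffle A s ≫ exchange _ _ _ =
        tensorShuffle A s' ≫ tensorList A l₁ ◁ (tensorConcat A k').hom := by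
  induction k with
  | nil l =>
    exact ⟨l₂, .nil _, s, nofun, fun _ _ => rfl, fun _ _ => rfl, concat_shuffle_right_nil _⟩
  | cons x k ih =>
    obtain ⟨m, k', s', h₁, h₂, h₃, h⟩ := ih s
    refine ⟨_, .cons x k', .right x s', ?_, ?_, ?_, concat_shuffle_right_cons _ _ _ _ _ h⟩
    · rintro y (_ | p)
      · rfl
      · exact congrArg Pos.there (h₁ y _)
    · exact fun y p => congrArg Pos.there (h₂ y p)
    · exact fun y p => congrArg Pos.there (h₃ y p)

end TensorShuffle

section SymmetricTensorShuffle

variable {M : Type u} [Category.{w} M] [MonoidalCategory M] [SymmetricCategory M]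
  {K : Type u₁} (A : K → M)

/-- Extracting l₁ and then l₂ differs from extracting l₂ and then l₁ by a single exchange. For
one-entry lists this is what happens to the inputs when two neighbouring letters of a word are
transposed. -/
theorem Shuffle.exchange {l₁ l₂ l₃ m c : List K} (s₁ : Shuffle l₁ m c) (s₂ : Shuffle l₂ l₃ m) :
    ∃ (n : List K) (t₁ : Shuffle l₂ n c) (t₂ : Shuffle l₁ l₃ n),
      (∀ x (p : Pos l₁ x), s₁.inl p = t₁.inr (t₂.inl p)) ∧
      (∀ x (p : Pos l₂ x), s₁.inr (s₂.inl p) = t₁.inl p) ∧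
      (∀ x (p : Pos l₃ x), s₁.inr (s₂.inr p) = t₁.inr (t₂.inr p)) ∧
      tensorShuffle A s₁ ≫ tensorList A l₁ ◁ tensorShuffle A s₂ =
        tensorShuffle A t₁ ≫ tensorList A l₂ ◁ tensorShuffle A t₂ ≫ QFTOperad.exchange _ _ _ := by
  induction s₁ generalizing l₂ l₃ with
  | nil =>
    cases s₂
    refine ⟨[], .nil, .nil, nofun, nofun, nofun, ?_⟩
    simp only [tensorShuffle, tensorList]
    rw [exchange_unit_mid]
    monoidal
  | left x s₁ ih =>
    obtain ⟨n, t₁, t₂, h₁, h₂, h₃, h⟩ := ih s₂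
    refine ⟨_, .right x t₁, .left x t₂, ?_, ?_, ?_, shuffle_exchange_left _ _ _ _ _ h⟩
    · rintro y (_ | p)
      · rfl
      · exact congrArg Pos.there (h₁ y _)
    · exact fun y p => congrArg Pos.there (h₂ y p)
    · exact fun y p => congrArg Pos.there (h₃ y p)
  | right x s₁ ih =>
    cases s₂ with
    | left _ s₂ =>
      obtain ⟨n, t₁, t₂, h₁, h₂, h₃, h⟩ := ih s₂
      refine ⟨_, .left x t₁, t₂, ?_, ?_, ?_, shuffle_exchange_mid _ _ _ _ _ h⟩
      · exact fun y p => congrArg Pos.there (h₁ y p)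
      · rintro y (_ | p)
        · rfl
        · exact congrArg Pos.there (h₂ y _)
      · exact fun y p => congrArg Pos.there (h₃ y p)
    | right _ s₂ =>
      obtain ⟨n, t₁, t₂, h₁, h₂, h₃, h⟩ := ih s₂
      refine ⟨_, .right x t₁, .right x t₂, ?_, ?_, ?_, shuffle_exchange_right _ _ _ _ _ h⟩
      · exact fun y p => congrArg Pos.there (h₁ y p)
      · exact fun y p => congrArg Pos.there (h₂ y p)
      · rintro y (_ | p)
        · rfl
        · exact congrArg Pos.there (h₃ y _)

/-- An adjacent transposition of a shuffle, if the left part has no adjacent transpositions. -/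
theorem Shuffle.adjSwap {l l' c c' : List K} (s : Shuffle l l' c) (σ : AdjSwap c c')
    (hl : ∀ m, IsEmpty (AdjSwap l m)) :
    (∃ s' : Shuffle l l' c', (∀ x (p : Pos l x), σ.pos (s.inl p) = s'.inl p) ∧
      (∀ x (p : Pos l' x), σ.pos (s.inr p) = s'.inr p) ∧
      tensorSwap A σ ≫ tensorShuffle A s' = tensorShuffle A s) ∨
    ∃ (m : List K) (τ : AdjSwap l' m) (s' : Shuffle l m c'),
      (∀ x (p : Pos l x), σ.pos (s.inl p) = s'.inl p) ∧
      (∀ x (p : Pos l' x), σ.pos (s.inr p) = s'.inr (τ.pos p)) ∧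
      tensorSwap A σ ≫ tensorShuffle A s' =
        tensorShuffle A s ≫ tensorList A l ◁ tensorSwap A τ := by
  induction σ generalizing l l' with
  | here x y c =>
    cases s with
    | left _ s =>
      cases s with
      -- If both swapped entries lay in the left part, that part would itself have an adjacent
      -- transposition. In the application it has a single entry.
      | left _ s => exact ((hl _).false (.here x y _)).elim
      | right _ s =>
        refine .inl ⟨.right y (.left x s), ?_, ?_, swap_shuffle_left_right _ _ _⟩
        · rintro z (_ | p) <;> rfl
        · rintro z (_ | p) <;> rfl
    | right _ s =>
      cases s with
      | left _ s =>
        refine .inl ⟨.left y (.right x s), ?_, ?_, swap_shuffle_right_left _ _ _⟩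
        · rintro z (_ | p) <;> rfl
        · rintro z (_ | p) <;> rfl
      | right _ s =>
        refine .inr ⟨_, .here x y _, .right y (.right x s), ?_, ?_,
          swap_shuffle_right_right _ _ _⟩
        · exact fun _ _ => rfl
        · rintro z (_ | _ | p) <;> rfl
  | there x σ ih =>
    cases s with
    | left _ s =>
      obtain ⟨s', h₁, h₂, h⟩ | ⟨m, τ, s', h₁, h₂, h⟩ :=
        ih s (fun m => ⟨fun τ => (hl _).false (.there x τ)⟩)
      · refine .inl ⟨.left x s', ?_, fun y p => congrArg Pos.there (h₂ y p), ?_⟩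
        · rintro z (_ | p)
          · rfl
          · exact congrArg Pos.there (h₁ z _)
        · simp only [tensorShuffle, tensorSwap, ← h]
          exact (whiskerLeft_comp_assoc _ _ _ _).symm
      · refine .inr ⟨m, τ, .left x s', ?_, fun y p => congrArg Pos.there (h₂ y p), ?_⟩
        · rintro z (_ | p)
          · rfl
          · exact congrArg Pos.there (h₁ z _)
        · exact tensor_swap_left _ _ _ _ _ h
    | right _ s =>
      obtain ⟨s', h₁, h₂, h⟩ | ⟨m, τ, s', h₁, h₂, h⟩ := ih s hl
      · refine .inl ⟨.right x s', fun y p => congrArg Pos.there (h₁ y p), ?_, ?_⟩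
        · rintro z (_ | p)
          · rfl
          · exact congrArg Pos.there (h₂ z _)
        · simp only [tensorShuffle, tensorSwap, ← h]
          exact (whiskerLeft_comp_assoc _ _ _ _).symm
      · refine .inr ⟨_, .there x τ, .right x s', fun y p => congrArg Pos.there (h₁ y p), ?_, ?_⟩
        · rintro z (_ | p)
          · rfl
          · exact congrArg Pos.there (h₂ z _)
        · exact tensor_swap_right _ _ _ _ _ h

end SymmetricTensorShuffle

end QFTOperad

namespace QFTOperad

/-! ### Splitting families of words along shuffles -/

/-- Relabelling of the input of a letter. -/
def Letter.relabel {C : Type u₁} [Category.{v₁} C] {c c' : List C} {t : C}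
    (e : ∀ {x : C}, Pos c x → Pos c' x) (a : Letter c t) : Letter c' t :=
  ⟨a.src, e a.pos, a.hom⟩

/-- Composition of the morphism of a letter with a morphism. -/
def Letter.post {C : Type u₁} [Category.{v₁} C] {c : List C} {t t' : C}
    (f : t ⟶ t') (a : Letter c t) : Letter c t' :=
  ⟨a.src, a.pos, a.hom ≫ f⟩

section

variable {C : Type u₁} [Category.{v₁} C] {M : Type u} [Category.{w} M] [MonoidalCategory M]

/-- Each tree goes to the part that contains its root and takes its leaves along as a block. The
shuffle of the roots thus induces one of the leaves, compatibly with substitution and evaluation. -/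
theorem Forest.exists_shuffle [BraidedCategory M] {A : C → M}
    (α : ∀ {c : List C} {t : C}, Word c t → (tensorList A c ⟶ A t)) {b a l l' : List C}
    (φ : Forest b a) (s : Shuffle l l' a) :
    ∃ (b₁ b₂ : List C) (φ₁ : Forest b₁ l) (φ₂ : Forest b₂ l') (s' : Shuffle b₁ b₂ b),
      (∀ (t x : C) (p : Pos l x) (f : x ⟶ t),
        φ.subst (s.inl p) f = (φ₁.subst p f).map (Letter.relabel s'.inl)) ∧
      (∀ (t x : C) (p : Pos l' x) (f : x ⟶ t),
        φ.subst (s.inr p) f = (φ₂.subst p f).map (Letter.relabel s'.inr)) ∧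
      φ.eval α ≫ tensorShuffle A s = tensorShuffle A s' ≫ (φ₁.eval α ⊗ₘ φ₂.eval α) := by
  induction φ generalizing l l' with
  | nil =>
    cases s
    refine ⟨[], [], .nil, .nil, .nil, nofun, nofun, ?_⟩
    simp [Forest.eval, tensorShuffle, tensorList]
  | cons k o φ ih =>
    cases s with
    | left a s =>
      obtain ⟨b₁, b₂, φ₁, φ₂, s', h₁, h₂, h⟩ := ih s
      obtain ⟨m, k', s'', h₃, h₄, h₅, h'⟩ := k.shuffle_left A s'
      refine ⟨m, b₂, .cons k' o φ₁, φ₂, s'', ?_, ?_, forest_shuffle_left _ _ _ _ _ _ _ _ _ h h'⟩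
      · rintro t x (_ | p) f
        · simp [Forest.subst, Shuffle.inl, Letter.relabel, h₃]
        · simp [Forest.subst, Shuffle.inl, Letter.relabel, h₁, h₄]
      · intro t x p f
        simp [Forest.subst, Shuffle.inr, Letter.relabel, h₂, h₅]
    | right a s =>
      obtain ⟨b₁, b₂, φ₁, φ₂, s', h₁, h₂, h⟩ := ih s
      obtain ⟨m, k', s'', h₃, h₄, h₅, h'⟩ := k.shuffle_right A s'
      refine ⟨b₁, m, φ₁, .cons k' o φ₂, s'', ?_, ?_, forest_shuffle_right _ _ _ _ _ _ _ _ _ h h'⟩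
      · intro t x p f
        simp [Forest.subst, Shuffle.inl, Letter.relabel, h₁, h₄]
      · rintro t x (_ | p) f
        · simp [Forest.subst, Shuffle.inr, Letter.relabel, h₃]
        · simp [Forest.subst, Shuffle.inr, Letter.relabel, h₂, h₅]

/-- The concatenation with the empty list. -/
def Concat.nilRight {K : Type u} : (l : List K) → Concat l [] l
  | [] => .nil []
  | x :: l => .cons x (nilRight l)

theorem Concat.nilRight_inl {K : Type u} {x : K} : (l : List K) → (p : Pos l x) →
    (nilRight l).inl p = p
  | _ :: _, .here => rfl
  | _ :: l, .there p => congrArg Pos.there (nilRight_inl l p)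

theorem Concat.nilRight_rec {K : Type u} {l c : List K} (k : Concat l [] c)
    {Q : (c : List K) → Concat l [] c → Prop} (h : Q l (nilRight l)) : Q c k := by
  induction l generalizing c with
  | nil => cases k; exact h
  | cons x l ih =>
    cases k with
    | cons _ k => exact ih k (Q := fun c k => Q (x :: c) (.cons x k)) h

theorem tensorConcat_nilRight {K : Type u₁} (A : K → M) : (l : List K) →
    (tensorConcat A (.nilRight l)).hom = (ρ_ (tensorList A l)).inv
  | [] => unitors_inv_equal
  | x :: l => by
      change A x ◁ (tensorConcat A (.nilRight l)).hom ≫ (α_ _ _ (𝟙_ M)).inv =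
        (ρ_ (A x ⊗ tensorList A l)).inv
      rw [tensorConcat_nilRight A l]
      exact (rightUnitor_tensor_inv _ _).symm

end

/-! ### Positions in shuffles -/

/-- Together with `Shuffle.single_unique`, this says that choosing a position amounts to splitting
off one entry. -/
theorem Pos.exists_shuffle {K : Type u} {x : K} : {c : List K} → (p : Pos c x) →
    ∃ (c' : List K) (s : Shuffle [x] c' c), s.inl .here = p
  | _ :: l, .here => ⟨l, .left x (.nilLeft l), rfl⟩
  | y :: _, .there p => by
      obtain ⟨c', s, rfl⟩ := p.exists_shuffle
      exact ⟨y :: c', .right y s, rfl⟩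

theorem Shuffle.perm_allInputs {K : Type u} : {l l' c : List K} → (s : Shuffle l l' c) →
    (allInputs c).Perm ((allInputs l).map (fun p => ⟨p.1, s.inl p.2⟩) ++
      (allInputs l').map (fun p => ⟨p.1, s.inr p.2⟩))
  | _, _, _, .nil => .refl _
  | _, _, _, .left x s => by
      have := (s.perm_allInputs).map (fun p => (⟨p.1, Pos.there p.2⟩ : Input (x :: _)))
      simpa [allInputs, Function.comp_def, inl, inr] using this
  | _, _, _, .right x s => by
      have := (s.perm_allInputs).map (fun p => (⟨p.1, Pos.there p.2⟩ : Input (x :: _)))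
      refine ((this.cons (⟨x, .here⟩ : Input (x :: _)))).trans ?_
      simpa [allInputs, Function.comp_def, inl, inr] using List.perm_middle.symm

theorem Shuffle.inr_injective {K : Type u} {x : K} : {l l' c : List K} → (s : Shuffle l l' c) →
    Function.Injective (s.inr (x := x))
  | _, _, _, .left _ s, _, _, h => s.inr_injective (Pos.there.inj h)
  | _, _, _, .right _ _, .here, .here, _ => rfl
  | _, _, _, .right _ _, .here, .there _, h => nomatch h
  | _, _, _, .right _ _, .there _, .here, h => nomatch h
  | _, _, _, .right _ s, .there _, .there _, h =>
      congrArg Pos.there (s.inr_injective (Pos.there.inj h))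

theorem Shuffle.input_injective {K : Type u} {l l' c : List K} (s : Shuffle l l' c) :
    Function.Injective (fun p : Input l' => (⟨p.1, s.inr p.2⟩ : Input c)) := by
  rintro ⟨x, p⟩ ⟨y, q⟩ h
  obtain ⟨h₁, h⟩ := Sigma.mk.inj h
  dsimp only at h₁
  subst h₁
  exact congrArg (Sigma.mk x) (s.inr_injective (eq_of_heq h))

theorem Shuffle.nilLeft_unique {K : Type u} {l l' c : List K} (s : Shuffle [] l c)
    (s' : Shuffle [] l' c) : l = l' ∧ s ≍ s' := by
  induction c generalizing l l' with
  | nil =>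
    cases s
    cases s'
    exact ⟨rfl, .rfl⟩
  | cons y c ih =>
    cases s with
    | right _ s =>
      cases s' with
      | right _ s' =>
        obtain ⟨rfl, h⟩ := ih s s'
        obtain rfl := eq_of_heq h
        exact ⟨rfl, .rfl⟩

/-- The position of the extracted entry determines everything, including the remaining list. This
makes the value of a word unique. -/
theorem Shuffle.single_unique {K : Type u} {x : K} {l l' c : List K} (s : Shuffle [x] l c)
    (s' : Shuffle [x] l' c) (h : s.inl .here = s'.inl .here) : l = l' ∧ s ≍ s' := by
  induction c generalizing l l' with
  | nil => cases s
  | cons y c ih =>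
    cases s with
    | left _ s =>
      cases s' with
      | left _ s' =>
        obtain ⟨rfl, h⟩ := s.nilLeft_unique s'
        obtain rfl := eq_of_heq h
        exact ⟨rfl, .rfl⟩
      | right _ s' => nomatch h
    | right _ s =>
      cases s' with
      | left _ s' => nomatch h
      | right _ s' =>
        obtain ⟨rfl, h⟩ := ih s s' (Pos.there.inj h)
        obtain rfl := eq_of_heq h
        exact ⟨rfl, .rfl⟩

end QFTOperad

namespace QFTOperad

open scoped MonObj

/-! ### Commuting morphisms into a monoid -/

section Monoids

variable {M : Type u} [Category.{w} M] [MonoidalCategory M]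

theorem mul_tensor_assoc {Z X₁ X₂ X₃ : M} [MonObj Z] (a : X₁ ⟶ Z) (b : X₂ ⟶ Z) (f : X₃ ⟶ Z) :
    (((a ⊗ₘ b) ≫ μ[Z]) ⊗ₘ f) ≫ μ[Z] =
      (α_ _ _ _).hom ≫ (a ⊗ₘ ((b ⊗ₘ f) ≫ μ[Z])) ≫ μ[Z] := by
  have h := MonObj.mul_assoc Z
  rw [← tensorHom_comp_whiskerRight_assoc, h, associator_naturality_assoc,
    tensorHom_comp_whiskerLeft_assoc]

theorem eval_assoc {Z C L L₁ L₂ L₃ N : M} [MonObj Z] (a : L₁ ⟶ Z) (b : L₂ ⟶ Z) (f : L₃ ⟶ Z)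
    (s : C ⟶ L ⊗ L₃) (s₀ : L ⟶ L₁ ⊗ L₂) (s₁ : C ⟶ L₁ ⊗ N) (s₂ : N ⟶ L₂ ⊗ L₃)
    (h : s ≫ s₀ ▷ L₃ ≫ (α_ _ _ _).hom = s₁ ≫ L₁ ◁ s₂) :
    s ≫ ((s₀ ≫ (a ⊗ₘ b) ≫ μ[Z]) ⊗ₘ f) ≫ μ[Z] =
      s₁ ≫ (a ⊗ₘ (s₂ ≫ (b ⊗ₘ f) ≫ μ[Z])) ≫ μ[Z] := by
  rw [← whiskerRight_comp_tensorHom_assoc, mul_tensor_assoc, reassoc_of% h,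
    whiskerLeft_comp_tensorHom_assoc]

variable [BraidedCategory M]

/-- Two morphisms to a monoid commute. -/
def Commutes {X Y Z : M} [MonObj Z] (a : X ⟶ Z) (b : Y ⟶ Z) : Prop :=
  (a ⊗ₘ b) ≫ μ[Z] = (a ⊗ₘ b) ≫ (β_ Z Z).hom ≫ μ[Z]

/-- By naturality the braiding may be applied to the sources instead of the target. Calculations use
this form; the definition itself matches `IsPerpCommutativeOver`. -/
theorem Commutes.eq {X Y Z : M} [MonObj Z] {a : X ⟶ Z} {b : Y ⟶ Z} (h : Commutes a b) :
    (a ⊗ₘ b) ≫ μ[Z] = (β_ X Y).hom ≫ (b ⊗ₘ a) ≫ μ[Z] := by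
  rw [h, BraidedCategory.braiding_naturality_assoc]

theorem Commutes.of_eq {X Y Z : M} [MonObj Z] {a : X ⟶ Z} {b : Y ⟶ Z}
    (h : (a ⊗ₘ b) ≫ μ[Z] = (β_ X Y).hom ≫ (b ⊗ₘ a) ≫ μ[Z]) : Commutes a b := by
  rw [Commutes, h, BraidedCategory.braiding_naturality_assoc]

theorem Commutes.precomp {X X' Y Y' Z : M} [MonObj Z] {a : X ⟶ Z} {b : Y ⟶ Z} (h : Commutes a b)
    (f : X' ⟶ X) (g : Y' ⟶ Y) : Commutes (f ≫ a) (g ≫ b) := by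
  rw [Commutes, ← tensorHom_comp_tensorHom_assoc, ← tensorHom_comp_tensorHom_assoc, h]

theorem Commutes.map {X Y Z Z' : M} [MonObj Z] [MonObj Z'] {a : X ⟶ Z} {b : Y ⟶ Z}
    (h : Commutes a b) (f : Z ⟶ Z') [IsMonHom f] : Commutes (a ≫ f) (b ≫ f) := by
  refine .of_eq ?_
  have h' := h.eq =≫ f
  simpa only [Category.assoc, IsMonHom.mul_hom, tensorHom_comp_tensorHom_assoc] using h'

/-- Reassociate so that the commuting factors are multiplied first, swap them there, and reassociate
back. -/
theorem exchange_mul {X₁ X₂ X₃ Z : M} [MonObj Z] {a : X₁ ⟶ Z} {b : X₂ ⟶ Z} (f : X₃ ⟶ Z)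
    (h : Commutes b a) :
    exchange X₂ X₁ X₃ ≫ (a ⊗ₘ ((b ⊗ₘ f) ≫ μ[Z])) ≫ μ[Z] = (b ⊗ₘ ((a ⊗ₘ f) ≫ μ[Z])) ≫ μ[Z] := by
  rw [← cancel_epi (α_ X₂ X₁ X₃).hom, ← mul_tensor_assoc b a f, h.eq, exchange]
  simp only [Category.assoc, Iso.hom_inv_id_assoc]
  rw [← mul_tensor_assoc a b f, whiskerRight_comp_tensorHom_assoc]

end Monoids

/-! ### Values of words in a monoid-valued functor -/

section Eval

section

variable {C : Type u₁} [Category.{v₁} C] {M : Type u} [Category.{w} M] [MonoidalCategory M]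

/-- The objects underlying a monoid-valued functor. -/
abbrev carrier (L : C ⥤ Mon M) (c : C) : M := (L.obj c).X

/-- The value of a letter. -/
def letterEval (L : C ⥤ Mon M) {x t : C} (h : x ⟶ t) :
    tensorList (carrier L) [x] ⟶ (L.obj t).X :=
  (ρ_ (L.obj x).X).hom ≫ (L.map h).hom

/-- The value of the empty word. -/
def unitEval (L : C ⥤ Mon M) (t : C) : tensorList (carrier L) [] ⟶ (L.obj t).X :=
  η[(L.obj t).X]

theorem letterEval_post (L : C ⥤ Mon M) {x t t' : C} (f : x ⟶ t) (g : t ⟶ t') :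
    letterEval L (f ≫ g) = letterEval L f ≫ (L.map g).hom := by
  rw [letterEval, L.map_comp]
  exact (Category.assoc _ _ _).symm

theorem unitEval_post (L : C ⥤ Mon M) {t t' : C} (g : t ⟶ t') :
    unitEval L t ≫ (L.map g).hom = unitEval L t' :=
  IsMonHom.one_hom _

theorem letterEval_natural {L L' : C ⥤ Mon M} (θ : L ⟶ L') {x t : C} (f : x ⟶ t) :
    letterEval L f ≫ (θ.app t).hom =
      tensorListMap (fun x => (θ.app x).hom) [x] ≫ letterEval L' f := by
  have h := congrArg Mon.Hom.hom (θ.naturality f)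
  have h' : letterEval L f ≫ (θ.app t).hom =
      (ρ_ (L.obj x).X).hom ≫ (L.map f ≫ θ.app t).hom := Category.assoc _ _ _
  rw [h', h]
  change _ = ((θ.app x).hom ⊗ₘ 𝟙 (𝟙_ M)) ≫ (ρ_ (L'.obj x).X).hom ≫ (L'.map f).hom
  simp

theorem unitEval_natural {L L' : C ⥤ Mon M} (θ : L ⟶ L') (t : C) :
    unitEval L t ≫ (θ.app t).hom =
      tensorListMap (fun x => (θ.app x).hom) [] ≫ unitEval L' t :=
  (IsMonHom.one_hom (θ.app t).hom).trans (Category.id_comp _).symm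

end

variable {C : Type u₁} [Category.{v₁} C] {M : Type u} [Category.{w} M] [MonoidalCategory M]
  [SymmetricCategory M]

/-- `Eval L c w f` says that `f` is the value of the word `w` with inputs `c`, i.e. the product of
the values of its letters. -/
inductive Eval (L : C ⥤ Mon M) {t : C} : (c : List C) → List (Letter c t) →
    (tensorList (carrier L) c ⟶ (L.obj t).X) → Prop
  | nil : Eval L [] [] (unitEval L t)
  | cons {x : C} {c c' : List C} (s : Shuffle [x] c' c) (h : x ⟶ t) {w : List (Letter c' t)}
      {f : tensorList (carrier L) c' ⟶ (L.obj t).X} (e : Eval L c' w f) :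
      Eval L c (⟨x, s.inl .here, h⟩ :: w.map (Letter.relabel s.inr))
        (tensorShuffle (carrier L) s ≫ (letterEval L h ⊗ₘ f) ≫
          μ[(L.obj t).X])

namespace Eval

variable {L : C ⥤ Mon M}

/-- The constructor `Eval.cons` carries the head letter and the relabelled tail as indices. Here,
and in `mk_cons`, they become equations, so that the lists involved can be manipulated freely. -/
theorem inv_cons {t : C} {c : List C} {a : Letter c t} {w : List (Letter c t)}
    {f : tensorList (carrier L) c ⟶ (L.obj t).X} (e : Eval L c (a :: w) f) :
    ∃ (c' : List C) (s : Shuffle [a.src] c' c) (w' : List (Letter c' t))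
      (f' : tensorList (carrier L) c' ⟶ (L.obj t).X), Eval L c' w' f' ∧ a.pos = s.inl .here ∧
      w = w'.map (Letter.relabel s.inr) ∧ f = tensorShuffle (carrier L) s ≫
        (letterEval L a.hom ⊗ₘ f') ≫ μ[(L.obj t).X] := by
  cases e with
  | cons s h e => exact ⟨_, s, _, _, e, rfl, rfl, rfl⟩

theorem mk_cons {t : C} {c : List C} {a : Letter c t} {w : List (Letter c t)}
    {c' : List C} (s : Shuffle [a.src] c' c) {w' : List (Letter c' t)}
    {f' : tensorList (carrier L) c' ⟶ (L.obj t).X} (e : Eval L c' w' f')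
    (ha : a.pos = s.inl .here) (hw : w = w'.map (Letter.relabel s.inr)) :
    Eval L c (a :: w) (tensorShuffle (carrier L) s ≫
        (letterEval L a.hom ⊗ₘ f') ≫ μ[(L.obj t).X]) := by
  have h := Eval.cons s a.hom e
  rw [← ha] at h
  subst hw
  exact h

theorem relabel_injective {t : C} {l l' c : List C} (s : Shuffle l l' c) :
    Function.Injective (Letter.relabel (t := t) s.inr) := by
  rintro ⟨x, p, f⟩ ⟨y, q, g⟩ h
  obtain ⟨h₁, h₂, h₃⟩ := Letter.mk.inj h
  dsimp only at h₁
  subst h₁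
  obtain rfl := s.inr_injective (eq_of_heq h₂)
  obtain rfl := eq_of_heq h₃
  rfl

/-- The input of the first letter determines the shuffle, and injectivity of relabelling then
determines the tail. -/
theorem unique {t : C} {c : List C} {w : List (Letter c t)}
    {f g : tensorList (carrier L) c ⟶ (L.obj t).X} (e : Eval L c w f) (e' : Eval L c w g) :
    f = g := by
  induction e with
  | nil =>
    cases e'
    rfl
  | cons s h e ih =>
    obtain ⟨c', s', w', f', e₁, h₁, h₂, rfl⟩ := e'.inv_cons
    obtain ⟨rfl, h₃⟩ := s.single_unique s' h₁
    obtain rfl := eq_of_heq h₃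
    obtain rfl := List.map_injective_iff.2 (relabel_injective s) h₂
    rw [ih e₁]

/-- Linearity is what lets the recursion continue: once the input of the first letter is split off,
the other letters use exactly the remaining inputs. -/
theorem exists_of_linear (L : C ⥤ Mon M) {t : C} {c : List C} (w : List (Letter c t))
    (hw : (w.map Letter.input).Perm (allInputs c)) : ∃ f, Eval L c w f := by
  induction n : w.length generalizing c w with
  | zero =>
    obtain rfl := List.length_eq_zero_iff.1 n
    cases c with
    | nil => exact ⟨_, .nil⟩
    | cons x c => simp [allInputs] at hw
  | succ n ih =>
    obtain _ | ⟨a, w⟩ := w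
    · simp at n
    obtain ⟨c', s, hs⟩ := a.pos.exists_shuffle
    have h : (w.map Letter.input).Perm
        ((allInputs c').map (fun p => (⟨p.1, s.inr p.2⟩ : Input c))) := by
      have := hw.trans s.perm_allInputs
      simpa [allInputs, hs, Letter.input] using this
    -- By `h` every input in the tail lies in the right part, so the tail is a relabelled word over
    -- `c'`.
    obtain ⟨w', rfl⟩ : w ∈ Set.range (List.map (Letter.relabel (t := t) s.inr)) := by
      rw [Set.range_list_map]
      rintro ⟨y, p, f⟩ hb
      have := h.subset (List.mem_map_of_mem (f := Letter.input) hb)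
      obtain ⟨⟨z, q⟩, -, hq⟩ := List.mem_map.1 this
      obtain ⟨rfl, h₂⟩ := Sigma.mk.inj hq
      obtain rfl := eq_of_heq h₂
      exact ⟨⟨_, q, f⟩, rfl⟩
    obtain ⟨f, e⟩ := ih w' (by
      rw [← List.map_perm_map_iff s.input_injective]
      simpa [Function.comp_def, Letter.relabel, Letter.input] using h) (by simpa using n)
    exact ⟨_, mk_cons s e hs.symm rfl⟩

/-- Juxtaposed words have the product of their values: associativity of shuffles supplies the
inputs, associativity of the monoid the rest. -/
theorem append {t : C} {l l' c : List C} {w : List (Letter l t)} {w' : List (Letter l' t)}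
    {f : tensorList (carrier L) l ⟶ (L.obj t).X} {g : tensorList (carrier L) l' ⟶ (L.obj t).X}
    (e : Eval L l w f) (e' : Eval L l' w' g) (s : Shuffle l l' c) :
    Eval L c (w.map (Letter.relabel s.inl) ++ w'.map (Letter.relabel s.inr))
      (tensorShuffle (carrier L) s ≫ (f ⊗ₘ g) ≫ μ[(L.obj t).X]) := by
  induction e generalizing c with
  | nil =>
    induction s using Shuffle.nilLeft_rec with
    | h =>
      have h₁ : w'.map (Letter.relabel (Shuffle.nilLeft l').inr) = w' := by
        refine (List.map_congr_left fun a _ => ?_).trans (List.map_id _)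
        simp [Letter.relabel, Shuffle.nilLeft_inr]
      have h₂ : tensorShuffle (carrier L) (.nilLeft l') ≫ (unitEval L _ ⊗ₘ g) ≫
          μ[(L.obj t).X] = g := by
        rw [tensorShuffle_nilLeft]
        change (λ_ _).inv ≫ (η[(L.obj t).X] ⊗ₘ g) ≫ μ[(L.obj t).X] = g
        rw [tensorHom_def'_assoc, MonObj.one_mul]
        simp
      rw [h₁, h₂]
      exact e'
  | cons s₀ h e ih =>
    obtain ⟨m, s₁, s₂, h₁, h₂, h₃, h'⟩ := s₀.assoc (carrier L) s
    rw [eval_assoc _ _ _ _ _ _ _ h']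
    refine mk_cons (a := ⟨_, s.inl (s₀.inl .here), h⟩) s₁ (ih s₂) ?_ ?_
    · simp [h₁]
    · simp [Letter.relabel, Function.comp_def, h₂, h₃]

theorem post {t t' : C} {c : List C} {w : List (Letter c t)}
    {f : tensorList (carrier L) c ⟶ (L.obj t).X} (e : Eval L c w f) (h : t ⟶ t') :
    Eval L c (w.map (Letter.post h)) (f ≫ (L.map h).hom) := by
  induction e with
  | nil =>
    rw [unitEval_post]
    exact .nil
  | cons s g e ih =>
    have := mk_cons (a := ⟨_, s.inl .here, g ≫ h⟩) s ih rfl rfl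
    convert this using 1
    · simp [Letter.post, Letter.relabel, Function.comp_def]
    · simp [IsMonHom.mul_hom, letterEval_post]

/-- Either the transposition moves the input of the first letter, and then only the shuffle changes,
or it restricts to a transposition of the remaining inputs and the induction applies. -/
theorem permute {t : C} {c c' : List C} {w : List (Letter c t)}
    {f : tensorList (carrier L) c ⟶ (L.obj t).X} (e : Eval L c w f) (σ : AdjSwap c c') :
    ∃ f', Eval L c' (w.map (Letter.relabel σ.pos)) f' ∧ f = tensorSwap (carrier L) σ ≫ f' := by
  induction e generalizing c' with
  | nil => cases σ
  | cons s h e ih =>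
    obtain ⟨s', h₁, h₂, h'⟩ | ⟨m, τ, s', h₁, h₂, h'⟩ :=
      s.adjSwap (carrier L) σ (fun m => ⟨fun τ => by cases τ with | there _ τ => cases τ⟩)
    · refine ⟨_, mk_cons s' e ?_ ?_, ?_⟩
      · simp [Letter.relabel, h₁]
      · simp [Letter.relabel, Function.comp_def, h₂]
      · rw [← h', Category.assoc]
        rfl
    · obtain ⟨f', e', rfl⟩ := ih τ
      refine ⟨_, mk_cons s' e' ?_ ?_, ?_⟩
      · simp [Letter.relabel, h₁]
      · simp [Letter.relabel, Function.comp_def, h₂]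
      · simp only [Letter.relabel]
        rw [reassoc_of% h', whiskerLeft_comp_tensorHom_assoc]

theorem natural {L' : C ⥤ Mon M} (θ : L ⟶ L') {t : C} {c : List C} {w : List (Letter c t)}
    {f : tensorList (carrier L) c ⟶ (L.obj t).X} (e : Eval L c w f) :
    ∃ g, Eval L' c w g ∧
      f ≫ (θ.app t).hom = tensorListMap (fun x => (θ.app x).hom) c ≫ g := by
  induction e with
  | nil =>
    exact ⟨_, .nil, unitEval_natural θ _⟩
  | cons s h e ih =>
    obtain ⟨g, e', h'⟩ := ih
    refine ⟨_, .cons s h e', ?_⟩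
    rw [reassoc_of% tensorShuffle_natural (fun x => (θ.app x).hom) s]
    simp only [Category.assoc, IsMonHom.mul_hom, tensorHom_comp_tensorHom_assoc, h',
      letterEval_natural]

end Eval

end Eval

end QFTOperad

namespace QFTOperad

open scoped MonObj

/-! ### Values of particular words, of composites and of transposed words -/

section Values

variable {C : Type u₁} [Category.{v₁} C] {M : Type u} [Category.{w} M] [MonoidalCategory M]

theorem tensorShuffle_first [BraidedCategory M] {K : Type u₁} (A : K → M) (x : K) (l : List K) :
    tensorShuffle A (.left x (.nilLeft l)) = (ρ_ (A x)).inv ▷ tensorList A l := by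
  have h := tensorShuffle_nilLeft A l
  change A x ◁ tensorShuffle A (.nilLeft l) ≫ (α_ _ (𝟙_ M) _).inv = _
  rw [h]
  change A x ◁ (λ_ (tensorList A l)).inv ≫ (α_ _ (𝟙_ M) _).inv = _
  monoidal

theorem forest_value {B B₁ B₂ A' A₁ A₂ U X Z : M} (φ : B ⟶ A') (s : A' ⟶ (A₁ ⊗ 𝟙_ M) ⊗ A₂)
    (s' : B ⟶ B₁ ⊗ B₂) (k : B₁ ⟶ U ⊗ 𝟙_ M) (o : U ⟶ A₁) (φ₂ : B₂ ⟶ A₂) (h : A₁ ⟶ X) (f : A₂ ⟶ Z)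
    (m : X ⊗ Z ⟶ Z) (H : φ ≫ s = s' ≫ ((k ≫ (o ⊗ₘ 𝟙 (𝟙_ M))) ⊗ₘ φ₂)) :
    φ ≫ s ≫ (((ρ_ A₁).hom ≫ h) ⊗ₘ f) ≫ m =
      s' ≫ ((k ≫ ((o ≫ h) ⊗ₘ 𝟙 (𝟙_ M)) ≫ (ρ_ X).hom) ⊗ₘ (φ₂ ≫ f)) ≫ m := by
  rw [reassoc_of% H, tensorHom_comp_tensorHom_assoc]
  simp

theorem exchange_value [BraidedCategory M] {B N N' X₁ X₂ X₃ Z : M} [MonObj Z] {a : X₁ ⟶ Z}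
    {b : X₂ ⟶ Z} (f : X₃ ⟶ Z) {s₁ : B ⟶ X₁ ⊗ N} {s₂ : N ⟶ X₂ ⊗ X₃} {t₁ : B ⟶ X₂ ⊗ N'}
    {t₂ : N' ⟶ X₁ ⊗ X₃} (H : s₁ ≫ X₁ ◁ s₂ = t₁ ≫ X₂ ◁ t₂ ≫ exchange _ _ _)
    (h : Commutes b a) :
    s₁ ≫ (a ⊗ₘ (s₂ ≫ (b ⊗ₘ f) ≫ μ[Z])) ≫ μ[Z] =
      t₁ ≫ (b ⊗ₘ (t₂ ≫ (a ⊗ₘ f) ≫ μ[Z])) ≫ μ[Z] := by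
  rw [← whiskerLeft_comp_tensorHom_assoc a s₂, ← whiskerLeft_comp_tensorHom_assoc b t₂,
    reassoc_of% H, exchange_mul f h]

variable [SymmetricCategory M]

theorem Eval.first {L : C ⥤ Mon M} {x t : C} {l : List C} (h : x ⟶ t) {w : List (Letter l t)}
    {f : tensorList (carrier L) l ⟶ (L.obj t).X} (e : Eval L l w f) :
    Eval L (x :: l) (⟨x, .here, h⟩ :: w.map (Letter.relabel Pos.there))
      (((L.map h).hom ⊗ₘ f) ≫ μ[(L.obj t).X]) := by
  have := Eval.mk_cons (a := ⟨x, .here, h⟩) (.left x (.nilLeft l)) e rfl rfl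
  convert this using 1
  · congr 2
    funext a
    simp [Letter.relabel, Shuffle.inr, Shuffle.nilLeft_inr]
  · rw [tensorShuffle_first, letterEval]
    change ((L.map h).hom ⊗ₘ f) ≫ μ[(L.obj t).X] =
      (ρ_ (L.obj x).X).inv ▷ tensorList (carrier L) l ≫
        (((ρ_ (L.obj x).X).hom ≫ (L.map h).hom) ⊗ₘ f) ≫ μ[(L.obj t).X]
    rw [whiskerRight_comp_tensorHom_assoc, Iso.inv_hom_id_assoc]

theorem Eval.ofHom (L : C ⥤ Mon M) {x t : C} (h : x ⟶ t) :
    Eval L [x] (Word.ofHom h).letters (letterEval L h) := by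
  have := Eval.first h (Eval.nil (L := L) (t := t))
  convert this using 1
  · rfl
  · change (ρ_ (L.obj x).X).hom ≫ (L.map h).hom = ((L.map h).hom ⊗ₘ η) ≫ μ
    rw [tensorHom_def_assoc, MonObj.mul_one, rightUnitor_naturality]

theorem Eval.mul (L : C ⥤ Mon M) (t : C) :
    Eval L [t, t] (Word.mul t).letters ((L.obj t).X ◁ (ρ_ (L.obj t).X).hom ≫ μ[(L.obj t).X]) := by
  have := Eval.first (𝟙 t) (Eval.ofHom L (𝟙 t))
  convert this using 1
  · rfl
  · rw [letterEval, L.map_id]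
    change (L.obj t).X ◁ (ρ_ (L.obj t).X).hom ≫ μ[(L.obj t).X] =
      (𝟙 (L.obj t).X ⊗ₘ (ρ_ (L.obj t).X).hom ≫ 𝟙 (L.obj t).X) ≫ μ[(L.obj t).X]
    simp

theorem Eval.concat_nil {L : C ⥤ Mon M} {t : C} {l c : List C} (k : Concat l [] c)
    {w : List (Letter l t)} {f : tensorList (carrier L) l ⟶ (L.obj t).X} (e : Eval L l w f) :
    Eval L c (w.map (Letter.relabel k.inl))
      ((tensorConcat (carrier L) k).hom ≫ (f ⊗ₘ 𝟙 (𝟙_ M)) ≫ (ρ_ (L.obj t).X).hom) := by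
  induction k using Concat.nilRight_rec with
  | h =>
    have h₁ : w.map (Letter.relabel (Concat.nilRight l).inl) = w := by
      refine (List.map_congr_left fun a _ => ?_).trans (List.map_id _)
      simp [Letter.relabel, Concat.nilRight_inl]
    have h₂ : (tensorConcat (carrier L) (.nilRight l)).hom ≫ (f ⊗ₘ 𝟙 (𝟙_ M)) ≫
        (ρ_ (L.obj t).X).hom = f := by
      rw [tensorConcat_nilRight]
      change (ρ_ (tensorList (carrier L) l)).inv ≫ (f ⊗ₘ 𝟙 (𝟙_ M)) ≫ (ρ_ (L.obj t).X).hom = f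
      simp
    rw [h₁, h₂]
    exact e

/-- Split the forest along the shuffle that extracts the first letter: the tree over this letter
gives a word postcomposed with its morphism, and `Eval.append` joins it to the words from the rest.
-/
theorem Eval.comp {L : C ⥤ Mon M}
    (α : ∀ {c : List C} {t : C}, Word c t → (tensorList (carrier L) c ⟶ carrier L t))
    (hα : ∀ {c : List C} {t : C} (o : Word c t), Eval L c o.letters (α o)) {t : C}
    {a b : List C} {w : List (Letter a t)} {f : tensorList (carrier L) a ⟶ (L.obj t).X}
    (e : Eval L a w f) (φ : Forest b a) :
    Eval L b (w.flatMap (fun l => φ.subst l.pos l.hom)) (φ.eval α ≫ f) := by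
  induction e generalizing b with
  | nil =>
    cases φ
    have h : Forest.eval α Forest.nil ≫ unitEval L t = unitEval L t :=
      Category.id_comp (X := 𝟙_ M) _
    rw [h]
    exact .nil
  | cons s h e ih =>
    obtain ⟨b₁, b₂, φ₁, φ₂, s', h₁, h₂, H⟩ := φ.exists_shuffle α s
    -- The forest `φ₁` has a single root, so it is one tree followed by the empty forest.
    obtain _ | ⟨k, o, φ₀⟩ := φ₁
    cases φ₀
    have e₁ := (Eval.concat_nil (L := L) k ((hα o).post h)).append (ih φ₂) s'
    convert e₁ using 1
    · simp [h₁, h₂, Forest.subst, Letter.relabel, Letter.post, Function.comp_def,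
        List.map_flatMap, List.flatMap_map]
    · exact forest_value _ _ _ _ _ _ _ _ _ H

/-- Commutativity enters only when the orthogonal pair stands at the front; a longer prefix is
peeled off by induction. -/
theorem Eval.step {R : Orthogonality C} {L : C ⥤ Mon M} {t : C}
    (hL : IsPerpCommutativeOver R L t) {c : List C} {l r : List (Letter c t)} {a b : Letter c t}
    (hab : R.rel a.hom b.hom) {f : tensorList (carrier L) c ⟶ (L.obj t).X}
    (e : Eval L c (l ++ a :: b :: r) f) : Eval L c (l ++ b :: a :: r) f := by
  induction n : l.length generalizing c with
  | zero =>
    obtain rfl := List.length_eq_zero_iff.1 n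
    obtain ⟨c₁, s₁, w₁, f₁, e₁, h₁, h₂, rfl⟩ := e.inv_cons
    obtain ⟨b', r', rfl, rfl, rfl⟩ := List.map_eq_cons_iff.1 h₂.symm
    obtain ⟨c₂, s₂, w₂, f₂, e₂, h₃, rfl, rfl⟩ := e₁.inv_cons
    -- The inputs of the two letters are now extracted in the opposite order. The exchange this
    -- costs is absorbed by `exchange_value`, as the two values commute.
    obtain ⟨n, t₁, t₂, h₄, h₅, h₆, H⟩ := s₁.exchange (carrier L) s₂
    have hc : Commutes (letterEval L b'.hom) (letterEval L a.hom) :=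
      Commutes.precomp (hL _ _ _ _ (R.symm hab)) _ _
    rw [exchange_value f₂ H hc]
    refine Eval.mk_cons (a := b'.relabel s₁.inr) t₁
      (Eval.mk_cons (a := ⟨a.src, t₂.inl .here, a.hom⟩) t₂ e₂ rfl rfl)
      ((congrArg s₁.inr h₃).trans (h₅ _ _)) ?_
    have h₇ : a = Letter.relabel t₁.inr ⟨a.src, t₂.inl .here, a.hom⟩ := by
      rw [Letter.relabel, ← h₄, ← h₁]
    rw [List.map_cons]
    refine congrArg₂ List.cons h₇ ?_
    simp [Letter.relabel, h₆]
  | succ n ih =>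
    obtain _ | ⟨d, l⟩ := l
    · simp at n
    obtain ⟨c₁, s₁, w₁, f₁, e₁, h₁, h₂, rfl⟩ := e.inv_cons
    obtain ⟨l', r', rfl, rfl, h₃⟩ := List.map_eq_append_iff.1 h₂.symm
    obtain ⟨a', r₁, rfl, rfl, h₄⟩ := List.map_eq_cons_iff.1 h₃
    obtain ⟨b', r₂, rfl, rfl, rfl⟩ := List.map_eq_cons_iff.1 h₄
    exact Eval.mk_cons s₁ (ih (a := a') (b := b') hab e₁ (by simpa using n)) h₁ (by simp)

end Values

end QFTOperad

namespace QFTOperad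

open scoped MonObj

/-! ### From ⊥-commutative functors to algebras -/

section Construction

variable {C : Type u₁} [Category.{v₁} C] {M : Type u} [Category.{w} M] [MonoidalCategory M]
  [SymmetricCategory M]

/-- The value of a word in a monoid-valued functor. -/
noncomputable def evalWord (L : C ⥤ Mon M) {c : List C} {t : C} (o : Word c t) :
    tensorList (carrier L) c ⟶ carrier L t :=
  (Eval.exists_of_linear L o.letters o.linear).choose

theorem evalWord_spec (L : C ⥤ Mon M) {c : List C} {t : C} (o : Word c t) :
    Eval L c o.letters (evalWord L o) :=
  (Eval.exists_of_linear L o.letters o.linear).choose_spec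

theorem Eval.evalWord_eq {L : C ⥤ Mon M} {c : List C} {t : C} {o : Word c t}
    {f : tensorList (carrier L) c ⟶ carrier L t} (e : Eval L c o.letters f) : evalWord L o = f :=
  (evalWord_spec L o).unique e

/-- The algebra given by a `⊥`-commutative functor. -/
noncomputable def toAlg (R : Orthogonality C) (L : C ⥤ Mon M)
    (hL : ∀ c, IsPerpCommutativeOver R L c) : Alg R M where
  obj := carrier L
  act {c t} := Quot.lift (evalWord L) (by
    rintro o o' ⟨l, r, a, b, h, h₁, h₂⟩
    have e := evalWord_spec L o
    rw [h₁] at e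
    have e' := e.step (hL t) h
    rw [← h₂] at e'
    exact e'.evalWord_eq.symm)
  act_one t := by
    have h := (Eval.ofHom L (𝟙 t)).evalWord_eq
    refine h.trans ?_
    rw [letterEval, L.map_id]
    exact Category.comp_id _
  act_permute s o := by
    obtain ⟨f', e, h⟩ := (evalWord_spec L o).permute s
    exact h.trans (congrArg _ (Eval.evalWord_eq (o := o.permute s) e).symm)
  act_comp o φ :=
    (Eval.evalWord_eq (o := o.comp φ)
      ((evalWord_spec L o).comp (fun o => evalWord L o) (fun o => evalWord_spec L o) φ))

/-- The functor underlying the algebra given by a `⊥`-commutative functor. -/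
noncomputable def underlyingToAlg (R : Orthogonality C) (L : C ⥤ Mon M)
    (hL : ∀ c, IsPerpCommutativeOver R L c) : (underlying R M).obj (toAlg R L hL) ≅ L :=
  NatIso.ofComponents (fun c => Mon.mkIso (Iso.refl (L.obj c).X)
    (by
      have h : evalWord L (Word.unit c) = unitEval L c :=
        Eval.evalWord_eq (o := Word.unit c) .nil
      exact (Category.comp_id _).trans h)
    (by
      have h := (Eval.mul L c).evalWord_eq
      have h' : (L.obj c).X ◁ (ρ_ (L.obj c).X).inv ≫ evalWord L (Word.mul c) =
          μ[(L.obj c).X] := by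
        rw [h]
        exact whiskerLeft_inv_hom_assoc _ _ _
      refine (Category.comp_id _).trans (h'.trans ?_)
      change _ = (𝟙 (L.obj c).X ⊗ₘ 𝟙 (L.obj c).X) ≫ μ[(L.obj c).X]
      simp))
    (fun {c c'} f => by
      ext
      have h := (Eval.ofHom L f).evalWord_eq
      have h' : (ρ_ (L.obj c).X).inv ≫ evalWord L (Word.ofHom f) = (L.map f).hom := by
        rw [h, letterEval]
        exact Iso.inv_hom_id_assoc _ _
      exact (Category.comp_id _).trans (h'.trans (Category.id_comp _).symm))

end Construction

/-! ### Algebras are determined by their underlying functors -/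

/-- Sequences of adjacent transpositions. -/
inductive Rearrangement {K : Type u} (c : List K) : List K → Type u
  | refl : Rearrangement c c
  | snoc {c' c'' : List K} : Rearrangement c c' → AdjSwap c' c'' → Rearrangement c c''

namespace Rearrangement

/-- The bijection between positions given by a rearrangement. -/
def pos {K : Type u} {z : K} : {c c' : List K} → Rearrangement c c' → Pos c z → Pos c' z
  | _, _, .refl, p => p
  | _, _, .snoc r s, p => s.pos (r.pos p)

/-- A rearrangement that keeps the first entry. -/
def there {K : Type u} (x : K) : {c c' : List K} → Rearrangement c c' →
    Rearrangement (x :: c) (x :: c')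
  | _, _, .refl => .refl
  | _, _, .snoc r s => .snoc (r.there x) (.there x s)

theorem there_pos_here {K : Type u} (x : K) : {c c' : List K} → (r : Rearrangement c c') →
    (r.there x).pos .here = .here
  | _, _, .refl => by rw [there, pos]
  | _, _, .snoc r s => by rw [there, pos, there_pos_here x r, AdjSwap.pos]

theorem there_pos_there {K : Type u} (x : K) {y : K} : {c c' : List K} →
    (r : Rearrangement c c') → (p : Pos c y) → (r.there x).pos (.there p) = .there (r.pos p)
  | _, _, .refl, _ => by rw [there, pos, pos]
  | _, _, .snoc r s, p => by rw [there, pos, there_pos_there x r, AdjSwap.pos, pos]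

variable {M : Type u} [Category.{w} M] [MonoidalCategory M] [BraidedCategory M]

/-- The permutation of tensor factors given by a rearrangement. -/
def tensor {K : Type u₁} (A : K → M) : {c c' : List K} → Rearrangement c c' →
    (tensorList A c ⟶ tensorList A c')
  | _, _, .refl => 𝟙 _
  | _, _, .snoc r s => r.tensor A ≫ tensorSwap A s

theorem there_tensor {K : Type u₁} (A : K → M) (x : K) : {c c' : List K} →
    (r : Rearrangement c c') → (r.there x).tensor A = A x ◁ r.tensor A
  | _, _, .refl => by
      rw [there, tensor, tensor]
      exact (MonoidalCategory.whiskerLeft_id _ _).symm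
  | _, _, .snoc r s => by
      rw [there, tensor, there_tensor A x r, tensor, MonoidalCategory.whiskerLeft_comp]
      rfl

theorem rearrangement_right {X Y Y' T T' : M} (s : T ⟶ Y ⊗ T') (p : Y ⟶ Y') :
    X ◁ (s ≫ p ▷ T') ≫ exchange X Y' T' = (X ◁ s ≫ exchange X Y T') ≫ p ▷ (X ⊗ T') := by
  rw [MonoidalCategory.whiskerLeft_comp, Category.assoc, exchange_natural_mid, Category.assoc]

/-- Splitting off an entry amounts to carrying it to the front by adjacent transpositions, the only
permutations for which algebras state equivariance. -/
theorem exists_of_shuffle {K : Type u₁} (A : K → M) {x : K} {c c' : List K}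
    (s : Shuffle [x] c' c) :
    ∃ r : Rearrangement c (x :: c'), r.pos (s.inl .here) = .here ∧
      (∀ (y : K) (p : Pos c' y), r.pos (s.inr p) = .there p) ∧
      r.tensor A = tensorShuffle A s ≫ (ρ_ (A x)).hom ▷ tensorList A c' := by
  induction c generalizing c' with
  | nil => cases s
  | cons y c ih =>
    cases s with
    | left _ s =>
      induction s using Shuffle.nilLeft_rec with
      | h =>
        refine ⟨.refl, by rw [pos, Shuffle.inl], fun y p => ?_, ?_⟩
        · rw [pos, Shuffle.inr, Shuffle.nilLeft_inr]
        rw [tensorShuffle_first, tensor]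
        exact (inv_hom_whiskerRight _ _).symm
    | right _ s =>
      obtain ⟨r, h₁, h₂, h₃⟩ := ih s
      refine ⟨(r.there y).snoc (.here y x _), ?_, ?_, ?_⟩
      · simp [Shuffle.inl, pos, there_pos_there, h₁, AdjSwap.pos]
      · rintro z (_ | p)
        · simp [Shuffle.inr, pos, there_pos_here, AdjSwap.pos]
        · simp [Shuffle.inr, pos, there_pos_there, h₂, AdjSwap.pos]
      · rw [tensor, there_tensor, h₃]
        exact rearrangement_right _ _

end Rearrangement

section Determined

variable {C : Type u₁} [Category.{v₁} C] {M : Type u} [Category.{w} M] [MonoidalCategory M]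

theorem Alg.exists_rearrange [BraidedCategory M] {R : Orthogonality C} (A : Alg R M)
    {c c' : List C} {t : C} (r : Rearrangement c c') (o : Word c t) :
    ∃ o' : Word c' t, o'.letters = o.letters.map (Letter.relabel r.pos) ∧
      A.act (o.toOp R) = r.tensor A.obj ≫ A.act (o'.toOp R) := by
  induction r with
  | refl =>
    refine ⟨o, ?_, ?_⟩
    · refine ((List.map_congr_left fun a _ => ?_).trans (List.map_id _)).symm
      simp [Letter.relabel, Rearrangement.pos]
    · rw [Rearrangement.tensor, Category.id_comp]
  | snoc r s ih =>
    obtain ⟨o', h, h'⟩ := ih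
    refine ⟨o'.permute s, ?_, ?_⟩
    · simp [Word.permute, h, Letter.relabel, Rearrangement.pos]
    · rw [h', A.act_permute s, Rearrangement.tensor, Category.assoc]

theorem first_value {X Z T : M} (h : X ⟶ Z) (f : T ⟶ Z) (m : Z ⊗ Z ⟶ Z)
    {p : X ⊗ 𝟙_ M ⟶ Z} {k : T ⟶ T ⊗ 𝟙_ M} {q : Z ⊗ (Z ⊗ 𝟙_ M) ⟶ Z}
    (hp : (ρ_ X).inv ≫ p = h) (hk : k = (ρ_ T).inv) (hq : Z ◁ (ρ_ Z).inv ≫ q = m) :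
    ((X ◁ (λ_ T).inv ≫ (α_ X (𝟙_ M) T).inv) ≫ (p ⊗ₘ (k ≫ (f ⊗ₘ 𝟙 (𝟙_ M))))) ≫ q =
      (h ⊗ₘ f) ≫ m := by
  rw [← hp, hk, ← hq]
  monoidal

theorem rearrange_value {X Z T C : M} (s : C ⟶ (X ⊗ 𝟙_ M) ⊗ T) (h : X ⟶ Z) (f : T ⟶ Z)
    (m : Z ⊗ Z ⟶ Z) (p : X ⊗ 𝟙_ M ⟶ X) :
    (s ≫ p ▷ T) ≫ (h ⊗ₘ f) ≫ m = s ≫ ((p ≫ h) ⊗ₘ f) ≫ m := by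
  rw [Category.assoc, whiskerRight_comp_tensorHom_assoc]

/-- Such a word is an operadic composite of the binary multiplication with a unary operation and the
shorter word. -/
theorem Alg.act_first [BraidedCategory M] {R : Orthogonality C} (A : Alg R M) {c : List C}
    {x t : C} (h : x ⟶ t) (o : Word c t) (o' : Word (x :: c) t)
    (ho : o'.letters = ⟨x, .here, h⟩ :: o.letters.map (Letter.relabel Pos.there)) :
    A.act (o'.toOp R) = (A.map h ⊗ₘ A.act (o.toOp R)) ≫ A.mul t := by
  have e : o' = (Word.mul t).comp (.cons (.cons x (.nil c)) (Word.ofHom h)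
      (.cons (.nilRight c) o .nil)) := by
    ext1
    rw [ho]
    simp [Word.mul, Word.comp, Word.ofHom, Forest.subst, Concat.inl, Concat.inr,
      Concat.nilRight_inl, Letter.relabel]
  rw [e, A.act_comp]
  exact first_value _ _ _ rfl (tensorConcat_nilRight _ _) rfl

variable [SymmetricCategory M] {R : Orthogonality C}

/-- Equivariance brings the input of the first letter to the front and associativity splits that
letter off. By induction every structure map is built from units, products and the action of
morphisms. -/
theorem Alg.act_eq (A : Alg R M) {c : List C} {t : C} {w : List (Letter c t)}
    {f : tensorList (carrier A.toFunctor) c ⟶ (A.toFunctor.obj t).X} (e : Eval A.toFunctor c w f)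
    (hw : (w.map Letter.input).Perm (allInputs c)) : A.act (Word.toOp R ⟨w, hw⟩) = f := by
  induction e with
  | nil => rfl
  | @cons x c c' s h w f e ih =>
    obtain ⟨r, h₁, h₂, h₃⟩ := Rearrangement.exists_of_shuffle A.obj s
    obtain ⟨o, h₄, h₅⟩ := A.exists_rearrange r ⟨_, hw⟩
    have h₆ : o.letters = ⟨x, .here, h⟩ :: w.map (Letter.relabel Pos.there) := by
      rw [h₄]
      simp [Letter.relabel, h₁, h₂]
    have h₇ : (w.map Letter.input).Perm (allInputs c') := by
      have := o.linear
      rw [h₆] at this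
      rw [← List.map_perm_map_iff (Shuffle.left x (Shuffle.nilLeft c')).input_injective]
      simpa [allInputs, Letter.input, Letter.relabel, Function.comp_def, Shuffle.inr,
        Shuffle.nilLeft_inr] using this
    rw [h₅, A.act_first h ⟨w, h₇⟩ o h₆, ih h₇, h₃]
    exact rearrange_value _ _ _ _ _

/-- Both structure maps are values of the same word, and values are natural in the functor. -/
theorem Alg.hom_comm {A B : Alg R M} (θ : A.toFunctor ⟶ B.toFunctor) {c : List C} {t : C}
    (o : Operation R c t) :
    A.act o ≫ (θ.app t).hom = tensorListMap (fun x => (θ.app x).hom) c ≫ B.act o := by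
  induction o using Quot.ind with
  | mk o =>
    obtain ⟨f, e⟩ := Eval.exists_of_linear A.toFunctor o.letters o.linear
    obtain ⟨g, e', h⟩ := e.natural θ
    have h₁ := A.act_eq e o.linear
    have h₂ := B.act_eq e' o.linear
    rw [← h₁, ← h₂] at h
    exact h

/-- Algebras form a full subcategory of the monoid-valued functors. -/
def underlyingFullyFaithful (R : Orthogonality C) : (underlying R M).FullyFaithful where
  preimage θ := ⟨fun c => (θ.app c).hom, fun o => Alg.hom_comm θ o⟩
  map_preimage _ := rfl
  preimage_map _ := rfl

end Determined

end QFTOperad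

namespace QFTOperad

/-! ### Restriction of algebras and of underlying functors -/

section RestrictionUnderlying

theorem pull_mul {M : Type u} [Category.{w} M] [MonoidalCategory M] {X Z : M}
    (m : X ⊗ (X ⊗ 𝟙_ M) ⟶ Z) :
    X ◁ (ρ_ X).inv ≫ X ◁ X ◁ 𝟙 (𝟙_ M) ≫ m = X ◁ (ρ_ X).inv ≫ m := by
  rw [MonoidalCategory.whiskerLeft_id, MonoidalCategory.whiskerLeft_id, Category.id_comp]

theorem pull_map {M : Type u} [Category.{w} M] [MonoidalCategory M] {X Z : M}
    (m : X ⊗ 𝟙_ M ⟶ Z) : (ρ_ X).inv ≫ X ◁ 𝟙 (𝟙_ M) ≫ m = (ρ_ X).inv ≫ m := by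
  rw [MonoidalCategory.whiskerLeft_id, Category.id_comp]

variable {C : Type u₁} [Category.{v₁} C] {D : Type u₂} [Category.{v₂} D] (F : C ⥤ D)
  {M : Type u} [Category.{w} M] [MonoidalCategory M] [BraidedCategory M]

theorem Word.map_mul (c : C) : (Word.mul c).map F = Word.mul (F.obj c) := by
  ext1
  simp [Word.map, Word.mul, Letter.map, Pos.map]

theorem Word.map_ofHom {c c' : C} (f : c ⟶ c') :
    (Word.ofHom f).map F = Word.ofHom (F.map f) := rfl

theorem Alg.restrict_one {R : Orthogonality D} (B : Alg R M) (c : C) :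
    (B.restrict F).one c = B.one (F.obj c) :=
  Category.id_comp _

theorem Alg.restrict_mul {R : Orthogonality D} (B : Alg R M) (c : C) :
    (B.restrict F).mul c = B.mul (F.obj c) := by
  have h : ((Word.mul c).toOp (R.pullback F)).map F R = (Word.mul (F.obj c)).toOp R :=
    congrArg (Word.toOp R) (Word.map_mul F c)
  exact (pull_mul _).trans (congrArg (fun x => _ ◁ (ρ_ _).inv ≫ B.act x) h)

theorem Alg.restrict_map {R : Orthogonality D} (B : Alg R M) {c c' : C} (f : c ⟶ c') :
    (B.restrict F).map f = B.map (F.map f) := by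
  have h : ((Word.ofHom f).toOp (R.pullback F)).map F R = (Word.ofHom (F.map f)).toOp R :=
    congrArg (Word.toOp R) (Word.map_ofHom F f)
  exact (pull_map _).trans (congrArg (fun x => (ρ_ _).inv ≫ B.act x) h)

/-- The functor underlying a restricted algebra. -/
def underlyingRestrict {R : Orthogonality D} (B : Alg R M) :
    (underlying (R.pullback F) M).obj ((restriction F R M).obj B) ≅
      F ⋙ (underlying R M).obj B :=
  NatIso.ofComponents (fun c => Mon.mkIso (Iso.refl (B.obj (F.obj c)))
    ((Category.comp_id _).trans (B.restrict_one F c))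
    (((Category.comp_id _).trans (B.restrict_mul F c)).trans (by
      change B.mul (F.obj c) = (𝟙 _ ⊗ₘ 𝟙 _) ≫ B.mul (F.obj c)
      simp)))
    (fun f => by
      ext
      exact ((Category.comp_id _).trans (B.restrict_map F f)).trans (Category.id_comp _).symm)

theorem underlyingRestrict_natural {R : Orthogonality D} {B B' : Alg R M} (φ : B ⟶ B') :
    (underlying (R.pullback F) M).map ((restriction F R M).map φ) ≫
      (underlyingRestrict F B').hom =
    (underlyingRestrict F B).hom ≫ Functor.whiskerLeft F ((underlying R M).map φ) := by
  ext c
  exact (Category.comp_id _).trans (Category.id_comp _).symm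

end RestrictionUnderlying

/-! ### Operadic extensions from Kan extensions -/

section Extension

variable {C : Type u₁} [Category.{v₁} C] {D : Type u₂} [Category.{v₂} D] (j : C ⥤ D)
  {M : Type u} [Category.{w} M] [MonoidalCategory M] [SymmetricCategory M]

/-- If the functor underlying an algebra is a left Kan extension, then the algebra is the operadic
extension. -/
theorem exists_isOperadicExtension {R : Orthogonality D} (A : Alg (R.pullback j) M) (L : D ⥤ Mon M)
    (α : (underlying (R.pullback j) M).obj A ⟶ j ⋙ L) [L.IsLeftKanExtension α] (B : Alg R M)
    (i : (underlying R M).obj B ≅ L) :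
    ∃ η : A ⟶ (restriction j R M).obj B, IsOperadicExtension R j A B η := by
  refine ⟨(underlyingFullyFaithful _).preimage
    (α ≫ Functor.whiskerLeft j i.inv ≫ (underlyingRestrict j B).inv), fun B' ψ => ?_⟩
  -- In order: full faithfulness over D, the identification of the functor of B with L, the
  -- universal property of L, restriction of underlying functors, and full faithfulness over C.
  let e : (B ⟶ B') ≃ (A ⟶ (restriction j R M).obj B') :=
    (underlyingFullyFaithful R).homEquiv.trans <|
      (i.homFromEquiv).trans <|
      (L.homEquivOfIsLeftKanExtension α _).trans <|
      ((underlyingRestrict j B').symm.homToEquiv).trans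
      (underlyingFullyFaithful _).homEquiv.symm
  -- It remains to see that the bijection `e` is composition with the chosen unit, which is checked
  -- on underlying functors.
  convert e.bijective.existsUnique ψ using 3 with φ
  apply (underlyingFullyFaithful _).map_injective
  have h : (underlying (R.pullback j) M).map (e φ) =
      (α ≫ Functor.whiskerLeft j (i.inv ≫ (underlying R M).map φ)) ≫
        (underlyingRestrict j B').inv :=
    (underlyingFullyFaithful (R.pullback j)).map_preimage _
  have h' := underlyingRestrict_natural j φ
  rw [← Iso.inv_comp_eq, ← Category.assoc, ← Iso.eq_comp_inv] at h'
  rw [Functor.map_comp, Functor.FullyFaithful.map_preimage, h]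
  simp only [Category.assoc, Functor.whiskerLeft_comp]
  congr 2

theorem IsOperadicExtension.nonempty_iso {R : Orthogonality D} {A : Alg (R.pullback j) M}
    {B B' : Alg R M} {η : A ⟶ (restriction j R M).obj B} {η' : A ⟶ (restriction j R M).obj B'}
    (h : IsOperadicExtension R j A B η) (h' : IsOperadicExtension R j A B' η') :
    Nonempty (B ≅ B') := by
  obtain ⟨f, hf, -⟩ := h B' η'
  obtain ⟨g, hg, -⟩ := h' B η
  refine ⟨f, g, ?_, ?_⟩
  · exact (h B η).unique (by rw [Functor.map_comp, ← Category.assoc, hf, hg])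
      (by rw [CategoryTheory.Functor.map_id, Category.comp_id])
  · exact (h' B' η').unique (by rw [Functor.map_comp, ← Category.assoc, hg, hf])
      (by rw [CategoryTheory.Functor.map_id, Category.comp_id])

end Extension

end QFTOperad

namespace QFTOperad


/-! ### Left Kan extensions into categories with products -/

section Kan

variable {C : Type u₁} [Category.{v₁} C] {D : Type u₂} [Category.{v₂} D] {E : Type u}
  [Category.{w} E]

/-- The right Kan extension of an object along the inclusion of an object `d`. -/
noncomputable def powerFunctor (d : D) (Y : E) [∀ d' : D, HasProduct fun _ : d' ⟶ d => Y] :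
    D ⥤ E where
  obj d' := ∏ᶜ fun _ : d' ⟶ d => Y
  map f := Pi.lift fun h => Pi.π (fun _ => Y) (f ≫ h)

section

variable (d : D) (Y : E) [∀ d' : D, HasProduct fun _ : d' ⟶ d => Y]

/-- The projections of the values of `powerFunctor d Y`. -/
noncomputable def powerFunctorProj {d' : D} (h : d' ⟶ d) : (powerFunctor d Y).obj d' ⟶ Y :=
  Pi.π (fun _ => Y) h

variable {d Y}

/-- Morphisms to the values of `powerFunctor d Y`. -/
noncomputable def powerFunctorLift {d' : D} {X : E} (γ : (d' ⟶ d) → (X ⟶ Y)) :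
    X ⟶ (powerFunctor d Y).obj d' :=
  Pi.lift γ

@[simp]
theorem powerFunctorLift_proj {d' : D} {X : E} (γ : (d' ⟶ d) → (X ⟶ Y)) (h : d' ⟶ d) :
    powerFunctorLift γ ≫ powerFunctorProj d Y h = γ h :=
  Pi.lift_π _ _

@[simp]
theorem powerFunctor_map_proj {d₁ d₂ : D} (f : d₁ ⟶ d₂) (h : d₂ ⟶ d) :
    (powerFunctor d Y).map f ≫ powerFunctorProj d Y h = powerFunctorProj d Y (f ≫ h) :=
  Pi.lift_π _ _

theorem powerFunctor_hom_ext {d' : D} {X : E} {u v : X ⟶ (powerFunctor d Y).obj d'}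
    (h : ∀ g : d' ⟶ d, u ≫ powerFunctorProj d Y g = v ≫ powerFunctorProj d Y g) : u = v :=
  Pi.hom_ext _ _ h

end

variable {j : C ⥤ D} {A : C ⥤ E} {L : D ⥤ E} (α : A ⟶ j ⋙ L) [L.IsLeftKanExtension α] {d : D}
  {Y : E} [∀ d' : D, HasProduct fun _ : d' ⟶ d => Y]

-- The Kan extension is not assumed pointwise, but `powerFunctor d Y` represents maps L(d) ⟶ Y as
-- natural transformations out of L. Hence L(d) still has the universal property of a colimit with
-- respect to Y.
include α in
theorem hom_ext_of_kan {u v : L.obj d ⟶ Y}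
    (h : ∀ (c : C) (g : j.obj c ⟶ d), α.app c ≫ L.map g ≫ u = α.app c ≫ L.map g ≫ v) : u = v := by
  let θ (u : L.obj d ⟶ Y) : L ⟶ powerFunctor d Y :=
    { app d' := powerFunctorLift fun h => L.map h ≫ u
      naturality d₁ d₂ f := powerFunctor_hom_ext fun h => by simp }
  have hθ : θ u = θ v := by
    apply L.hom_ext_of_isLeftKanExtension α
    ext c
    exact powerFunctor_hom_ext fun g => by simpa [θ] using h c g
  have := NatTrans.congr_app hθ d =≫ powerFunctorProj d Y (𝟙 d)
  simpa [θ] using this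

/-- A cocone γ is the same as a natural transformation from A to the restriction of `powerFunctor d
Y`. Extend it to L and project to the component of the identity of d. -/
theorem exists_desc_of_kan (γ : ∀ (c : C), (j.obj c ⟶ d) → (A.obj c ⟶ Y))
    (hγ : ∀ {c c' : C} (f : c ⟶ c') (g : j.obj c' ⟶ d), A.map f ≫ γ c' g = γ c (j.map f ≫ g)) :
    ∃ u : L.obj d ⟶ Y, ∀ (c : C) (g : j.obj c ⟶ d), α.app c ≫ L.map g ≫ u = γ c g := by
  let β : A ⟶ j ⋙ powerFunctor d Y :=
    { app c := powerFunctorLift fun g => γ c g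
      naturality c c' f := powerFunctor_hom_ext fun g => by simp [hγ] }
  let θ := L.descOfIsLeftKanExtension α _ β
  refine ⟨θ.app d ≫ powerFunctorProj d Y (𝟙 d), fun c g => ?_⟩
  have h : α.app c ≫ θ.app (j.obj c) = β.app c := L.descOfIsLeftKanExtension_fac_app α _ β c
  rw [θ.naturality_assoc, reassoc_of% h]
  simp [β]

end Kan

/-! ### The centralizer of a morphism into a monoid -/

section Centralizer

open scoped MonObj

variable {M : Type u} [Category.{w} M] [MonoidalCategory M]

section

variable [BraidedCategory M] {X X' Y Z : M} [MonObj Z]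

theorem Commutes.one (ψ : Y ⟶ Z) : Commutes ψ η[Z] := by
  refine .of_eq ?_
  rw [tensorHom_def_assoc, MonObj.mul_one, tensorHom_def'_assoc, MonObj.one_mul,
    leftUnitor_naturality, rightUnitor_naturality, ← braiding_leftUnitor Y, Category.assoc]

theorem Commutes.mul {ψ : Y ⟶ Z} {f : X ⟶ Z} {g : X' ⟶ Z} (hf : Commutes ψ f)
    (hg : Commutes ψ g) : Commutes ψ ((f ⊗ₘ g) ≫ μ[Z]) := by
  refine .of_eq ?_
  rw [← cancel_epi (α_ Y X X').hom, ← mul_tensor_assoc, hf.eq, ← whiskerRight_comp_tensorHom_assoc,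
    mul_tensor_assoc, hg.eq, ← whiskerLeft_comp_tensorHom_assoc,
    BraidedCategory.braiding_tensor_right_hom]
  simp only [Category.assoc, Iso.hom_inv_id_assoc]
  rw [mul_tensor_assoc, Iso.inv_hom_id_assoc]

end

theorem Commutes.symm [SymmetricCategory M] {X Y Z : M} [MonObj Z] {a : X ⟶ Z} {b : Y ⟶ Z}
    (h : Commutes a b) : Commutes b a := by
  refine .of_eq ?_
  rw [h.eq, SymmetricCategory.symmetry_assoc]

variable [BraidedCategory M] [MonoidalClosed M] {Y Z : M} [MonObj Z] (ψ : Y ⟶ Z)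

/-- Currying away Y turns commutation with ψ into equality after composition with two fixed parallel
morphisms out of Z, so an equalizer is the universal solution. -/
theorem commutes_iff_curry {X : M} (f : X ⟶ Z) : Commutes ψ f ↔
    f ≫ MonoidalClosed.curry (ψ ▷ Z ≫ μ[Z]) =
      f ≫ MonoidalClosed.curry (ψ ▷ Z ≫ (β_ Z Z).hom ≫ μ[Z]) := by
  rw [← MonoidalClosed.curry_natural_left, ← MonoidalClosed.curry_natural_left,
    MonoidalClosed.curry_injective.eq_iff, Commutes, tensorHom_def', Category.assoc, Category.assoc]

variable [HasEqualizers M]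

/-- The centralizer of a morphism to a monoid. -/
noncomputable def centralizerObj : M :=
  equalizer (MonoidalClosed.curry (ψ ▷ Z ≫ μ[Z]))
    (MonoidalClosed.curry (ψ ▷ Z ≫ (β_ Z Z).hom ≫ μ[Z]))

/-- The inclusion of the centralizer. -/
noncomputable def centralizerι : centralizerObj ψ ⟶ Z := equalizer.ι _ _

instance : Mono (centralizerι ψ) := equalizer.ι_mono

theorem commutes_centralizerι : Commutes ψ (centralizerι ψ) :=
  (commutes_iff_curry ψ _).2 (equalizer.condition _ _)

variable {ψ} in
/-- The factorization of a commuting morphism through the centralizer. -/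
noncomputable def centralizerLift {X : M} (f : X ⟶ Z) (h : Commutes ψ f) :
    X ⟶ centralizerObj ψ :=
  equalizer.lift f ((commutes_iff_curry ψ f).1 h)

variable {ψ} in
@[simp]
theorem centralizerLift_ι {X : M} (f : X ⟶ Z) (h : Commutes ψ f) :
    centralizerLift f h ≫ centralizerι ψ = f :=
  equalizer.lift_ι _ _

/-- The operations are inherited from Z, and the axioms are checked after the monomorphism into Z.
-/
noncomputable instance : MonObj (centralizerObj ψ) where
  one := centralizerLift η[Z] (.one ψ)
  mul := centralizerLift _ ((commutes_centralizerι ψ).mul (commutes_centralizerι ψ))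
  one_mul := by
    rw [← cancel_mono (centralizerι ψ)]
    simp only [Category.assoc, centralizerLift_ι]
    rw [whiskerRight_comp_tensorHom_assoc, centralizerLift_ι, tensorHom_def'_assoc,
      MonObj.one_mul, leftUnitor_naturality]
  mul_one := by
    rw [← cancel_mono (centralizerι ψ)]
    simp only [Category.assoc, centralizerLift_ι]
    rw [whiskerLeft_comp_tensorHom_assoc, centralizerLift_ι, tensorHom_def_assoc,
      MonObj.mul_one, rightUnitor_naturality]
  mul_assoc := by
    rw [← cancel_mono (centralizerι ψ)]
    simp only [Category.assoc, centralizerLift_ι]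
    rw [whiskerRight_comp_tensorHom_assoc, centralizerLift_ι, mul_tensor_assoc,
      whiskerLeft_comp_tensorHom_assoc, centralizerLift_ι]

instance : IsMonHom (centralizerι ψ) where
  one_hom := centralizerLift_ι _ _
  mul_hom := centralizerLift_ι _ _

instance isMonHom_centralizerLift {X : M} [MonObj X] (f : X ⟶ Z) [IsMonHom f]
    (h : Commutes ψ f) : IsMonHom (centralizerLift f h) where
  one_hom := by
    rw [← cancel_mono (centralizerι ψ), Category.assoc, centralizerLift_ι, IsMonHom.one_hom,
      IsMonHom.one_hom]
  mul_hom := by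
    rw [← cancel_mono (centralizerι ψ), Category.assoc, centralizerLift_ι, IsMonHom.mul_hom,
      Category.assoc, IsMonHom.mul_hom, tensorHom_comp_tensorHom_assoc, centralizerLift_ι]

end Centralizer

/-! ### Commutativity of the Kan extension over closed objects -/

section Closed

variable {C : Type u₁} [Category.{v₁} C] {M : Type u} [Category.{w} M] [MonoidalCategory M]

theorem swap_value [BraidedCategory M] {X Y Z : M} {a : X ⟶ Z} {b : Y ⟶ Z} {m : Z ⊗ Z ⟶ Z}
    (h : (a ⊗ₘ ((ρ_ Y).hom ≫ b)) ≫ m = exchange X Y (𝟙_ M) ≫ (b ⊗ₘ ((ρ_ X).hom ≫ a)) ≫ m) :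
    (a ⊗ₘ b) ≫ m = (β_ X Y).hom ≫ (b ⊗ₘ a) ≫ m := by
  rw [← whiskerLeft_comp_tensorHom_assoc, ← whiskerLeft_comp_tensorHom_assoc] at h
  rw [← cancel_epi (X ◁ (ρ_ Y).hom), h, exchange]
  monoidal

/-- After swapping its inputs, the word f₁(Φ₁)f₂(Φ₂) differs from the word with the letters in the
other order by one orthogonal transposition. Equivariance thus identifies the two products up to the
braiding. -/
theorem Alg.isPerpCommutativeOver [SymmetricCategory M] {R : Orthogonality C} (A : Alg R M)
    (c : C) : IsPerpCommutativeOver R A.toFunctor c := by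
  intro c₁ c₂ f₁ f₂ h
  let o : Word [c₁, c₂] c := ⟨[⟨c₁, .here, f₁⟩, ⟨c₂, .there .here, f₂⟩], .refl _⟩
  let o' : Word [c₂, c₁] c := ⟨[⟨c₂, .here, f₂⟩, ⟨c₁, .there .here, f₁⟩], .refl _⟩
  have h₁ := A.act_permute (.here c₁ c₂ []) o
  have h₂ : (o.permute (.here c₁ c₂ [])).toOp R = o'.toOp R :=
    Quot.sound ⟨[], [], ⟨c₁, .there .here, f₁⟩, ⟨c₂, .here, f₂⟩, h, rfl, rfl⟩
  have h₃ := A.act_eq (Eval.first f₁ (Eval.ofHom A.toFunctor f₂)) o.linear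
  have h₄ := A.act_eq (Eval.first f₂ (Eval.ofHom A.toFunctor f₁)) o'.linear
  rw [h₂] at h₁
  exact Commutes.of_eq (swap_value (h₃.symm.trans (h₁.trans (congrArg _ h₄))))

variable {D : Type w} [SmallCategory D] {j : C ⥤ D} [SymmetricCategory M] [MonoidalClosed M]
  [HasLimits M]

/-- By hypothesis the cocone with components A(c) ⟶ L(d) takes values in the centralizer of ψ. It
descends to L(d'), and by uniqueness `L.map f` factors through the centralizer. -/
theorem commutes_of_kan {A : C ⥤ Mon M} {L : D ⥤ Mon M} (α : A ⟶ j ⋙ L) [L.IsLeftKanExtension α]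
    {d d' : D} (f : d' ⟶ d) {Y : M} (ψ : Y ⟶ (L.obj d).X)
    (h : ∀ (c : C) (g : j.obj c ⟶ d'), Commutes ψ (α.app c ≫ L.map (g ≫ f)).hom) :
    Commutes ψ (L.map f).hom := by
  let K : Mon M := ⟨centralizerObj ψ⟩
  let i : K ⟶ L.obj d := ⟨centralizerι ψ⟩
  have hi : Mono i :=
    ⟨fun a b h => Mon.Hom.ext ((cancel_mono (centralizerι ψ)).1 (congrArg Mon.Hom.hom h))⟩
  let γ (c : C) (g : j.obj c ⟶ d') : A.obj c ⟶ K := ⟨centralizerLift _ (h c g)⟩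
  have hγ (c : C) (g : j.obj c ⟶ d') : γ c g ≫ i = α.app c ≫ L.map (g ≫ f) :=
    Mon.Hom.ext (centralizerLift_ι _ (h c g))
  obtain ⟨u, hu⟩ := exists_desc_of_kan α (Y := K) (d := d') γ (fun {c c'} k g => by
    rw [← cancel_mono i, Category.assoc, hγ, hγ, Category.assoc, L.map_comp (j.map k),
      α.naturality_assoc]
    rfl)
  have hu' : L.map f = u ≫ i := by
    apply hom_ext_of_kan α
    intro c g
    rw [reassoc_of% hu c g, hγ, L.map_comp]
  rw [hu']
  have := (commutes_centralizerι ψ).precomp (𝟙 Y) u.hom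
  rwa [Category.id_comp] at this

/-- Reducing one variable at a time leaves pairs with sources in C. These factor through a single
A(c), whose commutativity is pushed forward along a monoid morphism. -/
theorem isPerpCommutativeOver_of_isClosedAt {R : Orthogonality D} {d : D} (hd : IsClosedAt R j d)
    {A : C ⥤ Mon M} (hA : ∀ c, IsPerpCommutativeOver (R.pullback j) A c) {L : D ⥤ Mon M}
    (α : A ⟶ j ⋙ L) [L.IsLeftKanExtension α] : IsPerpCommutativeOver R L d := by
  intro d₁ d₂ f₁ f₂ hf
  refine Commutes.symm (commutes_of_kan α f₁ _ fun c₁ g₁ => Commutes.symm ?_)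
  refine commutes_of_kan α f₂ _ fun c₂ g₂ => ?_
  obtain ⟨c, g, k₁, k₂, h₁, h₂, hk⟩ := hd c₁ c₂ (g₁ ≫ f₁) (g₂ ≫ f₂) (R.precomp g₁ g₂ hf)
  rw [← h₁, ← h₂]
  have e {c' : C} (k : c' ⟶ c) :
      α.app c' ≫ L.map (j.map k ≫ g) = A.map k ≫ α.app c ≫ L.map g := by
    rw [α.naturality_assoc, L.map_comp]
    rfl
  rw [e, e]
  exact Commutes.map (hA c _ _ _ _ hk) _

end Closed

end QFTOperad

namespace QFTOperad

open scoped MonObj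

/-! ### Copowers of the unit object -/

section Copower

variable {M : Type u} [Category.{w} M] [MonoidalCategory M]

section Point

variable {Z : M} [MonObj Z]

theorem unit_tensor_point (a : 𝟙_ M ⟶ Z) : (λ_ (𝟙_ M)).inv ≫ (η[Z] ⊗ₘ a) ≫ μ[Z] = a := by
  rw [tensorHom_def'_assoc, MonObj.one_mul, leftUnitor_naturality, Iso.inv_hom_id_assoc]

theorem point_tensor_unit (a : 𝟙_ M ⟶ Z) : (λ_ (𝟙_ M)).inv ≫ (a ⊗ₘ η[Z]) ≫ μ[Z] = a := by
  rw [tensorHom_def_assoc, MonObj.mul_one, rightUnitor_naturality, unitors_inv_equal,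
    Iso.inv_hom_id_assoc]

theorem point_tensor_assoc (a b c : 𝟙_ M ⟶ Z) :
    (λ_ (𝟙_ M)).inv ≫ (((λ_ (𝟙_ M)).inv ≫ (a ⊗ₘ b) ≫ μ[Z]) ⊗ₘ c) ≫ μ[Z] =
      (λ_ (𝟙_ M)).inv ≫ (a ⊗ₘ ((λ_ (𝟙_ M)).inv ≫ (b ⊗ₘ c) ≫ μ[Z])) ≫ μ[Z] := by
  rw [← whiskerRight_comp_tensorHom_assoc, mul_tensor_assoc, ← whiskerLeft_comp_tensorHom_assoc a (λ_ (𝟙_ M)).inv]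
  generalize (a ⊗ₘ ((b ⊗ₘ c) ≫ μ[Z])) ≫ μ[Z] = x
  monoidal

theorem point_tensor_map {Z' : M} [MonObj Z'] (f : Z ⟶ Z') [IsMonHom f] (a b : 𝟙_ M ⟶ Z) :
    ((λ_ (𝟙_ M)).inv ≫ (a ⊗ₘ b) ≫ μ[Z]) ≫ f =
      (λ_ (𝟙_ M)).inv ≫ ((a ≫ f) ⊗ₘ (b ≫ f)) ≫ μ[Z'] := by
  simp only [Category.assoc, IsMonHom.mul_hom, tensorHom_comp_tensorHom_assoc]

end Point

/-- The points of a monoid. -/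
def Points (Z : Mon M) : Type w := 𝟙_ M ⟶ Z.X

instance (Z : Mon M) : Monoid (Points Z) where
  one := η[Z.X]
  mul a b := (λ_ (𝟙_ M)).inv ≫ (a ⊗ₘ b) ≫ μ[Z.X]
  one_mul a := unit_tensor_point a
  mul_one a := point_tensor_unit a
  mul_assoc a b c := point_tensor_assoc a b c

/-- The map on points given by a morphism of monoids. -/
def Points.map {Z Z' : Mon M} (f : Z ⟶ Z') : Points Z →* Points Z' where
  toFun a := (show 𝟙_ M ⟶ Z.X from a) ≫ f.hom
  map_one' := IsMonHom.one_hom f.hom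
  map_mul' a b := point_tensor_map f.hom a b

theorem Points.map_comp {Z Z' Z'' : Mon M} (f : Z ⟶ Z') (g : Z' ⟶ Z'') (a : Points Z) :
    Points.map (f ≫ g) a = Points.map g (Points.map f a) :=
  (Category.assoc _ _ _).symm

theorem Points.map_id {Z : Mon M} (a : Points Z) : Points.map (𝟙 Z) a = a :=
  Category.comp_id _

variable [HasColimits M]

/-- The copower of the unit object by a set. -/
noncomputable def copowerObj (M : Type u) [Category.{w} M] [MonoidalCategory M] [HasColimits M]
    (S : Type w) : M :=
  ∐ fun _ : S => 𝟙_ M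

/-- The points of a copower. -/
noncomputable def copowerι {S : Type w} (s : S) : 𝟙_ M ⟶ copowerObj M S :=
  Sigma.ι (fun _ : S => 𝟙_ M) s

/-- The morphism from a copower given by a family of points. -/
noncomputable def copowerLift {S : Type w} {W : M} (F : S → (𝟙_ M ⟶ W)) : copowerObj M S ⟶ W :=
  Sigma.desc F

@[simp]
theorem copowerι_lift {S : Type w} {W : M} (F : S → (𝟙_ M ⟶ W)) (s : S) :
    copowerι s ≫ copowerLift F = F s :=
  Sigma.ι_desc _ _

theorem copower_hom_ext {S : Type w} {W : M} {f g : copowerObj M S ⟶ W}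
    (h : ∀ s : S, copowerι s ≫ f = copowerι s ≫ g) : f = g :=
  Sigma.hom_ext _ _ h

/-- Sending s to one coprojection and all other elements to the other separates s from them. -/
theorem copowerι_injective (hM : (coprod.inl : 𝟙_ M ⟶ 𝟙_ M ⨿ 𝟙_ M) ≠ coprod.inr) {S : Type w} :
    Function.Injective (copowerι : S → (𝟙_ M ⟶ copowerObj M S)) := by
  classical
  intro s t h
  by_contra hst
  have h' := h =≫ copowerLift fun x => if x = s then (coprod.inl : 𝟙_ M ⟶ 𝟙_ M ⨿ 𝟙_ M)
    else coprod.inr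
  rw [copowerι_lift, copowerι_lift, if_pos rfl, if_neg (Ne.symm hst)] at h'
  exact hM h'

variable [MonoidalClosed M]

/-- As M is closed, tensoring with Y is a left adjoint and preserves the coproduct. -/
theorem tensor_copower_hom_ext {S : Type w} {Y W : M} {f g : Y ⊗ copowerObj M S ⟶ W}
    (h : ∀ s : S, Y ◁ copowerι s ≫ f = Y ◁ copowerι s ≫ g) : f = g := by
  apply MonoidalClosed.curry_injective
  apply copower_hom_ext
  intro s
  rw [← MonoidalClosed.curry_natural_left, h, MonoidalClosed.curry_natural_left]

/-- The morphism from a tensor product of two copowers given by a family of points. -/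
noncomputable def copowerLift₂ {S T : Type w} {W : M} (F : S → T → (𝟙_ M ⟶ W)) :
    copowerObj M S ⊗ copowerObj M T ⟶ W :=
  MonoidalClosed.uncurry (copowerLift fun t =>
    MonoidalClosed.curry ((ρ_ _).hom ≫ copowerLift fun s => F s t))

theorem copowerι_lift₂ {S T : Type w} {W : M} (F : S → T → (𝟙_ M ⟶ W)) (s : S) (t : T) :
    (copowerι s ⊗ₘ copowerι t) ≫ copowerLift₂ F = (λ_ (𝟙_ M)).hom ≫ F s t := by
  rw [tensorHom_def_assoc, copowerLift₂, ← MonoidalClosed.uncurry_natural_left, copowerι_lift,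
    MonoidalClosed.uncurry_curry, rightUnitor_naturality_assoc, copowerι_lift, unitors_equal]

variable [SymmetricCategory M]

theorem copower_tensor_hom_ext {S : Type w} {Y W : M} {f g : copowerObj M S ⊗ Y ⟶ W}
    (h : ∀ s : S, copowerι s ▷ Y ≫ f = copowerι s ▷ Y ≫ g) : f = g := by
  rw [← cancel_epi (β_ Y (copowerObj M S)).hom]
  apply tensor_copower_hom_ext
  intro s
  rw [BraidedCategory.braiding_naturality_right_assoc,
    BraidedCategory.braiding_naturality_right_assoc, h]

theorem copower_tensor_copower_hom_ext {S T : Type w} {W : M}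
    {f g : copowerObj M S ⊗ copowerObj M T ⟶ W}
    (h : ∀ (s : S) (t : T), (copowerι s ⊗ₘ copowerι t) ≫ f = (copowerι s ⊗ₘ copowerι t) ≫ g) :
    f = g := by
  apply tensor_copower_hom_ext
  intro t
  apply copower_tensor_hom_ext
  intro s
  rw [← tensorHom_def_assoc, ← tensorHom_def_assoc, h]

theorem copower_tensor₃_hom_ext {S T U : Type w} {W : M}
    {f g : (copowerObj M S ⊗ copowerObj M T) ⊗ copowerObj M U ⟶ W}
    (h : ∀ (s : S) (t : T) (u : U), ((copowerι s ⊗ₘ copowerι t) ⊗ₘ copowerι u) ≫ f =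
      ((copowerι s ⊗ₘ copowerι t) ⊗ₘ copowerι u) ≫ g) :
    f = g := by
  apply tensor_copower_hom_ext
  intro u
  rw [← cancel_epi (ρ_ _).inv]
  apply copower_tensor_copower_hom_ext
  intro s t
  rw [rightUnitor_inv_naturality_assoc, rightUnitor_inv_naturality_assoc, ← tensorHom_def_assoc,
    ← tensorHom_def_assoc, h]

variable {S : Type w} [Monoid S]

/-- This is the monoid algebra of S over the unit object; every axiom is checked on points. -/
noncomputable instance : MonObj (copowerObj M S) where
  one := copowerι 1
  mul := copowerLift₂ fun s t => copowerι (s * t)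
  one_mul := by
    apply tensor_copower_hom_ext
    intro s
    rw [← tensorHom_def'_assoc, copowerι_lift₂, one_mul, leftUnitor_naturality]
  mul_one := by
    apply copower_tensor_hom_ext
    intro s
    rw [← tensorHom_def_assoc, copowerι_lift₂, mul_one, rightUnitor_naturality, unitors_equal]
  mul_assoc := by
    apply copower_tensor₃_hom_ext
    intro s t u
    rw [tensorHom_comp_whiskerRight_assoc, copowerι_lift₂, associator_naturality_assoc,
      tensorHom_comp_whiskerLeft_assoc, copowerι_lift₂, ← whiskerRight_comp_tensorHom_assoc,
      copowerι_lift₂, ← whiskerLeft_comp_tensorHom_assoc, copowerι_lift₂, mul_assoc]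
    monoidal

variable (M S) in
/-- The copower of the unit object by a monoid. -/
noncomputable abbrev copower : Mon M := ⟨copowerObj M S⟩

theorem copowerι_tensor_mul (s t : S) :
    (copowerι s ⊗ₘ copowerι t) ≫ μ[copowerObj M S] = (λ_ (𝟙_ M)).hom ≫ copowerι (s * t) :=
  copowerι_lift₂ _ _ _

theorem copowerι_mul (s t : S) :
    copowerι (s * t) = (λ_ (𝟙_ M)).inv ≫ (copowerι s ⊗ₘ copowerι t) ≫ μ[copowerObj M S] := by
  rw [copowerι_tensor_mul, Iso.inv_hom_id_assoc]

theorem mul_copowerLift {Z : M} [MonObj Z] (F : S → (𝟙_ M ⟶ Z))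
    (hF : ∀ s t, F (s * t) = (λ_ (𝟙_ M)).inv ≫ (F s ⊗ₘ F t) ≫ μ[Z]) :
    μ[copowerObj M S] ≫ copowerLift F = (copowerLift F ⊗ₘ copowerLift F) ≫ μ[Z] := by
  apply copower_tensor_copower_hom_ext
  intro s t
  rw [reassoc_of% copowerι_tensor_mul s t, tensorHom_comp_tensorHom_assoc, copowerι_lift,
    copowerι_lift, copowerι_lift, hF, Iso.hom_inv_id_assoc]

/-- The points of the copower by a monoid. -/
noncomputable def copowerPoints : S →* Points (copower M S) where
  toFun s := copowerι s
  map_one' := rfl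
  map_mul' s t := copowerι_mul s t

/-- The morphism of monoids from a copower given by a homomorphism to the monoid of points. -/
noncomputable def copowerDesc {Z : Mon M} (φ : S →* Points Z) : copower M S ⟶ Z where
  hom := copowerLift φ
  isMonHom_hom :=
    { one_hom := (copowerι_lift _ _).trans φ.map_one
      mul_hom := mul_copowerLift _ φ.map_mul }

theorem map_copowerDesc {Z : Mon M} (φ : S →* Points Z) (s : S) :
    Points.map (copowerDesc φ) (copowerPoints s) = φ s :=
  copowerι_lift _ _

/-- With `copowerDesc`, this is the universal property that makes the monoid algebra left adjoint to
taking points. -/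
theorem copower_mon_hom_ext {Z : Mon M} {f g : copower M S ⟶ Z}
    (h : (Points.map f).comp copowerPoints = (Points.map g).comp copowerPoints) : f = g :=
  Mon.Hom.ext (copower_hom_ext fun s => DFunLike.congr_fun h s)

end Copower

theorem isLeftKanExtension_of_existsUnique {C : Type u₁} [Category.{v₁} C] {D : Type u₂}
    [Category.{v₂} D] {E : Type u} [Category.{w} E] {j : C ⥤ D} {A : C ⥤ E} {L : D ⥤ E}
    (α : A ⟶ j ⋙ L)
    (h : ∀ (G : D ⥤ E) (β : A ⟶ j ⋙ G), ∃! θ : L ⟶ G, α ≫ Functor.whiskerLeft j θ = β) :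
    L.IsLeftKanExtension α where
  nonempty_isUniversal := ⟨IsInitial.ofUniqueHom
    (fun X => StructuredArrow.homMk (h X.right X.hom).choose (h X.right X.hom).choose_spec.1)
    (fun X m => StructuredArrow.ext _ _
      ((h X.right X.hom).choose_spec.2 m.right (StructuredArrow.w m)))⟩

end QFTOperad

namespace QFTOperad

open scoped MonObj

/-! ### The functor of commuting points -/

section CopowerCommutes

variable {M : Type u} [Category.{w} M] [MonoidalCategory M] [HasColimits M]
  [SymmetricCategory M] [MonoidalClosed M] {S : Type w} [Monoid S]

theorem copowerι_tensor_braiding_mul (s t : S) :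
    (copowerι s ⊗ₘ copowerι t) ≫ (β_ _ _).hom ≫ μ[copowerObj M S] =
      (λ_ (𝟙_ M)).hom ≫ copowerι (t * s) := by
  rw [BraidedCategory.braiding_naturality_assoc, copowerι_tensor_mul,
    braiding_leftUnitor_assoc, unitors_equal]

end CopowerCommutes

section Generators

variable {C : Type w} [SmallCategory C] {D : Type w} [SmallCategory D] (R : Orthogonality D)
  (j : C ⥤ D) (X : Bool → C)

/-- The morphisms to `d` from the images of two given objects. -/
@[ext]
structure Gen (d : D) : Type w where
  /-- The index of the source. -/
  src : Bool
  /-- The morphism. -/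
  hom : j.obj (X src) ⟶ d

variable {j X}

/-- Postcomposition of generators. -/
def Gen.map {d d' : D} (f : d ⟶ d') (a : Gen j X d) : Gen j X d' := ⟨a.src, a.hom ≫ f⟩

/-- Two generators are related if they factor orthogonally through an object of `C`. -/
def Gen.Related {d : D} (a b : Gen j X d) : Prop :=
  ∃ (c : C) (g : j.obj c ⟶ d) (f₁ : X a.src ⟶ c) (f₂ : X b.src ⟶ c),
    j.map f₁ ≫ g = a.hom ∧ j.map f₂ ≫ g = b.hom ∧ (R.pullback j).rel f₁ f₂

variable {R}

theorem Gen.Related.symm {d : D} {a b : Gen j X d} (h : a.Related R b) : b.Related R a :=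
  let ⟨c, g, f₁, f₂, h₁, h₂, h⟩ := h
  ⟨c, g, f₂, f₁, h₂, h₁, (R.pullback j).symm h⟩

theorem Gen.Related.map {d d' : D} (f : d ⟶ d') {a b : Gen j X d} (h : a.Related R b) :
    (a.map f).Related R (b.map f) :=
  let ⟨c, g, f₁, f₂, h₁, h₂, h⟩ := h
  ⟨c, g ≫ f, f₁, f₂, (Category.assoc _ _ _).symm.trans (h₁ =≫ f),
    (Category.assoc _ _ _).symm.trans (h₂ =≫ f), h⟩

theorem Gen.map_id {d : D} (a : Gen j X d) : a.map (𝟙 d) = a :=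
  Gen.ext rfl (heq_of_eq (Category.comp_id _))

theorem Gen.mk_id_map {d : D} {b : Bool} (f : j.obj (X b) ⟶ d) :
    (⟨b, 𝟙 _⟩ : Gen j X (j.obj (X b))).map f = ⟨b, f⟩ :=
  Gen.ext rfl (heq_of_eq (Category.id_comp _))

theorem Gen.map_comp {d d' d'' : D} (f : d ⟶ d') (g : d' ⟶ d'') (a : Gen j X d) :
    a.map (f ≫ g) = (a.map f).map g :=
  Gen.ext rfl (heq_of_eq (Category.assoc _ _ _).symm)

variable (R j X)

/-- The monoid generated by the generators at `d`, in which related generators commute. -/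
def GenMonoid (d : D) : Type w :=
  PresentedMonoid fun x y : FreeMonoid (Gen j X d) =>
    ∃ a b : Gen j X d, a.Related R b ∧ x = FreeMonoid.of a * FreeMonoid.of b ∧
      y = FreeMonoid.of b * FreeMonoid.of a

instance (d : D) : Monoid (GenMonoid R j X d) :=
  inferInstanceAs (Monoid (PresentedMonoid _))

namespace GenMonoid

variable {j X} {d d' : D}

/-- A generator as an element of the monoid. -/
def of (a : Gen j X d) : GenMonoid R j X d := PresentedMonoid.of _ a

variable {R}

/-- The homomorphism given by a map on generators. -/
def lift {N : Type*} [Monoid N] (f : Gen j X d → N)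
    (h : ∀ a b, a.Related R b → f a * f b = f b * f a) : GenMonoid R j X d →* N :=
  PresentedMonoid.lift f (by
    rintro _ _ ⟨a, b, hab, rfl, rfl⟩
    simpa using h a b hab)

@[simp]
theorem lift_of {N : Type*} [Monoid N] (f : Gen j X d → N)
    (h : ∀ a b, a.Related R b → f a * f b = f b * f a) (a : Gen j X d) :
    lift f h (of R a) = f a :=
  rfl

theorem hom_ext {N : Type*} [Monoid N] {φ ψ : GenMonoid R j X d →* N}
    (h : ∀ a, φ (of R a) = ψ (of R a)) : φ = ψ :=
  PresentedMonoid.ext _ h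

theorem of_mul_of {a b : Gen j X d} (h : a.Related R b) : of R a * of R b = of R b * of R a :=
  PresentedMonoid.mk_eq_mk_of_rel ⟨a, b, h, rfl, rfl⟩

theorem induction {p : GenMonoid R j X d → Prop} (h_of : ∀ a, p (of R a)) (h_one : p 1)
    (h_mul : ∀ x y, p x → p y → p (x * y)) (x : GenMonoid R j X d) : p x := by
  have hx : x ∈ Submonoid.closure (Set.range (of R (j := j) (X := X) (d := d))) := by
    erw [PresentedMonoid.closure_range_of]
    trivial
  induction hx using Submonoid.closure_induction with
  | mem x hx => obtain ⟨a, rfl⟩ := hx; exact h_of a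
  | one => exact h_one
  | mul x y _ _ hx hy => exact h_mul x y hx hy

/-- If a and b were unrelated, the monoid would map onto the free monoid on two letters with a and b
going to the two letters, which do not commute. -/
theorem related_of_mul_of {a b : Gen j X d} (hab : a.src ≠ b.src)
    (h : of R a * of R b = of R b * of R a) : a.Related R b := by
  classical
  by_contra hn
  have hab' : b ≠ a := fun e => hab (by rw [e])
  -- All other generators go to 1, so only a relation between a and b could fail to be respected.
  have key := congrArg (lift (R := R) (fun x : Gen j X d =>
    if x = a then FreeMonoid.of true else if x = b then FreeMonoid.of false else 1) (by
      intro x y hxy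
      by_cases hxa : x = a <;> by_cases hya : y = a <;> by_cases hxb : x = b <;>
        by_cases hyb : y = b <;> simp_all
      · exact absurd hxy.symm hn)) h
  simp only [map_mul, lift_of, if_true, if_neg hab'] at key
  exact absurd (congrArg FreeMonoid.toList key) (by simp)

/-- The homomorphism given by postcomposition. -/
def map (f : d ⟶ d') : GenMonoid R j X d →* GenMonoid R j X d' :=
  lift (fun a => of R (a.map f)) fun _ _ h => of_mul_of (h.map f)

theorem map_of (f : d ⟶ d') (a : Gen j X d) : map f (of R a) = of R (a.map f) := rfl

/-- By fullness the generators at objects of C are morphisms of C. Composed with f₁ and f₂ they form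
an orthogonal pair in C, hence are related through c and its identity. -/
theorem map_mul_map [j.Full] {c₁ c₂ c : C} {f₁ : c₁ ⟶ c} {f₂ : c₂ ⟶ c}
    (h : (R.pullback j).rel f₁ f₂) (x : GenMonoid R j X (j.obj c₁))
    (y : GenMonoid R j X (j.obj c₂)) :
    Commute (map (j.map f₁) x) (map (j.map f₂) y) := by
  induction x using induction with
  | h_one => rw [map_one]; exact Commute.one_left _
  | h_mul x x' hx hx' => rw [map_mul]; exact hx.mul_left hx'
  | h_of a =>
    induction y using induction with
    | h_one => rw [map_one]; exact Commute.one_right _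
    | h_mul y y' hy hy' => rw [map_mul]; exact hy.mul_right hy'
    | h_of b =>
      exact of_mul_of ⟨c, 𝟙 _, j.preimage a.hom ≫ f₁, j.preimage b.hom ≫ f₂, by simp [Gen.map],
        by simp [Gen.map], (R.pullback j).precomp _ _ h⟩

end GenMonoid

variable (M : Type u) [Category.{w} M] [MonoidalCategory M] [SymmetricCategory M]
  [MonoidalClosed M] [HasColimits M]

theorem genMonoid_hom_ext {R : Orthogonality D} {j : C ⥤ D} {X : Bool → C} {M : Type u}
    [Category.{w} M] [MonoidalCategory M] [SymmetricCategory M] [MonoidalClosed M]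
    [HasColimits M] {d : D} {Z : Mon M} {f g : copower M (GenMonoid R j X d) ⟶ Z}
    (h : ∀ a, Points.map f (copowerPoints (GenMonoid.of R a)) =
      Points.map g (copowerPoints (GenMonoid.of R a))) : f = g :=
  copower_mon_hom_ext (GenMonoid.hom_ext h)

/-- The functor sending `d` to the copower of the unit object by the monoid of generators. -/
noncomputable abbrev genFunctor : D ⥤ Mon M where
  obj d := copower M (GenMonoid R j X d)
  map f := copowerDesc (copowerPoints.comp (GenMonoid.map f))
  map_id d := genMonoid_hom_ext fun a => by
    rw [map_copowerDesc, MonoidHom.comp_apply, GenMonoid.map_of, Gen.map_id, Points.map_id]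
  map_comp f g := genMonoid_hom_ext fun a => by
    rw [Points.map_comp, map_copowerDesc, map_copowerDesc, MonoidHom.comp_apply,
      MonoidHom.comp_apply, GenMonoid.map_of, GenMonoid.map_of, map_copowerDesc,
      MonoidHom.comp_apply, GenMonoid.map_of, Gen.map_comp]

variable {M R j X}

theorem copowerι_genFunctor_map {d d' : D} (f : d ⟶ d') (s : GenMonoid R j X d) :
    copowerι s ≫ ((genFunctor R j X M).map f).hom = copowerι (GenMonoid.map f s) :=
  copowerι_lift _ _

theorem genFunctor_map_points {d d' : D} (f : d ⟶ d') (a : Gen j X d) :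
    Points.map ((genFunctor R j X M).map f) (copowerPoints (GenMonoid.of R a)) =
      copowerPoints (GenMonoid.of R (a.map f)) :=
  map_copowerDesc _ _

theorem copowerι_tensor_genFunctor {d₁ d₂ d : D} (f₁ : d₁ ⟶ d) (f₂ : d₂ ⟶ d)
    (s : GenMonoid R j X d₁) (t : GenMonoid R j X d₂) :
    (copowerι s ⊗ₘ copowerι t) ≫
      (((genFunctor R j X M).map f₁).hom ⊗ₘ ((genFunctor R j X M).map f₂).hom) =
      copowerι (GenMonoid.map f₁ s) ⊗ₘ copowerι (GenMonoid.map f₂ t) :=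
  (tensorHom_comp_tensorHom _ _ _ _).trans
    (congrArg₂ (· ⊗ₘ ·) (copowerι_genFunctor_map f₁ s) (copowerι_genFunctor_map f₂ t))

theorem copowerι_tensor_genFunctor_assoc {d₁ d₂ d : D} (f₁ : d₁ ⟶ d) (f₂ : d₂ ⟶ d)
    (s : GenMonoid R j X d₁) (t : GenMonoid R j X d₂) {W : M}
    (k : copowerObj M (GenMonoid R j X d) ⊗ copowerObj M (GenMonoid R j X d) ⟶ W) :
    (copowerι s ⊗ₘ copowerι t) ≫
      (((genFunctor R j X M).map f₁).hom ⊗ₘ ((genFunctor R j X M).map f₂).hom) ≫ k =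
      (copowerι (GenMonoid.map f₁ s) ⊗ₘ copowerι (GenMonoid.map f₂ t)) ≫ k :=
  (Category.assoc _ _ _).symm.trans (copowerι_tensor_genFunctor f₁ f₂ s t =≫ k)

theorem isPerpCommutativeOver_genFunctor [j.Full] (c : C) :
    IsPerpCommutativeOver (R.pullback j) (j ⋙ genFunctor R j X M) c := by
  intro c₁ c₂ f₁ f₂ h
  refine copower_tensor_copower_hom_ext fun s t => ?_
  refine (copowerι_tensor_genFunctor_assoc (j.map f₁) (j.map f₂) s t _).trans
    (Eq.trans ?_ (copowerι_tensor_genFunctor_assoc (j.map f₁) (j.map f₂) s t _).symm)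
  refine (copowerι_tensor_mul _ _).trans (Eq.trans ?_ (copowerι_tensor_braiding_mul _ _).symm)
  rw [(GenMonoid.map_mul_map h s t).eq]

/-- Commutativity is tested on the identity generators at the two sources, whose images at d are a
and b. Injectivity of points carries the resulting equation back to the monoid. -/
theorem related_of_isPerpCommutativeOver_genFunctor
    (hM : (coprod.inl : 𝟙_ M ⟶ 𝟙_ M ⨿ 𝟙_ M) ≠ coprod.inr) {d : D}
    (hd : IsPerpCommutativeOver R (genFunctor R j X M) d) {a b : Gen j X d} (hab : a.src ≠ b.src)
    (h : R.rel a.hom b.hom) : a.Related R b := by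
  refine GenMonoid.related_of_mul_of hab (copowerι_injective hM ?_)
  have key := (copowerι (GenMonoid.of R (⟨a.src, 𝟙 _⟩ : Gen j X (j.obj (X a.src)))) ⊗ₘ
    copowerι (GenMonoid.of R (⟨b.src, 𝟙 _⟩ : Gen j X (j.obj (X b.src))))) ≫= hd _ _ _ _ h
  have key' := ((copowerι_tensor_genFunctor_assoc _ _ _ _ _).symm.trans key).trans
    (copowerι_tensor_genFunctor_assoc _ _ _ _ _)
  have key'' := ((copowerι_tensor_mul _ _).symm.trans key').trans
    (copowerι_tensor_braiding_mul _ _)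
  rw [cancel_epi] at key''
  rwa [GenMonoid.map_of, GenMonoid.map_of, Gen.mk_id_map, Gen.mk_id_map] at key''

/-! ### The functor of commuting points as a Kan extension of its restriction -/

section Extension

variable {G : D ⥤ Mon M} (β : j ⋙ genFunctor R j X M ⟶ j ⋙ G)

/-- The point of `G` at `d` given by a generator. -/
noncomputable def genPoint {d : D} (a : Gen j X d) : Points (G.obj d) :=
  Points.map (G.map a.hom)
    (Points.map (β.app (X a.src)) (copowerPoints (GenMonoid.of R ⟨a.src, 𝟙 _⟩)))

theorem genPoint_map {d d' : D} (f : d ⟶ d') (a : Gen j X d) :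
    genPoint β (a.map f) = Points.map (G.map f) (genPoint β a) := by
  rw [genPoint, genPoint, ← Points.map_comp (G.map a.hom), ← G.map_comp]
  rfl

theorem genPoint_of_map {b : Bool} {c : C} (f : X b ⟶ c) :
    genPoint β ⟨b, j.map f⟩ =
      Points.map (β.app c) (copowerPoints (GenMonoid.of R ⟨b, j.map f⟩)) := by
  have e := β.naturality f
  have h := genFunctor_map_points (R := R) (M := M) (j.map f) (⟨b, 𝟙 _⟩ : Gen j X (j.obj (X b)))
  rw [Gen.mk_id_map] at h
  rw [← h]
  exact ((Points.map_comp _ _ _).symm.trans (congrArg (fun k => Points.map k _) e.symm)).trans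
    (Points.map_comp _ _ _)

/-- Related generators already commute in the monoid at some object c of C. The images under `β.app
c` and then under G commute as well, so G itself needs no commutativity. -/
theorem genPoint_mul {d : D} {a b : Gen j X d} (h : a.Related R b) :
    genPoint β a * genPoint β b = genPoint β b * genPoint β a := by
  obtain ⟨b₁, g₁⟩ := a
  obtain ⟨b₂, g₂⟩ := b
  obtain ⟨c, g, f₁, f₂, h₁, h₂, h⟩ := h
  change X b₁ ⟶ c at f₁
  change X b₂ ⟶ c at f₂
  obtain rfl : j.map f₁ ≫ g = g₁ := h₁
  obtain rfl : j.map f₂ ≫ g = g₂ := h₂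
  have e := GenMonoid.of_mul_of (R := R) (a := (⟨b₁, j.map f₁⟩ : Gen j X (j.obj c)))
    (b := ⟨b₂, j.map f₂⟩) ⟨c, 𝟙 _, f₁, f₂, Category.comp_id _, Category.comp_id _, h⟩
  have e₁ := genPoint_map β g ⟨b₁, j.map f₁⟩
  have e₂ := genPoint_map β g ⟨b₂, j.map f₂⟩
  rw [genPoint_of_map] at e₁ e₂
  refine Eq.trans (congrArg₂ (· * ·) e₁ e₂) (Eq.trans ?_ (congrArg₂ (· * ·) e₂ e₁).symm)
  rw [← map_mul, ← map_mul, ← map_mul, ← map_mul, ← map_mul, ← map_mul]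
  exact congrArg (fun s => Points.map (G.map g) (Points.map (β.app c) (copowerPoints s))) e

/-- The extension of a natural transformation from `C` to `D`. -/
noncomputable def genDesc : genFunctor R j X M ⟶ G where
  app d := copowerDesc (GenMonoid.lift (genPoint β) fun _ _ h => genPoint_mul β h)
  naturality d d' f := genMonoid_hom_ext fun a => by
    rw [Points.map_comp, Points.map_comp, genFunctor_map_points, map_copowerDesc, map_copowerDesc,
      GenMonoid.lift_of, GenMonoid.lift_of, genPoint_map]

/-- Every generator is the image of an identity generator at an object of C, where θ is prescribed
by β; this gives uniqueness. Fullness ensures that the extension built this way restricts to β. -/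
theorem existsUnique_genFunctor [j.Full] :
    ∃! θ : genFunctor R j X M ⟶ G, Functor.whiskerLeft j θ = β := by
  refine ⟨genDesc β, ?_, fun θ hθ => ?_⟩
  · ext1
    ext1 c
    refine genMonoid_hom_ext fun ⟨b, g⟩ => ?_
    obtain ⟨f, rfl⟩ := j.map_surjective g
    exact (map_copowerDesc _ _).trans (genPoint_of_map β f)
  · ext1
    ext1 d
    refine genMonoid_hom_ext fun a => ?_
    refine Eq.trans ?_ (map_copowerDesc _ _).symm
    subst hθ
    have h := genFunctor_map_points (R := R) (M := M) a.hom ⟨a.src, 𝟙 _⟩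
    rw [Gen.mk_id_map] at h
    rw [← h]
    exact ((Points.map_comp _ _ _).symm.trans
      (congrArg (fun k => Points.map k _) (θ.naturality a.hom))).trans (Points.map_comp _ _ _)

end Extension

theorem isLeftKanExtension_genFunctor [j.Full] {A : C ⥤ Mon M}
    (i : A ≅ j ⋙ genFunctor R j X M) : (genFunctor R j X M).IsLeftKanExtension i.hom :=
  isLeftKanExtension_of_existsUnique _ fun G β => by
    obtain ⟨θ, hθ, hu⟩ := existsUnique_genFunctor (i.inv ≫ β)
    exact ⟨θ, (congrArg (i.hom ≫ ·) hθ).trans (Iso.hom_inv_id_assoc _ _), fun θ' h =>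
      hu _ ((Iso.inv_hom_id_assoc i _).symm.trans (congrArg (i.inv ≫ ·) h))⟩

variable (R j) (M) in
-- A single test algebra per pair suffices: the restriction to C of the functor generated by the two
-- sources.
theorem isClosedAt_of_isPerpCommutativeOver [j.Full]
    (hM : (coprod.inl : 𝟙_ M ⟶ 𝟙_ M ⨿ 𝟙_ M) ≠ coprod.inr) {d : D}
    (h : ∀ (A : Alg (R.pullback j) M) (L : D ⥤ Mon M)
      (α : (underlying (R.pullback j) M).obj A ⟶ j ⋙ L),
      L.IsLeftKanExtension α → IsPerpCommutativeOver R L d) :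
    IsClosedAt R j d := by
  intro c₁ c₂ g₁ g₂ hg
  -- Indexing by `Bool` keeps the two generators distinct even when c₁ = c₂ and g₁ = g₂.
  let X : Bool → C := fun b => cond b c₁ c₂
  have hd := h (toAlg (R.pullback j) (j ⋙ genFunctor R j X M) isPerpCommutativeOver_genFunctor)
    (genFunctor R j X M) _ (isLeftKanExtension_genFunctor (underlyingToAlg _ _ _))
  exact related_of_isPerpCommutativeOver_genFunctor hM hd (a := ⟨true, g₁⟩) (b := ⟨false, g₂⟩)
    (by simp) hg

end Generators

end QFTOperad

/-! ### The comparison theorem -/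

theorem theorem6p4 {D : Type w} [SmallCategory D] (R : QFTOperad.Orthogonality D)
    (P : ObjectProperty D) {M : Type u} [Category.{w} M] [MonoidalCategory M]
    [SymmetricCategory M] [MonoidalClosed M] [HasLimits M] [HasColimits M] :
    ((coprod.inl : 𝟙_ M ⟶ 𝟙_ M ⨿ 𝟙_ M) ≠ coprod.inr →
      ∀ d : D,
        (∀ (A : QFTOperad.Alg (R.pullback P.ι) M) (L : D ⥤ Mon M)
          (α : (QFTOperad.underlying (R.pullback P.ι) M).obj A ⟶ P.ι ⋙ L),
          L.IsLeftKanExtension α → QFTOperad.IsPerpCommutativeOver R L d) ↔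
        QFTOperad.IsClosedAt R P.ι d) ∧
    (∀ (A : QFTOperad.Alg (R.pullback P.ι) M) (L : D ⥤ Mon M)
      (α : (QFTOperad.underlying (R.pullback P.ι) M).obj A ⟶ P.ι ⋙ L),
      L.IsLeftKanExtension α → (∀ d : D, QFTOperad.IsPerpCommutativeOver R L d) →
        (∃ (B : QFTOperad.Alg R M) (η : A ⟶ (QFTOperad.restriction P.ι R M).obj B),
          QFTOperad.IsOperadicExtension R P.ι A B η) ∧
        ∀ (B : QFTOperad.Alg R M) (η : A ⟶ (QFTOperad.restriction P.ι R M).obj B),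
          QFTOperad.IsOperadicExtension R P.ι A B η →
            Nonempty (L ≅ (QFTOperad.underlying R M).obj B)) := by
  refine ⟨fun hM d => ⟨fun h => ?_, fun hd A L α hα => ?_⟩, fun A L α hα hL => ⟨?_, ?_⟩⟩
  · exact QFTOperad.isClosedAt_of_isPerpCommutativeOver R P.ι M hM h
  · exact QFTOperad.isPerpCommutativeOver_of_isClosedAt
      (A := (QFTOperad.underlying (R.pullback P.ι) M).obj A) hd (fun c => A.isPerpCommutativeOver c) α
  · obtain ⟨θ, h⟩ := QFTOperad.exists_isOperadicExtension P.ι A L α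
      (QFTOperad.toAlg R L hL)
      (QFTOperad.underlyingToAlg R L hL)
    exact ⟨_, θ, h⟩
  -- An arbitrary operadic extension is isomorphic to the algebra built on L, since both have the
  -- same universal property.
  · intro B θ h
    obtain ⟨θ', h'⟩ := QFTOperad.exists_isOperadicExtension P.ι A L α
      (QFTOperad.toAlg R L hL)
      (QFTOperad.underlyingToAlg R L hL)
    obtain ⟨e⟩ := QFTOperad.IsOperadicExtension.nonempty_iso P.ι h' h
    exact ⟨(QFTOperad.underlyingToAlg R L hL).symm ≪≫ (QFTOperad.underlying R M).mapIso e⟩
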